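/- **Setting.** Let $q\in\{0,1\}$ and let $L$ be meromorphic on $\mathbb C$, holomorphic except for a pole of order $q$ at $x=1$ (with $L(1)\neq 0$ if $q=0$), nonvanishing for $\operatorname{Re}x>1$, and with a logarithm there satisfying $(\log L)^{(n)}(x)=O(x^{-N})$ as $x\to+\infty$ for all $n,N\ge 0$. Let $\mathbf G,\Xi$ be entire functions of order $1$ with $\mathbf G(x)\Xi(x)=(x-1)^qL(x)$ and $\Xi(x)=\Xi(1-x)$, such that the zeros $x_k$ of $\mathbf G$ lie in $\{\operatorname{Re}x\le 0\}$ and the zeros $\rho$ of $\Xi$ are non-real and lie in $\{0<\operatorname{Re}x<1\}$. Write the latter as $\rho=\frac12\pm i\tau_k$ $(k=1,2,\dots)$ with $\operatorname{Re}\tau_k>0$. All zeros are counted with multiplicity. Assume that a holomorphic logarithm of $\mathbf G$ on $\{\operatorname{Re}x>0\}$ has, for $x\to+\infty$, the expansion $$-\log\mathbf G(x)\sim\tilde a_1x(\log x-1)+b_1x+\tilde a_0\log x+b_0+\sum_{n\ge1}a_{-n}x^{-n},$$ differentiable term by term any number of times. With principal powers define $$\mathscr Z(s,x)=\sum_\rho(x-\rho)^{-s},\quad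 \mathbf Z(s,x)=\sum_k(x-x_k)^{-s}\ (\operatorname{Re}s>1),\qquad \mathcal Z(\sigma,v)=\sum_k(\tau_k^2+v)^{-\sigma}\ (\operatorname{Re}\sigma>\tfrac12),$$ for parameters (called admissible for the respective family) such that no $x-\rho$, $x-x_k$, $\tau_k^2+v$ respectively lies in $(-\infty,0]$. At integer exponents these definitions only need $x-\rho\ne0$, $\tau_k^2+v\neq0$; and $\mathscr Z(1,x)=\sum_k\big[(x-\frac12-i\tau_k)^{-1}+(x-\frac12+i\tau_k)^{-1}\big]$, the zeros being grouped in pairs. Then the following hold. 1. For admissible parameters the three series converge absolutely in the stated half-planes and continue meromorphically in the exponent to all of $\mathbb C$, regularly at exponent $0$. Let $'$ be the derivative in the exponent, and put $\mathscr D(x)=e^{-\mathscr Z'(0,x)}$, $\mathbf D(x)=e^{-\mathbf Z'(0,x)}$, $\mathcal D(v)=e^{-\mathcal Z'(0,v)}$. 2. For every $v$ admissible for $\mathcal Z$, $\mathcal D(v)=e^{-(b_0+b_1/2)}\,\Xi(\tfrac12\pm v^{1/2})$; and $\mathcal D(v)=e^{b_1v^{1/2}}\mathscr D(\tfrac12+v^{1/2})$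 if moreover $\frac12+v^{1/2}$ is admissible for $\mathscr Z$. 3. With $v=(x-\frac12)^2$, whenever $x$ is admissible for $\mathbf Z$ and $v$ for $\mathcal Z$, $$(x-1)^qL(x)=e^{-b_1(x-1/2)}\,\mathbf D(x)\,\mathcal D(v)$$ (the left side being understood as its limit at $x=1$). 4. $\mathcal Z'(0,v)=\frac12b_1+b_0-\log\Xi(\frac12\pm v^{1/2})$: the function $v\mapsto\mathcal Z'(0,v)$ is analytic on the set of admissible $v$, and for $\operatorname{Re}x>1$ the point $v=(x-\frac12)^2$ is admissible and $\mathcal Z'(0,v)=\frac12b_1+b_0-[q\log(x-1)+\log L(x)-\log\mathbf G(x)]$, where the logarithms are those fixed above and $\log(x-1)$ is principal. 5. Let $\Xi(x)\neq0$ and $v=(x-\frac12)^2$. The series for $\mathscr Z(n,x)$ $(n\ge1)$ and $\mathcal Z(m,v)$ $(m\ge1)$ converge absolutely (for $n=1$, as a series over pairs). For $n=1,2,\dots$ $$\frac{\mathscr Z(n,x)}n=\sum_{0\le\ell\le n/2}(-1)^\ell\binom{n-\ell}{\ell}(2x-1)^{n-2\ell}\,\frac{\mathcal Z(n-\ell,v)}{n-\ell},$$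 and, for $m=1,2,\dots$, if $x\ne\frac12$, $$\mathcal Z(m,v)=\sum_{\ell=0}^{m-1}\binom{m+\ell-1}{m-1}(2x-1)^{-m-\ell}\,\mathscr Z(m-\ell,x),$$ whereas $\mathcal Z(m,0)=\frac12(-1)^m\mathscr Z(2m,\frac12)$. For each $x\neq\frac12$ the two systems are mutually inverse: for arbitrary complex sequences $A_n$, $B_m$ put in place of $\mathscr Z(n,x)$, $\mathcal Z(m,v)$, the first system (all $n\ge1$) holds if and only if the second one (all $m\ge1$) does. 6. Consequently, for $m\ge1$, with $\Xi(x)\ne0$, $x\ne\frac12$ and $v=(x-\frac12)^2$ (that is, $x=\frac12\pm v^{1/2}$, $v\neq 0$), $$\mathcal Z(m,v)=-\sum_{\ell=0}^{m-1}\binom{m+\ell-1}{m-1}\frac{(1-2x)^{-m-\ell}}{(m-\ell-1)!}(\log\Xi)^{(m-\ell)}(x),\qquad \mathcal Z(m,0)=\frac{(-1)^{m+1}}{2(2m-1)!}(\log\Xi)^{(2m)}(\tfrac12).$$ -/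

import Mathlib

open Filter Topology Asymptotics

/-- `μ` is the order of (growth of) the entire function `f`: the infimum of the exponents `ν ≥ 0`
with `f z = O(exp (|z| ^ ν))` as `|z| → ∞`. -/
def IsEntireOfOrder (f : ℂ → ℂ) (μ : ℝ) : Prop :=
  Differentiable ℂ f ∧
    IsGLB {ν : ℝ | 0 ≤ ν ∧
      f =O[Bornology.cobounded ℂ] fun z : ℂ => Real.exp (‖z‖ ^ ν)} μ

/-- `F` is the meromorphic continuation of the zeta function `∑ k, m k * (w k) ^ (-s)`, which
converges absolutely for `re s > a`, and `F` is regular at `s = 0`.  Powers are principal. -/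
structure IsZetaContinuation {ι : Type*} (m : ι → ℕ) (w : ι → ℂ) (a : ℝ) (F : ℂ → ℂ) : Prop where
  hasSum : ∀ s : ℂ, a < s.re → HasSum (fun k => (m k : ℂ) * w k ^ (-s)) (F s)
  meromorphic : Meromorphic F
  analyticAt_zero : AnalyticAt ℂ F 0

/-- Two continuations have the same germ at `0`, so that the derivative at `0` is well defined. -/
theorem IsZetaContinuation.deriv_zero_unique {ι : Type*} {m : ι → ℕ} {w : ι → ℂ} {a : ℝ}
    {F₁ F₂ : ℂ → ℂ} (h₁ : IsZetaContinuation m w a F₁) (h₂ : IsZetaContinuation m w a F₂) :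
    deriv F₁ 0 = deriv F₂ 0 := by
  have hm : MeromorphicOn (F₁ - F₂) Set.univ := fun x _ =>
    (h₁.meromorphic x).sub (h₂.meromorphic x)
  have hopen : IsOpen {s : ℂ | a < s.re} := isOpen_lt continuous_const Complex.continuous_re
  have hmem : ((a + 1 : ℝ) : ℂ) ∈ {s : ℂ | a < s.re} := by simp
  have htop : meromorphicOrderAt (F₁ - F₂) ((a + 1 : ℝ) : ℂ) = ⊤ := by
    rw [meromorphicOrderAt_eq_top_iff]
    filter_upwards [mem_nhdsWithin_of_mem_nhds (hopen.mem_nhds hmem)] with s hs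
    simp [(h₁.hasSum s hs).unique (h₂.hasSum s hs)]
  have h0 : meromorphicOrderAt (F₁ - F₂) 0 = ⊤ := by
    by_contra hne
    exact hm.meromorphicOrderAt_ne_top_of_isPreconnected isPreconnected_univ
      (Set.mem_univ _) (Set.mem_univ _) hne htop
  rw [meromorphicOrderAt_eq_top_iff] at h0
  have hev : F₁ =ᶠ[𝓝[≠] 0] F₂ := by
    filter_upwards [h0] with s hs
    simpa [sub_eq_zero] using hs
  have : F₁ =ᶠ[𝓝 0] F₂ := by
    have hc := (h₁.analyticAt_zero.frequently_eq_iff_eventually_eq h₂.analyticAt_zero).1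
      hev.frequently
    exact hc
  exact this.deriv_eq

open Classical in
/-- The derivative at `s = 0` of the continuation of `∑ k, m k * (w k) ^ (-s)`
(with value `0` if there is no continuation). -/
noncomputable def zetaDerivZero {ι : Type*} (m : ι → ℕ) (w : ι → ℂ) (a : ℝ) : ℂ :=
  if h : ∃ F, IsZetaContinuation m w a F then deriv h.choose 0 else 0

/-- `zetaDerivZero` is the derivative at `0` of any continuation. -/
theorem IsZetaContinuation.zetaDerivZero_eq {ι : Type*} {m : ι → ℕ} {w : ι → ℂ} {a : ℝ}
    {F : ℂ → ℂ} (h : IsZetaContinuation m w a F) : zetaDerivZero m w a = deriv F 0 := by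
  have hex : ∃ F, IsZetaContinuation m w a F := ⟨F, h⟩
  rw [zetaDerivZero, dif_pos hex]
  exact hex.choose_spec.deriv_zero_unique h

/-- A primary zeta or `L`-function `L`, with its trivial factor `G`, its completed function `Ξ`
and the coefficients of the Stirling expansion of `-log G`. -/
structure PrimaryFunction where
  /-- the primary function (its value at `1` is irrelevant if `1` is a pole) -/
  L : ℂ → ℂ
  /-- the order of the pole of `L` at `1` -/
  q : ℕ
  /-- the trivial factor -/
  G : ℂ → ℂ
  /-- the completed function -/
  Ξ : ℂ → ℂ
  /-- the determination of `log L` on `re x > 1` that tends to `0` at `+∞` -/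
  logL : ℂ → ℂ
  /-- the determination of `log G` on `re x > 0` that has the Stirling expansion below -/
  logG : ℂ → ℂ
  /-- coefficient of `x * (log x - 1)` in the expansion of `-log G` -/
  ta₁ : ℂ
  /-- coefficient of `log x` -/
  ta₀ : ℂ
  /-- coefficient of `x` -/
  b₁ : ℂ
  /-- constant coefficient -/
  b₀ : ℂ
  /-- `a j` is the coefficient of `x ^ (-j)`, for `j ≥ 1` -/
  a : ℕ → ℂ
  q_le : q ≤ 1
  differentiableAt_L : ∀ x : ℂ, x ≠ 1 → DifferentiableAt ℂ L x
  meromorphicAt_L : MeromorphicAt L 1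
  order_L : meromorphicOrderAt L 1 = ((-(q : ℤ) : ℤ) : WithTop ℤ)
  differentiableAt_L_one : q = 0 → DifferentiableAt ℂ L 1
  L_ne_zero : ∀ x : ℂ, 1 < x.re → L x ≠ 0
  /-- `logL` is a holomorphic logarithm of `L` on `re x > 1` ... -/
  differentiableOn_logL : DifferentiableOn ℂ logL {x : ℂ | 1 < x.re}
  exp_logL : ∀ x : ℂ, 1 < x.re → Complex.exp (logL x) = L x
  /-- ... all of whose derivatives are `O(x ^ (-∞))` as `x → +∞` -/
  logL_decay : ∀ n N : ℕ,
    (fun t : ℝ => iteratedDeriv n logL (t : ℂ)) =O[atTop] fun t : ℝ => t ^ (-(N : ℤ))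
  G_order : IsEntireOfOrder G 1
  Ξ_order : IsEntireOfOrder Ξ 1
  /-- `Ξ(x) = G(x)⁻¹ (x - 1) ^ q L(x)` -/
  G_mul_Ξ : ∀ x : ℂ, x ≠ 1 → G x * Ξ x = (x - 1) ^ q * L x
  /-- the functional equation -/
  Ξ_symm : ∀ x : ℂ, Ξ x = Ξ (1 - x)
  /-- the trivial zeros lie in `re x ≤ 0` -/
  trivial_zeros : ∀ x : ℂ, G x = 0 → x.re ≤ 0
  /-- the nontrivial zeros lie in the critical strip and are not real -/
  nontrivial_zeros : ∀ ρ : ℂ, Ξ ρ = 0 → 0 < ρ.re ∧ ρ.re < 1 ∧ ρ.im ≠ 0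
  /-- `logG` is a holomorphic logarithm of `G` on `re x > 0` ... -/
  differentiableOn_logG : DifferentiableOn ℂ logG {x : ℂ | 0 < x.re}
  exp_logG : ∀ x : ℂ, 0 < x.re → Complex.exp (logG x) = G x
  /-- ... with the asymptotic expansion, as `x → +∞`,
  `-log G ~ ta₁ x (log x - 1) + b₁ x + ta₀ log x + b₀ + ∑ j ≥ 1, a j x ^ (-j)`,
  indefinitely differentiable term by term -/
  stirling : ∀ n N : ℕ,
    (fun t : ℝ => iteratedDeriv n
      (fun x : ℂ => logG x + (ta₁ * (x * (Complex.log x - 1)) + b₁ * x + ta₀ * Complex.log x + b₀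
        + ∑ j ∈ Finset.Icc 1 N, a j * x ^ (-(j : ℤ)))) (t : ℂ))
      =O[atTop] fun t : ℝ => t ^ (-((N : ℤ) + 1 + n))

namespace PrimaryFunction

variable (P : PrimaryFunction)

/-- The nontrivial zeros. -/
abbrev Zeros : Type := {ρ : ℂ // P.Ξ ρ = 0}

/-- The nontrivial zeros `ρ = 1/2 + i τ` with `re τ > 0`; the others are the `1 - ρ`. -/
abbrev UpperZeros : Type := {ρ : ℂ // P.Ξ ρ = 0 ∧ 0 < ρ.im}

/-- The trivial zeros. -/
abbrev TrivialZeros : Type := {y : ℂ // P.G y = 0}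

/-- The multiplicity of a nontrivial zero. -/
noncomputable def mult (ρ : ℂ) : ℕ := analyticOrderNatAt P.Ξ ρ

/-- The multiplicity of a trivial zero. -/
noncomputable def trivialMult (y : ℂ) : ℕ := analyticOrderNatAt P.G y

/-- The `τ` with `ρ = 1/2 + i τ`. -/
noncomputable def tau (ρ : ℂ) : ℂ := -Complex.I * (ρ - 1 / 2)

/-! ### The zeta functions, for large exponents -/

/-- First family: `∑ (x - ρ) ^ (-s)` over all nontrivial zeros (`re s > 1`). -/
noncomputable def zetaFirst (s x : ℂ) : ℂ :=
  ∑' ρ : P.Zeros, (P.mult ρ : ℂ) * (x - ρ) ^ (-s)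

/-- First family at integers `n ≥ 1`; for `n = 1` the zeros `ρ` and `1 - ρ` are grouped. -/
noncomputable def zetaFirstInt (n : ℕ) (x : ℂ) : ℂ :=
  if n = 1 then ∑' ρ : P.UpperZeros, (P.mult ρ : ℂ) * ((x - ρ)⁻¹ + (x - 1 + ρ)⁻¹)
  else P.zetaFirst n x

/-- Second family: `∑ (τ_k ^ 2 + v) ^ (-σ)` over the zeros `1/2 ± i τ_k` (`re σ > 1/2`). -/
noncomputable def zetaSecond (σ v : ℂ) : ℂ :=
  ∑' ρ : P.UpperZeros, (P.mult ρ : ℂ) * (tau ρ ^ 2 + v) ^ (-σ)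

/-! ### The parameters for which the families are defined -/

/-- `x - ρ` avoids the half-line `(-∞, 0]` for every nontrivial zero `ρ`. -/
def FirstAdmissible (x : ℂ) : Prop := ∀ ρ : P.Zeros, x - ρ ∈ Complex.slitPlane

/-- `τ_k ^ 2 + v` avoids the half-line `(-∞, 0]` for every `k`. -/
def SecondAdmissible (v : ℂ) : Prop := ∀ ρ : P.UpperZeros, tau ρ ^ 2 + v ∈ Complex.slitPlane

/-- `x - y` avoids the half-line `(-∞, 0]` for every trivial zero `y`. -/
def TrivialAdmissible (x : ℂ) : Prop := ∀ y : P.TrivialZeros, x - y ∈ Complex.slitPlane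

/-! ### Meromorphic continuations and zeta-regularized products -/

/-- `F` continues `s ↦ ∑ (x - ρ) ^ (-s)` and is regular at `0`. -/
def IsFirstContinuation (x : ℂ) (F : ℂ → ℂ) : Prop :=
  IsZetaContinuation (fun ρ : P.Zeros => P.mult ρ) (fun ρ => x - ρ) 1 F

/-- `F` continues `σ ↦ ∑ (τ_k ^ 2 + v) ^ (-σ)` and is regular at `0`. -/
def IsSecondContinuation (v : ℂ) (F : ℂ → ℂ) : Prop :=
  IsZetaContinuation (fun ρ : P.UpperZeros => P.mult ρ) (fun ρ => tau ρ ^ 2 + v) (1 / 2) F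

/-- `F` continues `s ↦ ∑ (x - y) ^ (-s)`, over the trivial zeros, and is regular at `0`. -/
def IsTrivialContinuation (x : ℂ) (F : ℂ → ℂ) : Prop :=
  IsZetaContinuation (fun y : P.TrivialZeros => P.trivialMult y) (fun y => x - y) 1 F

/-- The derivative at exponent `0` of the first family. -/
noncomputable def zetaFirstDerivZero (x : ℂ) : ℂ :=
  zetaDerivZero (fun ρ : P.Zeros => P.mult ρ) (fun ρ => x - ρ) 1

/-- The derivative at exponent `0` of the second family. -/
noncomputable def zetaSecondDerivZero (v : ℂ) : ℂ :=
  zetaDerivZero (fun ρ : P.UpperZeros => P.mult ρ) (fun ρ => tau ρ ^ 2 + v) (1 / 2)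

/-- The derivative at exponent `0` of the zeta function over the trivial zeros. -/
noncomputable def zetaTrivialDerivZero (x : ℂ) : ℂ :=
  zetaDerivZero (fun y : P.TrivialZeros => P.trivialMult y) (fun y => x - y) 1

/-- The zeta-regularized product over all nontrivial zeros, as a function of `x`. -/
noncomputable def detFirst (x : ℂ) : ℂ := Complex.exp (-P.zetaFirstDerivZero x)

/-- The zeta-regularized product over the pairs of nontrivial zeros, as a function of `v`. -/
noncomputable def detSecond (v : ℂ) : ℂ := Complex.exp (-P.zetaSecondDerivZero v)

/-- The zeta-regularized product over the trivial zeros. -/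
noncomputable def detTrivial (x : ℂ) : ℂ := Complex.exp (-P.zetaTrivialDerivZero x)

/-! ### Logarithms of `Ξ` -/

/-- The `n`-th derivative of `log Ξ`, for `n ≥ 1`, where `Ξ` does not vanish. -/
noncomputable def logXiDeriv (n : ℕ) (x : ℂ) : ℂ := iteratedDeriv (n - 1) (logDeriv P.Ξ) x

/-- The determination of `log Ξ = q log (x - 1) + log L - log G` on `re x > 1`. -/
noncomputable def logXi (x : ℂ) : ℂ := P.q * Complex.log (x - 1) + P.logL x - P.logG x

end PrimaryFunction

/-! ### Zeros of entire functions -/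

/-! The functions $\mathbf G$ and $\Xi$ are instances of one situation: an entire $f$ of order at
most one, with its zeros to the left of $\operatorname{Re}x=2$, and a logarithm $\varphi$ of $f$ on
$\operatorname{Re}x>1$ with a Stirling expansion whose linear and constant terms are $bx+c$. For
$\Xi$ the expansion is that of $-\log\mathbf G$ plus $q\log(x-1)$, because $\log L$ and its
derivatives decay faster than any power.

Hadamard's theory, obtained here from Landau's factorization on growing discs, gives
$-\varphi''(x)=\sum m_\rho(x-\rho)^{-2}$. At the base point $2$ all the numbers $w=2-\rho$ lie in
the right half-plane, and integrating term by term shows that the Mellin transform of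
$y\mapsto-\varphi''(2+y)$ at $2-s$ is $\Gamma(s)\Gamma(2-s)\sum m_\rho w^{-s}$ for
$1<\operatorname{Re}s<2$. Subtracting finitely many terms of the expansion of $\varphi''$ pushes the
domain to the left and continues the zeta function (`ConvergesBeyond.mellin_isStripContinuation`,
`exists_isZetaContinuation`). Its derivative at $0$ is an explicit integral; integration by parts
evaluates it from the boundary terms at infinity, which are the Stirling constants:
$F'(0)=-\varphi(2)+c+2b$. The binomial expansion of $(w+x-2)^{-s}$ moves the base point from $2$ to
$x$. It adds a convergent sum of logarithms, which exponentiates to the Hadamard product, so that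
$e^{-F'(0)}=f(x)e^{-c-bx}$ (`GrowthAtMostOne.exp_neg_deriv_zero`).

For the second family, the zeros are grouped in pairs $\rho,1-\rho$. At $v=0$ the principal powers
of $\pm i\tau$ combine to $\mathcal Z(\sigma,0)=\mathscr Z(2\sigma,\tfrac12)/(2\cos\pi\sigma)$, and
the derivatives at $0$ agree. The numbers $\tau^2$ have exponent of convergence at most
$\tfrac12<1$, so translation by $v$ costs only $\sum(\log\tau^2-\log(\tau^2+v))$. The Hadamard
product centred at the symmetry point $\tfrac12$, where $\Xi'/\Xi$ vanishes, turns this into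
$\Xi(x)/\Xi(\tfrac12)$ (`PrimaryFunction.detSecond_eq`). The factorization of $(x-1)^qL$ is the
product of the two determinants. For the logarithmic form, two determinations of one logarithm on a
half-plane differ by a constant, which is found at $x=2$, where the principal logarithms of a pair
add without a jump.

At integer exponents, $a=x-\rho$ and $b=x-1+\rho$ have sum $2x-1$ and product $\tau^2+v$. Waring's
formula expresses $a^{-n}+b^{-n}$ through powers of $(ab)^{-1}$, and a partial fraction identity
inverts it; summation over the pairs relates the two families. Since the sum $2x-1$ is fixed and the
product is free, the inversion is an identity of polynomials, and linearity extends it to arbitrary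
sequences. The derivatives of $\log\Xi$ enter because $\mathscr
Z(n,x)=(-1)^{n-1}(\log\Xi)^{(n)}(x)/(n-1)!$. -/

theorem analyticOrderAt_ne_top_of_differentiable {f : ℂ → ℂ} (hf : Differentiable ℂ f) {c : ℂ}
    (hc : f c ≠ 0) (z : ℂ) : analyticOrderAt f z ≠ ⊤ := by
  intro h
  have han : AnalyticOnNhd ℂ f Set.univ := fun z _ => hf.analyticAt z
  have h0 : f =ᶠ[𝓝 z] 0 := by
    rw [analyticOrderAt_eq_top] at h
    exact h
  have := han.eqOn_zero_of_preconnected_of_eventuallyEq_zero isPreconnected_univ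
    (Set.mem_univ z) h0
  exact hc (this (Set.mem_univ c))

theorem analyticOrderNatAt_pos {f : ℂ → ℂ} (hf : Differentiable ℂ f) {c : ℂ}
    (hc : f c ≠ 0) {z : ℂ} (hz : f z = 0) : 1 ≤ analyticOrderNatAt f z := by
  rw [Nat.one_le_iff_ne_zero]
  intro h
  have h1 : analyticOrderAt f z = 0 := by
    rw [← Nat.cast_analyticOrderNatAt (analyticOrderAt_ne_top_of_differentiable hf hc z), h]
    rfl
  rw [(hf.analyticAt z).analyticOrderAt_eq_zero] at h1
  exact h1 hz

theorem finite_zeros_inter {f : ℂ → ℂ} (hf : Differentiable ℂ f) {c : ℂ}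
    (hc : f c ≠ 0) {K : Set ℂ} (hK : IsCompact K) : {z | z ∈ K ∧ f z = 0}.Finite := by
  have han : AnalyticOnNhd ℂ f Set.univ := fun z _ => hf.analyticAt z
  have h := han.preimage_zero_mem_codiscrete hc
  have h2 := hK.finite_sdiff_of_mem_codiscreteWithin
    (Filter.codiscreteWithin_mono (Set.subset_univ K) h)
  refine h2.subset fun z hz => ?_
  simpa using hz

/-- Splitting off finitely many zeros of an entire function. -/
theorem exists_eq_prod_mul_of_finset {f : ℂ → ℂ} (hf : Differentiable ℂ f) {c : ℂ}
    (hc : f c ≠ 0) (S : Finset ℂ) :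
    ∃ h : ℂ → ℂ, Differentiable ℂ h ∧
      (∀ z, f z = (∏ ρ ∈ S, (z - ρ) ^ analyticOrderNatAt f ρ) * h z) ∧ ∀ ρ ∈ S, h ρ ≠ 0 := by
  classical
  induction S using Finset.induction_on with
  | empty => exact ⟨f, hf, by simp, by simp⟩
  | insert ρ₀ S hρ ih =>
    obtain ⟨h, hd, hprod, hne⟩ := ih
    have hfun : f = (fun z => ∏ ρ ∈ S, (z - ρ) ^ analyticOrderNatAt f ρ) * h := funext hprod
    have hPan : AnalyticAt ℂ (fun z => ∏ ρ ∈ S, (z - ρ) ^ analyticOrderNatAt f ρ) ρ₀ := by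
      apply Differentiable.analyticAt
      fun_prop
    have hPne : (fun z => ∏ ρ ∈ S, (z - ρ) ^ analyticOrderNatAt f ρ) ρ₀ ≠ 0 := by
      simp only [Finset.prod_ne_zero_iff]
      intro ρ hρS
      apply pow_ne_zero
      rw [sub_ne_zero]
      rintro rfl
      exact hρ hρS
    have hord : analyticOrderAt f ρ₀ = analyticOrderAt h ρ₀ := by
      conv_lhs => rw [hfun]
      rw [analyticOrderAt_mul hPan (hd.analyticAt _), hPan.analyticOrderAt_eq_zero.2 hPne, zero_add]
    have htop := analyticOrderAt_ne_top_of_differentiable hf hc ρ₀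
    have hn : analyticOrderAt h ρ₀ = (analyticOrderNatAt f ρ₀ : ℕ) := by
      rw [← hord, Nat.cast_analyticOrderNatAt htop]
    obtain ⟨g, hg, hg0, hgeq⟩ := (hd.analyticAt ρ₀).analyticOrderAt_eq_natCast.1 hn
    set n := analyticOrderNatAt f ρ₀ with hndef
    -- The quotient by $(z-\rho_0)^n$, completed at $\rho_0$ by the value of the nonvanishing local
    -- factor, so that the singularity is removed.
    let k : ℂ → ℂ := fun z => if z = ρ₀ then g ρ₀ else h z / (z - ρ₀) ^ n
    have hk0 : k ρ₀ = g ρ₀ := by simp [k]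
    have hkg : k =ᶠ[𝓝 ρ₀] g := by
      filter_upwards [hgeq] with z hz
      by_cases hzz : z = ρ₀
      · simp [k, hzz]
      · have : (z - ρ₀) ^ n ≠ 0 := pow_ne_zero _ (sub_ne_zero.2 hzz)
        simp only [k, hzz, if_false, hz, smul_eq_mul]
        field_simp
    have hmul : ∀ z, h z = (z - ρ₀) ^ n * k z := by
      intro z
      by_cases hzz : z = ρ₀
      · have := hgeq.self_of_nhds
        rw [hzz, hk0, this, smul_eq_mul]
      · have : (z - ρ₀) ^ n ≠ 0 := pow_ne_zero _ (sub_ne_zero.2 hzz)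
        simp only [k, hzz, if_false]
        field_simp
    refine ⟨k, ?_, ?_, ?_⟩
    · intro z
      by_cases hzz : z = ρ₀
      · rw [hzz]
        exact (hg.congr hkg.symm).differentiableAt
      · have hev : k =ᶠ[𝓝 z] fun z => h z / (z - ρ₀) ^ n := by
          filter_upwards [isOpen_ne.mem_nhds hzz] with w hw
          simp only [k, if_neg hw]
        refine DifferentiableAt.congr_of_eventuallyEq ?_ hev
        exact (hd z).div (by fun_prop) (pow_ne_zero _ (sub_ne_zero.2 hzz))
    · intro z
      rw [Finset.prod_insert hρ, hprod z, hmul z]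
      ring
    · intro ρ hρS
      rcases Finset.mem_insert.1 hρS with rfl | hS
      · rwa [hk0]
      · intro hk
        apply hne ρ hS
        rw [hmul, hk, mul_zero]

/-- A zero-free holomorphic function on a disc has a holomorphic logarithm. -/
theorem exists_exp_eq_of_ne_zero {h : ℂ → ℂ} {c : ℂ} {R : ℝ} (hR : 0 < R)
    (hd : DifferentiableOn ℂ h (Metric.ball c R)) (hne : ∀ z ∈ Metric.ball c R, h z ≠ 0) :
    ∃ g : ℂ → ℂ, DifferentiableOn ℂ g (Metric.ball c R) ∧ g c = 0 ∧
      ∀ z ∈ Metric.ball c R, h z = h c * Complex.exp (g z) := by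
  have hd' : DifferentiableOn ℂ (fun z => deriv h z / h z) (Metric.ball c R) :=
    (hd.deriv Metric.isOpen_ball).div hd hne
  obtain ⟨g, hg0, hg⟩ := hd'.isExactOn_ball.with_val_at c 0
  have hgd : DifferentiableOn ℂ g (Metric.ball c R) := fun z hz =>
    (hg z hz).differentiableAt.differentiableWithinAt
  refine ⟨g, hgd, hg0, ?_⟩
  have hc : c ∈ Metric.ball c R := Metric.mem_ball_self hR
  have hconst : ∀ z ∈ Metric.ball c R, h z * Complex.exp (-g z) = h c * Complex.exp (-g c) := by
    intro z hz
    refine (convex_ball c R).is_const_of_fderivWithin_eq_zero (𝕜 := ℂ)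
      (f := fun z => h z * Complex.exp (-g z)) (hd.mul hgd.neg.cexp) ?_ hz hc
    intro w hw
    rw [fderivWithin_of_isOpen Metric.isOpen_ball hw]
    have h1 : HasDerivAt h (deriv h w) w :=
      (hd.differentiableAt (Metric.isOpen_ball.mem_nhds hw)).hasDerivAt
    have h2 := h1.mul ((hg w hw).neg.cexp)
    have h3 : deriv h w * Complex.exp (-g w) + h w * (Complex.exp (-g w) * -(deriv h w / h w)) = 0 := by
      field_simp [hne w hw]
      ring
    have h4 : HasDerivAt (fun z => h z * Complex.exp (-g z)) 0 w := by
      rw [← h3]; exact h2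
    have h5 := h4.hasFDerivAt.fderiv
    rw [h5]
    ext; simp
  intro z hz
  have := hconst z hz
  rw [hg0, neg_zero, Complex.exp_zero, mul_one] at this
  rw [← this, mul_assoc, ← Complex.exp_add]
  simp

/-- Landau's factorization of an entire function on a disc. -/
theorem exists_landau_factorization {f : ℂ → ℂ} (hf : Differentiable ℂ f) {c : ℂ}
    (hc : f c ≠ 0) {R B : ℝ} (hR : 0 < R)
    (hB : ∀ z ∈ Metric.closedBall c (4 * R), ‖f z‖ ≤ Real.exp B) (S : Finset ℂ)
    (hS : ∀ z, z ∈ S ↔ z ∈ Metric.closedBall c R ∧ f z = 0) :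
    (∑ ρ ∈ S, analyticOrderNatAt f ρ : ℕ) * Real.log 3 ≤ B - Real.log ‖f c‖ ∧
    ∃ g : ℂ → ℂ, DifferentiableOn ℂ g (Metric.ball c R) ∧ g c = 0 ∧
      (∀ z ∈ Metric.ball c R, f z = f c *
        (∏ ρ ∈ S, ((z - ρ) / (c - ρ)) ^ analyticOrderNatAt f ρ) * Complex.exp (g z)) ∧
      ∀ z ∈ Metric.ball c (R / 2), ‖g z‖ ≤ 2 * (B - Real.log ‖f c‖ + 1) := by
  obtain ⟨h, hd, hprod, hne⟩ := exists_eq_prod_mul_of_finset hf hc S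
  have hcρ : ∀ ρ ∈ S, c - ρ ≠ 0 := by
    intro ρ hρ h0
    rw [sub_eq_zero] at h0
    exact hc (h0 ▸ ((hS ρ).1 hρ).2)
  set N := ∑ ρ ∈ S, analyticOrderNatAt f ρ with hN
  set Q : ℂ := ∏ ρ ∈ S, (c - ρ) ^ analyticOrderNatAt f ρ with hQ
  have hQ0 : Q ≠ 0 := Finset.prod_ne_zero_iff.2 fun ρ hρ => pow_ne_zero _ (hcρ ρ hρ)
  set k : ℂ → ℂ := fun z => Q * h z with hk
  have hkd : Differentiable ℂ k := hd.const_mul Q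
  have hfk : ∀ z, f z = (∏ ρ ∈ S, ((z - ρ) / (c - ρ)) ^ analyticOrderNatAt f ρ) * k z := by
    intro z
    rw [hprod z, hk]
    simp only [div_pow, Finset.prod_div_distrib]
    rw [← hQ]
    field_simp
  have hkc : k c = f c := by
    rw [hfk c, Finset.prod_eq_one, one_mul]
    intro ρ hρ
    rw [div_self (hcρ ρ hρ), one_pow]
  have hfpos : 0 < ‖f c‖ := norm_pos_iff.2 hc
  -- On the sphere of radius $4R$ one has $|z-\rho|\ge3R$ and $|c-\rho|\le R$, so each quotient has
  -- modulus at least $3$. The maximum principle carries the gain $3^{-N}$ to the whole disc.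
  have hbd : ∀ z ∈ Metric.closedBall c (4 * R), ‖k z‖ ≤ Real.exp B / 3 ^ N := by
    have hR4 : (4 * R) ≠ 0 := by positivity
    have hfr : ∀ z ∈ frontier (Metric.ball c (4 * R)), ‖k z‖ ≤ Real.exp B / 3 ^ N := by
      intro z hz
      rw [frontier_ball c hR4, mem_sphere_iff_norm] at hz
      rw [le_div_iff₀ (by positivity), mul_comm]
      have h3 : (3 : ℝ) ^ N ≤ ‖∏ ρ ∈ S, ((z - ρ) / (c - ρ)) ^ analyticOrderNatAt f ρ‖ := by
        rw [norm_prod, hN, ← Finset.prod_pow_eq_pow_sum]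
        refine Finset.prod_le_prod (fun _ _ => by positivity) fun ρ hρ => ?_
        rw [norm_pow]
        refine pow_le_pow_left₀ (by norm_num) ?_ _
        rw [norm_div, le_div_iff₀ (norm_pos_iff.2 (hcρ ρ hρ))]
        have h1 : ‖ρ - c‖ ≤ R := by
          have := ((hS ρ).1 hρ).1
          rwa [mem_closedBall_iff_norm] at this
        have h2 : ‖z - c‖ ≤ ‖z - ρ‖ + ‖ρ - c‖ := by
          have := norm_add_le (z - ρ) (ρ - c)
          simpa using this
        rw [norm_sub_rev c ρ]
        linarith
      have h4 := hB z (by rw [mem_closedBall_iff_norm, hz])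
      rw [hfk z, norm_mul] at h4
      exact (mul_le_mul_of_nonneg_right h3 (norm_nonneg _)).trans h4
    intro z hz
    refine Complex.norm_le_of_forall_mem_frontier_norm_le Metric.isBounded_ball
      hkd.diffContOnCl hfr ?_
    rwa [closure_ball c hR4]
  -- At the centre `k` equals `f`, so the gain $3^{-N}$ is a bound for the number of zeros.
  have hcount : (N : ℝ) * Real.log 3 ≤ B - Real.log ‖f c‖ := by
    have h1 := hbd c (Metric.mem_closedBall_self (by positivity))
    rw [hkc, le_div_iff₀ (by positivity)] at h1
    have h2 := Real.log_le_log (by positivity) h1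
    rw [Real.log_mul hfpos.ne' (by positivity), Real.log_pow, Real.log_exp] at h2
    linarith
  refine ⟨hcount, ?_⟩
  have hkne : ∀ z ∈ Metric.ball c R, k z ≠ 0 := by
    intro z hz h0
    have hfz : f z = 0 := by rw [hfk, h0, mul_zero]
    have hzS : z ∈ S := (hS z).2 ⟨Metric.ball_subset_closedBall hz, hfz⟩
    rcases mul_eq_zero.1 h0 with h1 | h1
    · exact hQ0 h1
    · exact hne z hzS h1
  obtain ⟨g, hg, hg0, hgk⟩ := exists_exp_eq_of_ne_zero hR hkd.differentiableOn hkne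
  have hlog3 : 0 ≤ (N : ℝ) * Real.log 3 := by positivity
  refine ⟨g, hg, hg0, ?_, ?_⟩
  · intro z hz
    rw [hfk z, hgk z hz, hkc]
    ring
  -- The summand $1$ makes `A` strictly positive, as Borel–Carathéodory requires. On the half disc
  -- the ratio $|z-c|/(R-|z-c|)$ is at most $1$, which leaves the factor $2$.
  · set A := B - Real.log ‖f c‖ + 1 with hA
    have hApos : 0 < A := by linarith
    have hre : ∀ z ∈ Metric.ball c R, (g z).re ≤ A := by
      intro z hz
      have hz4 : z ∈ Metric.closedBall c (4 * R) := by
        rw [mem_ball_iff_norm] at hz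
        rw [mem_closedBall_iff_norm]
        linarith
      have h1 := hbd z hz4
      rw [hgk z hz, hkc, norm_mul, Complex.norm_exp] at h1
      have h2 : Real.exp B / 3 ^ N ≤ Real.exp B :=
        div_le_self (Real.exp_pos _).le (one_le_pow₀ (by norm_num))
      have h3 := Real.log_le_log (by positivity) (h1.trans h2)
      rw [Real.log_mul hfpos.ne' (Real.exp_pos _).ne', Real.log_exp, Real.log_exp] at h3
      linarith
    intro z hz
    have hmap : Set.MapsTo (fun w : ℂ => c + w) (Metric.ball 0 R) (Metric.ball c R) := by
      intro w hw
      rw [mem_ball_iff_norm] at hw ⊢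
      simpa using hw
    have hz' : ‖z - c‖ < R / 2 := by rwa [mem_ball_iff_norm] at hz
    have hBC := Complex.borelCaratheodory_zero (f := fun w => g (c + w)) (M := A) (R := R)
      (z := z - c) hApos (hg.comp (by fun_prop) hmap) (fun w hw => hre _ (hmap hw)) hR
      (by rw [mem_ball_zero_iff]; linarith) (by simpa using hg0)
    simp only [add_sub_cancel] at hBC
    refine hBC.trans ?_
    rw [div_le_iff₀ (by linarith)]
    have := norm_nonneg (z - c)
    nlinarith

/-! ### Exponents of convergence -/

/-- The points `w k`, with multiplicities `m k`, are nonzero and `∑ m k * |w k| ^ (-s)` converges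
for every real `s > a`. -/
structure ConvergesBeyond {ι : Type*} (m : ι → ℕ) (w : ι → ℂ) (a : ℝ) : Prop where
  one_le : ∀ k, 1 ≤ m k
  ne_zero : ∀ k, w k ≠ 0
  summable : ∀ s : ℝ, a < s → Summable fun k => (m k : ℝ) * ‖w k‖ ^ (-s)

namespace ConvergesBeyond

variable {ι : Type*} {m : ι → ℕ} {w : ι → ℂ} {a : ℝ}

/-- Multiplicities are at least one, so each term of a convergent series dominates $|w_k|^{-s}$ for
some $s>0$; only finitely many points can be bounded. -/
theorem tendsto_norm (h : ConvergesBeyond m w a) : Tendsto (fun k => ‖w k‖) cofinite atTop := by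
  rw [tendsto_atTop]
  intro b
  set B := max b 1 with hB
  have hB0 : 0 < B := lt_of_lt_of_le one_pos (le_max_right _ _)
  set s := max a 0 + 1 with hs
  have hs0 : 0 < s := by have := le_max_right a 0; linarith
  have hsa : a < s := by have := le_max_left a 0; linarith
  have ht := (h.summable s hsa).tendsto_cofinite_zero
  have hpos : 0 < B ^ (-s) := Real.rpow_pos_of_pos hB0 _
  filter_upwards [ht.eventually_lt_const hpos] with k hk
  refine (le_max_left b 1).trans ?_
  by_contra hlt
  rw [not_le] at hlt
  have hw : 0 < ‖w k‖ := norm_pos_iff.2 (h.ne_zero k)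
  have h1 : B ^ (-s) ≤ ‖w k‖ ^ (-s) :=
    Real.rpow_le_rpow_of_nonpos hw hlt.le (by linarith)
  have h2 : ‖w k‖ ^ (-s) ≤ (m k : ℝ) * ‖w k‖ ^ (-s) :=
    le_mul_of_one_le_left (by positivity) (by exact_mod_cast h.one_le k)
  linarith

theorem eventually_le_norm (h : ConvergesBeyond m w a) (B : ℝ) :
    ∀ᶠ k in cofinite, B ≤ ‖w k‖ :=
  h.tendsto_norm.eventually_ge_atTop B

theorem countable (h : ConvergesBeyond m w a) : Countable ι := by
  have h1 := (h.summable (a + 1) (by linarith)).countable_support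
  have h2 : (Function.support fun k => (m k : ℝ) * ‖w k‖ ^ (-(a + 1))) = Set.univ := by
    ext k
    simp only [Function.mem_support, Set.mem_univ, iff_true]
    have hw : 0 < ‖w k‖ := norm_pos_iff.2 (h.ne_zero k)
    have hm : 0 < (m k : ℝ) := by exact_mod_cast h.one_le k
    positivity
  rw [h2] at h1
  exact Set.countable_univ_iff.1 h1

/-- Cofinitely many points are moved by less than half of their modulus. -/
theorem eventually_half_le (h : ConvergesBeyond m w a) (b : ℂ) :
    ∀ᶠ k in cofinite, ‖w k‖ / 2 ≤ ‖w k + b‖ := by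
  filter_upwards [h.eventually_le_norm (2 * ‖b‖)] with k hk
  have := norm_sub_le (w k + b) b
  rw [add_sub_cancel_right] at this
  linarith

/-- Cofinitely many moduli are at worst halved. Since $a\ge0$ the exponents $s$ are positive, so
halving costs the factor $2^s$. -/
theorem add_const (ha : 0 ≤ a) (h : ConvergesBeyond m w a) {b : ℂ} (hb : ∀ k, w k + b ≠ 0) :
    ConvergesBeyond m (fun k => w k + b) a := by
  refine ⟨h.one_le, hb, fun s hs => ?_⟩
  refine Summable.of_norm_bounded_eventually ((h.summable s hs).mul_left (2 ^ s)) ?_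
  filter_upwards [h.eventually_half_le b] with k hk
  have hw : 0 < ‖w k‖ := norm_pos_iff.2 (h.ne_zero k)
  have h1 : ‖w k + b‖ ^ (-s) ≤ (‖w k‖ / 2) ^ (-s) :=
    Real.rpow_le_rpow_of_nonpos (by positivity) hk (by linarith)
  have h2 : (‖w k‖ / 2) ^ (-s) = 2 ^ s * ‖w k‖ ^ (-s) := by
    rw [Real.div_rpow hw.le (by norm_num), Real.rpow_neg (by norm_num : (0:ℝ) ≤ 2), div_inv_eq_mul,
      mul_comm]
  rw [Real.norm_of_nonneg (by positivity)]
  calc (m k : ℝ) * ‖w k + b‖ ^ (-s) ≤ m k * (2 ^ s * ‖w k‖ ^ (-s)) := by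
        rw [← h2]; gcongr
    _ = 2 ^ s * (m k * ‖w k‖ ^ (-s)) := by ring

theorem summable_pow (h : ConvergesBeyond m w a) {n : ℕ} (hn : a < n) :
    Summable fun k => (m k : ℝ) * (‖w k‖ ^ n)⁻¹ := by
  refine (h.summable n hn).congr fun k => ?_
  rw [Real.rpow_neg (norm_nonneg _), Real.rpow_natCast]

theorem summable_inv_pow (h : ConvergesBeyond m w a) {n : ℕ} (hn : a < n) :
    Summable fun k => (m k : ℂ) * (w k ^ n)⁻¹ := by
  refine Summable.of_norm_bounded (h.summable_pow hn) fun k => ?_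
  simp

end ConvergesBeyond

theorem norm_cpow_neg_le {z : ℂ} (hz : z ≠ 0) (s : ℂ) :
    ‖z ^ (-s)‖ ≤ ‖z‖ ^ (-s.re) * Real.exp (Real.pi * |s.im|) := by
  rw [Complex.norm_cpow_of_ne_zero hz, div_eq_mul_inv, ← Real.exp_neg]
  simp only [Complex.neg_re, Complex.neg_im]
  gcongr
  calc -(z.arg * -s.im) = z.arg * s.im := by ring
    _ ≤ |z.arg * s.im| := le_abs_self _
    _ = |z.arg| * |s.im| := abs_mul _ _
    _ ≤ Real.pi * |s.im| := by gcongr; exact Complex.abs_arg_le_pi z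

theorem ConvergesBeyond.summable_cpow {ι : Type*} {m : ι → ℕ} {w : ι → ℂ} {a : ℝ}
    (h : ConvergesBeyond m w a) {s : ℂ} (hs : a < s.re) :
    Summable fun k => (m k : ℂ) * w k ^ (-s) := by
  refine Summable.of_norm_bounded
    ((h.summable s.re hs).mul_right (Real.exp (Real.pi * |s.im|))) fun k => ?_
  rw [norm_mul, Complex.norm_natCast, mul_assoc]
  gcongr
  exact norm_cpow_neg_le (h.ne_zero k) s

/-! ### Zeros of entire functions of order at most one -/

theorem exists_zeros_finset {f : ℂ → ℂ} (hf : Differentiable ℂ f) {c : ℂ} (hc : f c ≠ 0) :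
    ∃ S : ℝ → Finset {z // f z = 0}, ∀ (R : ℝ) (ρ : {z // f z = 0}),
      ρ ∈ S R ↔ ‖(ρ : ℂ) - c‖ ≤ R := by
  have hfin : ∀ R : ℝ, {ρ : {z // f z = 0} | ‖(ρ : ℂ) - c‖ ≤ R}.Finite := by
    intro R
    have h := finite_zeros_inter hf hc (isCompact_closedBall c R)
    refine Set.Finite.of_finite_image (f := Subtype.val) (h.subset ?_)
      Subtype.val_injective.injOn
    rintro _ ⟨ρ, hρ, rfl⟩
    exact ⟨by rw [mem_closedBall_iff_norm]; exact hρ, ρ.2⟩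
  exact ⟨fun R => (hfin R).toFinset, fun R ρ => by simp⟩

theorem tendsto_zeros_finset {f : ℂ → ℂ} {c : ℂ} {S : ℝ → Finset {z // f z = 0}}
    (hS : ∀ (R : ℝ) (ρ : {z // f z = 0}), ρ ∈ S R ↔ ‖(ρ : ℂ) - c‖ ≤ R) :
    Tendsto S atTop atTop := by
  refine Filter.tendsto_atTop_finset_of_monotone (fun R R' hR ρ hρ => ?_) fun ρ =>
    ⟨‖(ρ : ℂ) - c‖, (hS _ _).2 le_rfl⟩
  rw [hS] at hρ ⊢
  exact hρ.trans hR

/-- Landau's factorization on all discs about `c`, with one constant for all radii. The zero count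
yields the exponent of convergence; the bound on the logarithm of the zero-free factor yields
Hadamard's theorem. -/
theorem exists_landau_family {f : ℂ → ℂ} (hf : Differentiable ℂ f) {c : ℂ} (hc : f c ≠ 0)
    {ν C : ℝ} (hν : 0 ≤ ν) (hC : ∀ z, ‖f z‖ ≤ Real.exp (C * (1 + ‖z‖) ^ ν))
    {S : ℝ → Finset {z // f z = 0}}
    (hS : ∀ (R : ℝ) (ρ : {z // f z = 0}), ρ ∈ S R ↔ ‖(ρ : ℂ) - c‖ ≤ R) :
    ∃ A : ℝ, 0 ≤ A ∧ ∀ R : ℝ, 1 ≤ R →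
      ((∑ ρ ∈ S R, analyticOrderNatAt f ρ : ℕ) : ℝ) ≤ A * R ^ ν ∧
      ∃ g : ℂ → ℂ, DifferentiableOn ℂ g (Metric.ball c R) ∧ g c = 0 ∧
        (∀ z ∈ Metric.ball c R, f z = f c *
          (∏ ρ ∈ S R, ((z - ρ) / (c - ρ)) ^ analyticOrderNatAt f ρ) * Complex.exp (g z)) ∧
        ∀ z ∈ Metric.ball c (R / 2), ‖g z‖ ≤ A * R ^ ν := by
  -- For $R\ge1$ and $|z-c|\le4R$ one has $1+|z|\le(5+|c|)R$.
  set D := |C| * (5 + ‖c‖) ^ ν with hD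
  set l := |Real.log ‖f c‖| with hl
  have hl' : -Real.log ‖f c‖ ≤ l := neg_le_abs _
  refine ⟨2 * (D + l + 1), by positivity, fun R hR => ?_⟩
  have hR0 : 0 < R := by linarith
  have hRν : 1 ≤ R ^ ν := Real.one_le_rpow hR hν
  have hB : ∀ z ∈ Metric.closedBall c (4 * R), ‖f z‖ ≤ Real.exp (D * R ^ ν) := by
    intro z hz
    rw [mem_closedBall_iff_norm] at hz
    refine (hC z).trans (Real.exp_le_exp.2 ?_)
    have h1 : ‖z‖ ≤ ‖z - c‖ + ‖c‖ := by simpa using norm_add_le (z - c) c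
    have h2 : 1 + ‖z‖ ≤ (5 + ‖c‖) * R := by nlinarith [norm_nonneg c]
    calc C * (1 + ‖z‖) ^ ν ≤ |C| * ((5 + ‖c‖) * R) ^ ν := by gcongr; exact le_abs_self C
      _ = D * R ^ ν := by rw [Real.mul_rpow (by positivity) hR0.le, hD]; ring
  obtain ⟨hcount, g, hg, hg0, hprod, hgb⟩ := exists_landau_factorization hf hc hR0 hB
    ((S R).map (Function.Embedding.subtype _)) (by
      intro z
      simp only [Finset.mem_map, Function.Embedding.subtype_apply, mem_closedBall_iff_norm]
      constructor
      · rintro ⟨ρ, hρ, rfl⟩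
        exact ⟨(hS R ρ).1 hρ, ρ.2⟩
      · rintro ⟨h1, h2⟩
        exact ⟨⟨z, h2⟩, (hS R ⟨z, h2⟩).2 h1, rfl⟩)
  simp only [Finset.sum_map, Finset.prod_map, Function.Embedding.subtype_apply] at hcount hprod
  have hbig : D * R ^ ν - Real.log ‖f c‖ + 1 ≤ (D + l + 1) * R ^ ν := by
    nlinarith [abs_nonneg (Real.log ‖f c‖)]
  refine ⟨?_, g, hg, hg0, hprod, fun z hz => (hgb z hz).trans (by linarith)⟩
  -- With $\log3\ge1$ the bound on $N\log3$ bounds $N$ itself.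
  have hlog3 : 1 ≤ Real.log 3 := by
    rw [Real.le_log_iff_exp_le (by norm_num)]
    linarith [Real.exp_one_lt_d9]
  have h0 : (0 : ℝ) ≤ ((∑ ρ ∈ S R, analyticOrderNatAt f ρ : ℕ) : ℝ) := Nat.cast_nonneg _
  have h5 : 0 ≤ (D + l + 1) * R ^ ν := by positivity
  nlinarith

/-- An entire function of order at most one. -/
def GrowthAtMostOne (f : ℂ → ℂ) : Prop :=
  ∀ ν : ℝ, 1 < ν → ∃ C, ∀ z, ‖f z‖ ≤ Real.exp (C * (1 + ‖z‖) ^ ν)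

theorem IsEntireOfOrder.growthAtMostOne {f : ℂ → ℂ} (h : IsEntireOfOrder f 1) :
    GrowthAtMostOne f := by
  intro ν hν
  obtain ⟨μ, ⟨hμ0, hμ⟩, -, hμν⟩ := h.2.exists_between hν
  obtain ⟨K, hK⟩ := hμ.bound
  obtain ⟨r, -, hr⟩ := Filter.hasBasis_cobounded_norm.eventually_iff.1 hK
  obtain ⟨K', hK'⟩ := (isCompact_closedBall (0 : ℂ) r).exists_bound_of_continuousOn
    h.1.continuous.continuousOn
  set T := max (max K K') 1 with hT
  have hT1 : 1 ≤ T := le_max_right _ _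
  refine ⟨Real.log T + 1, fun z => ?_⟩
  have hz1 : 1 ≤ 1 + ‖z‖ := by linarith [norm_nonneg z]
  have hpow1 : 1 ≤ (1 + ‖z‖) ^ ν := Real.one_le_rpow hz1 (by linarith)
  have hle : ‖z‖ ^ μ ≤ (1 + ‖z‖) ^ ν :=
    (Real.rpow_le_rpow (norm_nonneg _) (by linarith) hμ0).trans
      (Real.rpow_le_rpow_of_exponent_le hz1 hμν.le)
  have hmain : ‖f z‖ ≤ T * Real.exp ((1 + ‖z‖) ^ ν) := by
    rcases le_total r ‖z‖ with hz | hz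
    · have h1 := hr hz
      rw [Real.norm_of_nonneg (Real.exp_pos _).le] at h1
      refine h1.trans ?_
      gcongr
      exact (le_max_left _ _).trans (le_max_left _ _)
    · have h1 := hK' z (by simpa using hz)
      refine h1.trans (((le_max_right K K').trans (le_max_left _ 1)).trans ?_)
      exact le_mul_of_one_le_right (by linarith) (Real.one_le_exp (by positivity))
  refine hmain.trans ?_
  have hlog : 0 ≤ Real.log T := Real.log_nonneg hT1
  calc T * Real.exp ((1 + ‖z‖) ^ ν) = Real.exp (Real.log T + (1 + ‖z‖) ^ ν) := by
        rw [Real.exp_add, Real.exp_log (by linarith)]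
    _ ≤ Real.exp ((Real.log T + 1) * (1 + ‖z‖) ^ ν) := by
        rw [Real.exp_le_exp]
        nlinarith

/-- The exponent of convergence of the zeros of an entire function of order at most one. -/
theorem GrowthAtMostOne.convergesBeyond {f : ℂ → ℂ} (hgr : GrowthAtMostOne f)
    (hf : Differentiable ℂ f) {c : ℂ} (hc : f c ≠ 0) :
    ConvergesBeyond (fun ρ : {z // f z = 0} => analyticOrderNatAt f ρ) (fun ρ => c - ρ) 1 := by
  obtain ⟨S, hS⟩ := exists_zeros_finset hf hc
  refine ⟨fun ρ => analyticOrderNatAt_pos hf hc ρ.2, fun ρ h => ?_, fun s hs => ?_⟩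
  · rw [sub_eq_zero] at h
    exact hc (h ▸ ρ.2)
  -- An exponent strictly between $1$ and $s$: the zero count grows like $R^\nu$, and the dyadic
  -- shells then contribute a geometric series of ratio $2^{\nu-s}<1$.
  · set ν := (1 + s) / 2 with hν
    have hν1 : 1 < ν := by linarith
    have hνs : ν - s < 0 := by linarith
    obtain ⟨C, hC⟩ := hgr ν hν1
    obtain ⟨A, hA0, hA⟩ := exists_landau_family hf hc (by linarith) hC hS
    set q : ℝ := 2 ^ (ν - s) with hq
    have hq0 : 0 < q := by positivity
    have hq1 : q < 1 := Real.rpow_lt_one_of_one_lt_of_neg (by norm_num) hνs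
    have hgeo := summable_geometric_of_lt_one hq0.le hq1
    -- The finitely many zeros within distance one of `c` are dropped, so that the shells
    -- $2^n\le|\rho-c|<2^{n+1}$ with $n\ge0$ cover the rest.
    suffices hsum : Summable fun ρ : {z // f z = 0} =>
        if ‖(ρ : ℂ) - c‖ ≤ 1 then 0 else (analyticOrderNatAt f ρ : ℝ) * ‖c - (ρ : ℂ)‖ ^ (-s) by
      refine Summable.of_norm_bounded_eventually hsum ?_
      have hfin : {ρ : {z // f z = 0} | ‖(ρ : ℂ) - c‖ ≤ 1}.Finite :=
        (S 1).finite_toSet.subset fun ρ hρ => (hS 1 ρ).2 hρ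
      filter_upwards [hfin.compl_mem_cofinite] with ρ hρ
      rw [Set.mem_compl_iff, Set.mem_ofPred_eq] at hρ
      rw [if_neg hρ, Real.norm_of_nonneg (by positivity)]
    -- The shell of index $n$ contributes at most $2^{-ns}\cdot A\,2^{(n+1)\nu}=A\,2^\nu q^n$.
    refine summable_of_sum_le (c := A * 2 ^ ν * ∑' n : ℕ, q ^ n) (fun ρ => ?_) fun T => ?_
    · dsimp only
      split_ifs
      · exact le_rfl
      · show 0 ≤ _
        positivity
    · obtain ⟨J, hJ⟩ : ∃ J : ℕ, ∀ ρ ∈ T, ‖(ρ : ℂ) - c‖ ≤ (2 : ℝ) ^ J := by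
        obtain ⟨b, hb⟩ := (T.image fun ρ : {z // f z = 0} => ‖(ρ : ℂ) - c‖).bddAbove
        obtain ⟨J, hJ⟩ := pow_unbounded_of_one_lt b (one_lt_two (α := ℝ))
        exact ⟨J, fun ρ hρ => (hb (Finset.mem_coe.2
          (Finset.mem_image_of_mem _ hρ))).trans hJ.le⟩
      have hterm : ∀ ρ ∈ T, (if ‖(ρ : ℂ) - c‖ ≤ 1 then 0 else
          (analyticOrderNatAt f ρ : ℝ) * ‖c - (ρ : ℂ)‖ ^ (-s)) ≤
          ∑ n ∈ Finset.range (J + 1), ((2 : ℝ) ^ n) ^ (-s) *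
            (if ‖(ρ : ℂ) - c‖ ≤ (2 : ℝ) ^ (n + 1) then (analyticOrderNatAt f ρ : ℝ) else 0) := by
        intro ρ hρ
        have hnn : ∀ n ∈ Finset.range (J + 1), 0 ≤ ((2 : ℝ) ^ n) ^ (-s) *
            (if ‖(ρ : ℂ) - c‖ ≤ (2 : ℝ) ^ (n + 1) then (analyticOrderNatAt f ρ : ℝ) else 0) := by
          intro n _
          split_ifs <;> positivity
        split_ifs with h1
        · exact Finset.sum_nonneg hnn
        · rw [not_le] at h1
          obtain ⟨n, hn1, hn2⟩ := exists_nat_pow_near h1.le (one_lt_two (α := ℝ))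
          have hnJ : n ∈ Finset.range (J + 1) := by
            rw [Finset.mem_range, Nat.lt_succ_iff]
            exact (pow_le_pow_iff_right₀ (one_lt_two (α := ℝ))).1 (hn1.trans (hJ ρ hρ))
          refine le_trans ?_ (Finset.single_le_sum hnn hnJ)
          rw [if_pos hn2.le, mul_comm, norm_sub_rev c]
          gcongr ?_ * _
          exact Real.rpow_le_rpow_of_nonpos (by positivity) hn1 (by linarith)
      refine (Finset.sum_le_sum hterm).trans ?_
      rw [Finset.sum_comm]
      have hn : ∀ n ∈ Finset.range (J + 1), (∑ ρ ∈ T, ((2 : ℝ) ^ n) ^ (-s) *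
          (if ‖(ρ : ℂ) - c‖ ≤ (2 : ℝ) ^ (n + 1) then (analyticOrderNatAt f ρ : ℝ) else 0)) ≤
          A * 2 ^ ν * q ^ n := by
        intro n _
        rw [← Finset.mul_sum, ← Finset.sum_filter]
        have h1 : ∑ ρ ∈ T.filter (fun ρ : {z // f z = 0} => ‖(ρ : ℂ) - c‖ ≤ (2 : ℝ) ^ (n + 1)),
            (analyticOrderNatAt f ρ : ℝ) ≤ ∑ ρ ∈ S (2 ^ (n + 1)), (analyticOrderNatAt f ρ : ℝ) := by
          refine Finset.sum_le_sum_of_subset_of_nonneg (fun ρ hρ => ?_) fun _ _ _ =>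
            Nat.cast_nonneg _
          rw [hS]
          exact (Finset.mem_filter.1 hρ).2
        have h2 := (hA (2 ^ (n + 1)) (one_le_pow₀ one_le_two)).1
        push_cast at h2
        calc ((2 : ℝ) ^ n) ^ (-s) * _ ≤ ((2 : ℝ) ^ n) ^ (-s) * (A * (2 ^ (n + 1)) ^ ν) := by
              gcongr
              exact h1.trans h2
          _ = A * 2 ^ ν * q ^ n := by
              rw [hq, pow_succ, Real.mul_rpow (by positivity) (by norm_num),
                ← Real.rpow_natCast, ← Real.rpow_natCast, ← Real.rpow_mul (by norm_num),
                ← Real.rpow_mul (by norm_num), ← Real.rpow_mul (by norm_num)]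
              have : (2 : ℝ) ^ ((ν - s) * n) = 2 ^ ((n : ℝ) * -s) * 2 ^ ((n : ℝ) * ν) := by
                rw [← Real.rpow_add (by norm_num)]
                ring_nf
              rw [this]
              ring
      refine (Finset.sum_le_sum hn).trans ?_
      rw [← Finset.mul_sum]
      gcongr
      exact hgeo.sum_le_tsum _ fun _ _ => by positivity

/-! ### Hadamard's theorem for entire functions of order at most one -/

/-- Cauchy's estimate on circles of radius $R/8$: a logarithm of size $R^{3/2}$ has derivatives of
order $n\ge2$ of size $O(R^{3/2-2})$, which tends to $0$. This is where order at most one is used;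
only the affine part of the remainder can survive in the limit. -/
theorem GrowthAtMostOne.exists_remainder {f : ℂ → ℂ} (hgr : GrowthAtMostOne f)
    (hf : Differentiable ℂ f) {c : ℂ} (hc : f c ≠ 0) {S : ℝ → Finset {z // f z = 0}}
    (hS : ∀ (R : ℝ) (ρ : {z // f z = 0}), ρ ∈ S R ↔ ‖(ρ : ℂ) - c‖ ≤ R) :
    ∃ ε : ℝ → ℝ, Tendsto ε atTop (𝓝 0) ∧ ∃ G : ℝ → ℂ → ℂ, ∀ R : ℝ, 8 ≤ R →
      DifferentiableOn ℂ (G R) (Metric.ball c R) ∧ G R c = 0 ∧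
      (∀ z ∈ Metric.ball c R, f z = f c *
        (∏ ρ ∈ S R, ((z - ρ) / (c - ρ)) ^ analyticOrderNatAt f ρ) * Complex.exp (G R z)) ∧
      ∀ z ∈ Metric.ball c (R / 4), ∀ n : ℕ, 2 ≤ n →
        ‖iteratedDeriv n (G R) z‖ ≤ n.factorial * ε R := by
  obtain ⟨C, hC⟩ := hgr (3 / 2) (by norm_num)
  obtain ⟨A, hA0, hA⟩ := exists_landau_family hf hc (by norm_num) hC hS
  -- The constant $64$ is $8^2$, from the radius $R/8$ and the worst case $n=2$.
  refine ⟨fun R => 64 * A * R ^ (-(1 / 2) : ℝ), ?_, ?_⟩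
  · simpa using (tendsto_rpow_neg_atTop (by norm_num : (0 : ℝ) < 1 / 2)).const_mul (64 * A)
  · have hex : ∀ R : ℝ, ∃ g : ℂ → ℂ, 1 ≤ R → DifferentiableOn ℂ g (Metric.ball c R) ∧ g c = 0 ∧
        (∀ z ∈ Metric.ball c R, f z = f c *
          (∏ ρ ∈ S R, ((z - ρ) / (c - ρ)) ^ analyticOrderNatAt f ρ) * Complex.exp (g z)) ∧
        ∀ z ∈ Metric.ball c (R / 2), ‖g z‖ ≤ A * R ^ (3 / 2 : ℝ) := by
      intro R
      by_cases hR : 1 ≤ R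
      · obtain ⟨g, hg⟩ := (hA R hR).2
        exact ⟨g, fun _ => hg⟩
      · exact ⟨0, fun h => absurd h hR⟩
    choose G hG using hex
    refine ⟨G, fun R hR => ?_⟩
    obtain ⟨h1, h2, h3, h4⟩ := hG R (by linarith)
    refine ⟨h1, h2, h3, fun z hz n hn => ?_⟩
    rw [mem_ball_iff_norm] at hz
    have hR0 : 0 < R := by linarith
    have hsub : Metric.closedBall z (R / 8) ⊆ Metric.ball c (R / 2) := by
      intro w hw
      rw [mem_closedBall_iff_norm] at hw
      rw [mem_ball_iff_norm]
      have := norm_add_le (w - z) (z - c)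
      simp only [sub_add_sub_cancel] at this
      linarith
    have hsub' : Metric.ball c (R / 2) ⊆ Metric.ball c R := Metric.ball_subset_ball (by linarith)
    refine (Complex.norm_iteratedDeriv_le_of_forall_mem_sphere_norm_le n (R := R / 8)
      (C := A * R ^ (3 / 2 : ℝ)) (by linarith) (h1.diffContOnCl_ball (hsub.trans hsub'))
      fun w hw => h4 w (hsub (Metric.sphere_subset_closedBall hw))).trans ?_
    rw [mul_div_assoc]
    gcongr
    have h5 : (R / 8) ^ 2 ≤ (R / 8) ^ n := pow_le_pow_right₀ (by linarith) hn
    have h6 : R ^ (3 / 2 : ℝ) = R ^ (-(1 / 2) : ℝ) * R ^ 2 := by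
      rw [← Real.rpow_natCast, ← Real.rpow_add hR0]
      norm_num
    calc A * R ^ (3 / 2 : ℝ) / (R / 8) ^ n ≤ A * R ^ (3 / 2 : ℝ) / (R / 8) ^ 2 := by gcongr
      _ = 64 * A * R ^ (-(1 / 2) : ℝ) := by
        rw [h6]
        field_simp
        norm_num

theorem logDeriv_eq_of_factorization {f : ℂ → ℂ} {c : ℂ} {R : ℝ} (hc : f c ≠ 0)
    {S : Finset {z // f z = 0}} {m : {z // f z = 0} → ℕ} {g : ℂ → ℂ}
    (hg : DifferentiableOn ℂ g (Metric.ball c R))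
    (hprod : ∀ z ∈ Metric.ball c R, f z = f c *
        (∏ ρ ∈ S, ((z - ρ) / (c - ρ)) ^ m ρ) * Complex.exp (g z))
    {z : ℂ} (hz : z ∈ Metric.ball c R) (hfz : f z ≠ 0) :
    logDeriv f z = ∑ ρ ∈ S, (m ρ : ℂ) * (z - ρ)⁻¹ + deriv g z := by
  have hcρ : ∀ ρ : {z // f z = 0}, c - ρ ≠ 0 := by
    intro ρ h0
    rw [sub_eq_zero] at h0
    exact hc (h0 ▸ ρ.2)
  have hzρ : ∀ ρ : {z // f z = 0}, z - ρ ≠ 0 := by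
    intro ρ h0
    rw [sub_eq_zero] at h0
    exact hfz (h0 ▸ ρ.2)
  have hgz : DifferentiableAt ℂ g z := hg.differentiableAt (Metric.isOpen_ball.mem_nhds hz)
  have hev : f =ᶠ[𝓝 z] fun z => f c * (∏ ρ ∈ S, ((z - ρ) / (c - ρ)) ^ m ρ) * Complex.exp (g z) := by
    filter_upwards [Metric.isOpen_ball.mem_nhds hz] with w hw using hprod w hw
  have hP0 : (∏ ρ ∈ S, ((z - (ρ : ℂ)) / (c - ρ)) ^ m ρ) ≠ 0 :=
    Finset.prod_ne_zero_iff.2 fun ρ _ => pow_ne_zero _ (div_ne_zero (hzρ ρ) (hcρ ρ))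
  rw [logDeriv_apply, hev.deriv_eq, hev.self_of_nhds, ← logDeriv_apply, logDeriv_mul
    (f := fun z => f c * ∏ ρ ∈ S, ((z - (ρ : ℂ)) / (c - ρ)) ^ m ρ)
    (g := fun z => Complex.exp (g z)) z (mul_ne_zero hc hP0) (Complex.exp_ne_zero _) (by fun_prop) (by fun_prop),
    logDeriv_const_mul z _ hc, logDeriv_prod]
  · congr 1
    · refine Finset.sum_congr rfl fun ρ _ => ?_
      rw [logDeriv_fun_pow (by fun_prop)]
      congr 1
      rw [logDeriv_apply]
      have : HasDerivAt (fun z : ℂ => (z - ρ) / (c - ρ)) (1 / (c - ρ)) z :=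
        ((hasDerivAt_id z).sub_const _).div_const _
      rw [this.deriv]
      field_simp [hzρ ρ, hcρ ρ]
    · rw [logDeriv_apply, hgz.hasDerivAt.cexp.deriv]
      field_simp
  · exact fun ρ _ => pow_ne_zero _ (div_ne_zero (hzρ ρ) (hcρ ρ))
  · intro ρ _
    fun_prop

section Limits

variable {f : ℂ → ℂ} {c z : ℂ}

/-- Two applications of the mean value inequality. The linear part at `c` has to be subtracted,
because only the second derivative is known to be small. -/
theorem remainder_estimates {g : ℂ → ℂ} {r e : ℝ} (hg : DifferentiableOn ℂ g (Metric.ball c r))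
    (hg0 : g c = 0) (hz : z ∈ Metric.ball c r)
    (hd : ∀ w ∈ Metric.ball c r, ‖iteratedDeriv 2 g w‖ ≤ e) :
    ‖deriv g z - deriv g c‖ ≤ e * ‖z - c‖ ∧
      ‖g z - (z - c) * deriv g c‖ ≤ e * ‖z - c‖ ^ 2 := by
  have hopen : IsOpen (Metric.ball c r) := Metric.isOpen_ball
  have hr : 0 < r := Metric.nonempty_ball.1 ⟨z, hz⟩
  have hcr : c ∈ Metric.ball c r := Metric.mem_ball_self hr
  have h1 : ∀ w ∈ Metric.ball c r, ‖deriv g w - deriv g c‖ ≤ e * ‖w - c‖ := by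
    intro w hw
    refine (convex_ball c r).norm_image_sub_le_of_norm_deriv_le (f := deriv g)
      (fun x hx => (hg.deriv hopen).differentiableAt (hopen.mem_nhds hx)) (fun x hx => ?_) hcr hw
    have := hd x hx
    rwa [iteratedDeriv_succ, iteratedDeriv_one] at this
  refine ⟨h1 z hz, ?_⟩
  have he : 0 ≤ e := (norm_nonneg _).trans (hd c hcr)
  have hsub : Metric.closedBall c ‖z - c‖ ⊆ Metric.ball c r :=
    Metric.closedBall_subset_ball (by rwa [mem_ball_iff_norm] at hz)
  have h2 := (convex_closedBall c ‖z - c‖).norm_image_sub_le_of_norm_deriv_le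
    (f := fun w => g w - (w - c) * deriv g c) (C := e * ‖z - c‖) (x := c) (y := z)
    (fun x hx => ((hg.differentiableAt (hopen.mem_nhds (hsub hx))).sub (by fun_prop)))
    (fun x hx => ?_) (Metric.mem_closedBall_self (norm_nonneg _))
    (by rw [mem_closedBall_iff_norm])
  · simp only [sub_self, zero_mul, hg0, sub_zero] at h2
    rw [sq, ← mul_assoc]
    exact h2
  · have hx' := hsub hx
    have hder : HasDerivAt (fun w => g w - (w - c) * deriv g c) (deriv g x - 1 * deriv g c) x :=
      ((hg.differentiableAt (hopen.mem_nhds hx')).hasDerivAt).sub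
        (((hasDerivAt_id x).sub_const c).mul_const _)
    rw [hder.deriv, one_mul]
    refine (h1 x hx').trans ?_
    rw [mem_closedBall_iff_norm] at hx
    gcongr

/-- The factorization at the centre shows that the linear coefficient of the remainder is
$f'/f(c)-\sum1/(c-\rho)$. Thus it supplies both the convergence factors and the exponential in the
limit. -/
theorem GrowthAtMostOne.tendsto_prod (hgr : GrowthAtMostOne f)
    (hf : Differentiable ℂ f) (hc : f c ≠ 0) {S : ℝ → Finset {z // f z = 0}}
    (hS : ∀ (R : ℝ) (ρ : {z // f z = 0}), ρ ∈ S R ↔ ‖(ρ : ℂ) - c‖ ≤ R) (z : ℂ) :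
    Tendsto (fun R => ∏ ρ ∈ S R, ((z - ρ) / (c - ρ) * Complex.exp (-((z - c) / (c - ρ))))
      ^ analyticOrderNatAt f ρ) atTop
      (𝓝 (f z / f c * Complex.exp (-((z - c) * logDeriv f c)))) := by
  obtain ⟨ε, hε, G, hG⟩ := hgr.exists_remainder hf hc hS
  have hlim : Tendsto (fun R => G R z - (z - c) * deriv (G R) c) atTop (𝓝 0) := by
    refine squeeze_zero_norm' (a := fun R => Nat.factorial 2 * ε R * ‖z - c‖ ^ 2) ?_ ?_
    · filter_upwards [eventually_ge_atTop 8, eventually_gt_atTop (4 * ‖z - c‖)] with R hR hRz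
      obtain ⟨h1, h2, -, h4⟩ := hG R hR
      exact (remainder_estimates (h1.mono (Metric.ball_subset_ball (by linarith))) h2
        (by rw [mem_ball_iff_norm]; linarith) fun w hw => h4 w hw 2 le_rfl).2
    · simpa using (hε.const_mul (Nat.factorial 2 : ℝ)).mul_const (‖z - c‖ ^ 2)
  have hlim2 := ((Complex.continuous_exp.tendsto _).comp hlim.neg).const_mul
    (f z / f c * Complex.exp (-((z - c) * logDeriv f c)))
  simp only [neg_zero, Complex.exp_zero, mul_one] at hlim2
  refine hlim2.congr' ?_
  filter_upwards [eventually_ge_atTop 8, eventually_gt_atTop ‖z - c‖] with R hR hRz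
  obtain ⟨h1, h2, h3, -⟩ := hG R hR
  have hz : z ∈ Metric.ball c R := by rwa [mem_ball_iff_norm]
  have hcR : c ∈ Metric.ball c R := Metric.mem_ball_self (by linarith)
  have hl := logDeriv_eq_of_factorization hc h1 h3 hcR hc
  simp only [Function.comp_apply, mul_pow, Finset.prod_mul_distrib, ← Complex.exp_nat_mul]
  rw [← Complex.exp_sum, h3 z hz, hl]
  have hsum : ∑ ρ ∈ S R, (analyticOrderNatAt f ρ : ℂ) * -((z - c) / (c - ρ)) =
      -((z - c) * ∑ ρ ∈ S R, (analyticOrderNatAt f ρ : ℂ) * (c - (ρ : ℂ))⁻¹) := by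
    rw [Finset.mul_sum, ← Finset.sum_neg_distrib]
    refine Finset.sum_congr rfl fun ρ _ => ?_
    ring
  rw [hsum]
  have hE : Complex.exp (G R z) * Complex.exp (-((z - c) *
      (∑ ρ ∈ S R, (analyticOrderNatAt f ρ : ℂ) * (c - (ρ : ℂ))⁻¹ + deriv (G R) c))) *
      Complex.exp (-(G R z - (z - c) * deriv (G R) c)) =
      Complex.exp (-((z - c) * ∑ ρ ∈ S R, (analyticOrderNatAt f ρ : ℂ) * (c - (ρ : ℂ))⁻¹)) := by
    rw [← Complex.exp_add, ← Complex.exp_add]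
    ring_nf
  rw [← hE]
  field_simp

theorem GrowthAtMostOne.tendsto_sum (hgr : GrowthAtMostOne f)
    (hf : Differentiable ℂ f) (hc : f c ≠ 0) {S : ℝ → Finset {z // f z = 0}}
    (hS : ∀ (R : ℝ) (ρ : {z // f z = 0}), ρ ∈ S R ↔ ‖(ρ : ℂ) - c‖ ≤ R) (hz : f z ≠ 0) :
    Tendsto (fun R => ∑ ρ ∈ S R, (analyticOrderNatAt f ρ : ℂ) * ((z - ρ)⁻¹ - (c - (ρ : ℂ))⁻¹)) atTop
      (𝓝 (logDeriv f z - logDeriv f c)) := by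
  obtain ⟨ε, hε, G, hG⟩ := hgr.exists_remainder hf hc hS
  have hlim : Tendsto (fun R => deriv (G R) z - deriv (G R) c) atTop (𝓝 0) := by
    refine squeeze_zero_norm' (a := fun R => Nat.factorial 2 * ε R * ‖z - c‖) ?_ ?_
    · filter_upwards [eventually_ge_atTop 8, eventually_gt_atTop (4 * ‖z - c‖)] with R hR hRz
      obtain ⟨h1, h2, -, h4⟩ := hG R hR
      exact (remainder_estimates (h1.mono (Metric.ball_subset_ball (by linarith))) h2
        (by rw [mem_ball_iff_norm]; linarith) fun w hw => h4 w hw 2 le_rfl).1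
    · simpa using (hε.const_mul (Nat.factorial 2 : ℝ)).mul_const ‖z - c‖
  have hlim2 := hlim.const_sub (logDeriv f z - logDeriv f c)
  rw [sub_zero] at hlim2
  refine hlim2.congr' ?_
  filter_upwards [eventually_ge_atTop 8, eventually_gt_atTop ‖z - c‖] with R hR hRz
  obtain ⟨h1, h2, h3, -⟩ := hG R hR
  have hzR : z ∈ Metric.ball c R := by rwa [mem_ball_iff_norm]
  have hcR : c ∈ Metric.ball c R := Metric.mem_ball_self (by linarith)
  rw [logDeriv_eq_of_factorization hc h1 h3 hcR hc, logDeriv_eq_of_factorization hc h1 h3 hzR hz]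
  simp only [mul_sub, Finset.sum_sub_distrib]
  ring

theorem iteratedDeriv_sub_inv (n : ℕ) (ρ z : ℂ) :
    iteratedDeriv n (fun w => (w - ρ)⁻¹) z = (-1) ^ n * n.factorial * ((z - ρ) ^ (n + 1))⁻¹ := by
  have h := congrFun (iter_deriv_inv_linear_sub (𝕜 := ℂ) n 1 ρ) z
  simp only [one_mul, one_pow, mul_one] at h
  rw [iteratedDeriv_eq_iterate, h]
  congr 1
  rw [← zpow_natCast, ← zpow_neg]
  congr 1
  push_cast
  ring

/-- After one or more differentiations of $f'/f$ the contribution of the remainder itself vanishes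
in the limit, so no comparison with the value at `c` is needed. -/
theorem GrowthAtMostOne.tendsto_sum_pow (hgr : GrowthAtMostOne f)
    (hf : Differentiable ℂ f) (hc : f c ≠ 0) {S : ℝ → Finset {z // f z = 0}}
    (hS : ∀ (R : ℝ) (ρ : {z // f z = 0}), ρ ∈ S R ↔ ‖(ρ : ℂ) - c‖ ≤ R) (hz : f z ≠ 0) (n : ℕ) :
    Tendsto (fun R => ∑ ρ ∈ S R, (analyticOrderNatAt f ρ : ℂ) * ((z - ρ) ^ (n + 2))⁻¹) atTop
      (𝓝 ((-1) ^ (n + 1) / (n + 1).factorial * iteratedDeriv (n + 1) (logDeriv f) z)) := by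
  obtain ⟨ε, hε, G, hG⟩ := hgr.exists_remainder hf hc hS
  have hlim : Tendsto (fun R => iteratedDeriv (n + 2) (G R) z) atTop (𝓝 0) := by
    refine squeeze_zero_norm' (a := fun R => Nat.factorial (n + 2) * ε R) ?_ ?_
    · filter_upwards [eventually_ge_atTop 8, eventually_gt_atTop (4 * ‖z - c‖)] with R hR hRz
      obtain ⟨h1, h2, -, h4⟩ := hG R hR
      exact h4 z (by rw [mem_ball_iff_norm]; linarith) (n + 2) (by omega)
    · simpa using hε.const_mul (Nat.factorial (n + 2) : ℝ)
  have hlim2 := (hlim.const_sub (iteratedDeriv (n + 1) (logDeriv f) z)).const_mul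
    ((-1) ^ (n + 1) / ((n + 1).factorial : ℂ))
  rw [sub_zero] at hlim2
  refine hlim2.congr' ?_
  filter_upwards [eventually_ge_atTop 8, eventually_gt_atTop ‖z - c‖] with R hR hRz
  obtain ⟨h1, h2, h3, -⟩ := hG R hR
  have hzR : z ∈ Metric.ball c R := by rwa [mem_ball_iff_norm]
  have hzρ : ∀ ρ : {z // f z = 0}, z - ρ ≠ 0 := by
    intro ρ h0
    rw [sub_eq_zero] at h0
    exact hz (h0 ▸ ρ.2)
  have hev : logDeriv f =ᶠ[𝓝 z] fun w =>
      (∑ ρ ∈ S R, (analyticOrderNatAt f ρ : ℂ) * (w - (ρ : ℂ))⁻¹) + deriv (G R) w := by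
    filter_upwards [Metric.isOpen_ball.mem_nhds hzR,
      (hf.continuous.isOpen_preimage _ isOpen_ne).mem_nhds hz] with w hw hfw
    exact logDeriv_eq_of_factorization hc h1 h3 hw hfw
  have hcd : ∀ ρ ∈ S R, ContDiffAt ℂ (n + 1 : ℕ) (fun w => (w - (ρ : ℂ))⁻¹) z := fun ρ _ =>
    (contDiffAt_id.sub contDiffAt_const).inv (hzρ ρ)
  have hcd' : ∀ ρ ∈ S R, ContDiffAt ℂ (n + 1 : ℕ)
      (fun w => (analyticOrderNatAt f ρ : ℂ) * (w - (ρ : ℂ))⁻¹) z := fun ρ hρ =>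
    contDiffAt_const.mul (hcd ρ hρ)
  have hGd : ContDiffAt ℂ (n + 1 : ℕ) (deriv (G R)) z :=
    ((h1.deriv Metric.isOpen_ball).analyticAt (Metric.isOpen_ball.mem_nhds hzR)).contDiffAt
  rw [hev.iteratedDeriv_eq, iteratedDeriv_fun_add (ContDiffAt.sum hcd') hGd,
    iteratedDeriv_fun_sum hcd', iteratedDeriv_succ' (n := n + 1), add_sub_cancel_right,
    Finset.mul_sum]
  refine Finset.sum_congr rfl fun ρ hρ => ?_
  rw [iteratedDeriv_const_mul _ (hcd ρ hρ), iteratedDeriv_sub_inv]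
  have h5 : ((n + 1).factorial : ℂ) ≠ 0 := by exact_mod_cast Nat.factorial_ne_zero _
  have h6 : ((-1 : ℂ) ^ (n + 1)) * (-1) ^ (n + 1) = 1 := by
    rw [← mul_pow]; simp
  field_simp
  rw [sq, h6, one_mul]

end Limits

section Hadamard

variable {f : ℂ → ℂ} {c z : ℂ}

theorem HasSum.of_tendsto_finset {ι : Type*} {u : ι → ℂ} {S : ℝ → Finset ι} {l : ℂ}
    (hS : Tendsto S atTop atTop) (hu : Summable u)
    (h : Tendsto (fun R => ∑ k ∈ S R, u k) atTop (𝓝 l)) : HasSum u l := by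
  have h1 : Tendsto (fun R => ∑ k ∈ S R, u k) atTop (𝓝 (∑' k, u k)) := hu.hasSum.comp hS
  rw [tendsto_nhds_unique h h1]
  exact hu.hasSum

theorem sub_zero_ne_zero {f : ℂ → ℂ} {c : ℂ} (hc : f c ≠ 0) (ρ : {z // f z = 0}) :
    c - (ρ : ℂ) ≠ 0 := by
  intro h0
  rw [sub_eq_zero] at h0
  exact hc (h0 ▸ ρ.2)

/-- **Hadamard's factorization theorem** for order at most one, centred at `c`. -/
theorem GrowthAtMostOne.hasProd (hgr : GrowthAtMostOne f) (hf : Differentiable ℂ f)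
    (hc : f c ≠ 0) (hz : f z ≠ 0) :
    HasProd (fun ρ : {z // f z = 0} => ((z - ρ) / (c - ρ) *
      Complex.exp (-((z - c) / (c - ρ)))) ^ analyticOrderNatAt f ρ)
      (f z / f c * Complex.exp (-((z - c) * logDeriv f c))) := by
  obtain ⟨S, hS⟩ := exists_zeros_finset hf hc
  have hconv := hgr.convergesBeyond hf hc
  -- Logarithms of the factors: removing the linear term leaves $O(|c-\rho|^{-2})$. This gives
  -- unconditional convergence, and the limit along discs identifies the value.
  set u : {z // f z = 0} → ℂ := fun ρ => (analyticOrderNatAt f ρ : ℂ) *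
    (Complex.log (1 + (z - c) / (c - ρ)) - (z - c) / (c - ρ)) with hu
  have hus : Summable u := by
    refine Summable.of_norm_bounded_eventually
      ((hconv.summable_pow (n := 2) (by norm_num)).mul_left (‖z - c‖ ^ 2)) ?_
    filter_upwards [hconv.eventually_le_norm (2 * ‖z - c‖)] with ρ hρ
    have hpos : 0 < ‖c - (ρ : ℂ)‖ := norm_pos_iff.2 (hconv.ne_zero ρ)
    have hhalf : ‖(z - c) / (c - (ρ : ℂ))‖ ≤ 1 / 2 := by
      rw [norm_div, div_le_iff₀ hpos]
      linarith
    rw [hu]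
    simp only [norm_mul, Complex.norm_natCast]
    have h1 := Complex.norm_log_one_add_sub_self_le (z := (z - c) / (c - (ρ : ℂ)))
      (by linarith)
    have h2 : (1 - ‖(z - c) / (c - (ρ : ℂ))‖)⁻¹ ≤ 2 := by
      rw [inv_le_comm₀ (by linarith) (by norm_num)]
      linarith
    have h3 : ‖(z - c) / (c - (ρ : ℂ))‖ ^ 2 * (1 - ‖(z - c) / (c - (ρ : ℂ))‖)⁻¹ / 2 ≤
        ‖(z - c) / (c - (ρ : ℂ))‖ ^ 2 := by
      have := mul_le_mul_of_nonneg_left h2 (sq_nonneg ‖(z - c) / (c - (ρ : ℂ))‖)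
      linarith
    calc _ ≤ (analyticOrderNatAt f ρ : ℝ) * ‖(z - c) / (c - (ρ : ℂ))‖ ^ 2 := by
          gcongr
          exact h1.trans h3
      _ = _ := by
          rw [norm_div, div_pow]
          ring
  have hexp : ∀ ρ, Complex.exp (u ρ) = ((z - ρ) / (c - ρ) *
      Complex.exp (-((z - c) / (c - ρ)))) ^ analyticOrderNatAt f ρ := by
    intro ρ
    have h1 : 1 + (z - c) / (c - (ρ : ℂ)) = (z - ρ) / (c - ρ) := by
      field_simp [sub_zero_ne_zero hc ρ]
      ring
    rw [hu]
    simp only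
    rw [Complex.exp_nat_mul, sub_eq_add_neg, Complex.exp_add, h1, Complex.exp_log
      (div_ne_zero (sub_zero_ne_zero hz ρ) (sub_zero_ne_zero hc ρ))]
  have hprod := hus.hasSum.cexp
  have h1 : Tendsto (fun R => ∏ ρ ∈ S R, Complex.exp (u ρ)) atTop
      (𝓝 (Complex.exp (∑' ρ, u ρ))) := hprod.comp (tendsto_zeros_finset hS)
  simp only [hexp] at h1
  rw [tendsto_nhds_unique (hgr.tendsto_prod hf hc hS z) h1]
  convert! hprod using 1
  funext ρ
  exact (hexp ρ).symm

theorem GrowthAtMostOne.hasSum_sub (hgr : GrowthAtMostOne f) (hf : Differentiable ℂ f)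
    (hc : f c ≠ 0) (hz : f z ≠ 0) :
    HasSum (fun ρ : {z // f z = 0} => (analyticOrderNatAt f ρ : ℂ) *
      ((z - ρ)⁻¹ - (c - (ρ : ℂ))⁻¹)) (logDeriv f z - logDeriv f c) := by
  obtain ⟨S, hS⟩ := exists_zeros_finset hf hc
  have hconv := hgr.convergesBeyond hf hc
  refine HasSum.of_tendsto_finset (tendsto_zeros_finset hS) ?_ (hgr.tendsto_sum hf hc hS hz)
  refine Summable.of_norm_bounded_eventually
      ((hconv.summable_pow (n := 2) (by norm_num)).mul_left (2 * ‖z - c‖)) ?_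
  filter_upwards [hconv.eventually_half_le (z - c)] with ρ hρ
  have hpos : 0 < ‖c - (ρ : ℂ)‖ := norm_pos_iff.2 (hconv.ne_zero ρ)
  rw [show c - (ρ : ℂ) + (z - c) = z - ρ by ring] at hρ
  have hpos2 : 0 < ‖z - (ρ : ℂ)‖ := by linarith
  have h1 : (z - (ρ : ℂ))⁻¹ - (c - (ρ : ℂ))⁻¹ = -((z - c) / ((z - ρ) * (c - ρ))) := by
    have := sub_zero_ne_zero hc ρ
    have := sub_zero_ne_zero hz ρ
    field_simp
    ring
  rw [h1, norm_mul, norm_neg, norm_div, norm_mul, Complex.norm_natCast]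
  have h2 : ‖z - c‖ / (‖z - (ρ : ℂ)‖ * ‖c - (ρ : ℂ)‖) ≤
      2 * ‖z - c‖ * (‖c - (ρ : ℂ)‖ ^ 2)⁻¹ := by
    rw [div_le_iff₀ (by positivity)]
    have h3 : 1 ≤ 2 * (‖c - (ρ : ℂ)‖ ^ 2)⁻¹ * (‖z - (ρ : ℂ)‖ * ‖c - (ρ : ℂ)‖) := by
      field_simp
      linarith
    calc ‖z - c‖ ≤ ‖z - c‖ * (2 * (‖c - (ρ : ℂ)‖ ^ 2)⁻¹ * (‖z - (ρ : ℂ)‖ * ‖c - (ρ : ℂ)‖)) :=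
          le_mul_of_one_le_right (norm_nonneg _) h3
      _ = _ := by ring
  calc _ ≤ (analyticOrderNatAt f ρ : ℝ) * (2 * ‖z - c‖ * (‖c - (ρ : ℂ)‖ ^ 2)⁻¹) := by gcongr
    _ = _ := by ring

theorem GrowthAtMostOne.hasSum_pow (hgr : GrowthAtMostOne f) (hf : Differentiable ℂ f)
    (hz : f z ≠ 0) (n : ℕ) :
    HasSum (fun ρ : {z // f z = 0} => (analyticOrderNatAt f ρ : ℂ) * ((z - ρ) ^ (n + 2))⁻¹)
      ((-1) ^ (n + 1) / (n + 1).factorial * iteratedDeriv (n + 1) (logDeriv f) z) := by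
  obtain ⟨S, hS⟩ := exists_zeros_finset hf hz
  exact HasSum.of_tendsto_finset (tendsto_zeros_finset hS)
    ((hgr.convergesBeyond hf hz).summable_inv_pow (by push_cast; linarith))
    (hgr.tendsto_sum_pow hf hz hS hz n)

end Hadamard

/-! ### Series of holomorphic functions with finitely many exceptional terms -/

/-- The exceptional terms, being finitely many, are bounded by their modulus at $s_0$ plus one on a
smaller neighbourhood. In the applications they come from points too small, or outside the right
half-plane, for the general estimate. -/
theorem analyticAt_tsum_of_eventually {ι : Type*} {F : ι → ℂ → ℂ} {s₀ : ℂ} {U : Set ℂ}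
    (hU : U ∈ 𝓝 s₀) {u : ι → ℝ} (hu : Summable u)
    (hev : ∀ᶠ k in cofinite, DifferentiableOn ℂ (F k) U ∧ ∀ s ∈ U, ‖F k s‖ ≤ u k)
    (han : ∀ k, AnalyticAt ℂ (F k) s₀) :
    AnalyticAt ℂ (fun s => ∑' k, F k s) s₀ ∧
      HasSum (fun k => deriv (F k) s₀) (deriv (fun s => ∑' k, F k s) s₀) ∧
      ∀ᶠ s in 𝓝 s₀, Summable fun k => F k s := by
  classical
  set E : Set ι := {k | ¬ (DifferentiableOn ℂ (F k) U ∧ ∀ s ∈ U, ‖F k s‖ ≤ u k)} with hE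
  have hEfin : E.Finite := hev
  have hE2 : ∀ᶠ s in 𝓝 s₀, ∀ k ∈ E, AnalyticAt ℂ (F k) s ∧ ‖F k s‖ ≤ ‖F k s₀‖ + 1 := by
    rw [Filter.eventually_all_finite hEfin]
    intro k _
    refine (han k).eventually_analyticAt.and ?_
    have hc : ContinuousAt (fun s => ‖F k s‖) s₀ := (han k).continuousAt.norm
    exact hc.eventually_le_const (by linarith)
  obtain ⟨V, hV, hVo, hs₀⟩ := eventually_nhds_iff.1 (hE2.and hU)
  set u' : ι → ℝ := fun k => if k ∈ E then ‖F k s₀‖ + 1 else u k with hu'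
  have hsum : Summable u' := by
    refine (summable_congr_cofinite ?_).2 hu
    filter_upwards [hEfin.compl_mem_cofinite] with k hk
    simp only [hu']
    rw [if_neg hk]
  have hd : ∀ k, DifferentiableOn ℂ (F k) V := by
    intro k
    by_cases hk : k ∈ E
    · exact fun s hs => ((hV s hs).1 k hk).1.differentiableAt.differentiableWithinAt
    · rw [hE, Set.mem_ofPred_eq, not_not] at hk
      exact hk.1.mono fun s hs => (hV s hs).2
  have hb : ∀ k, ∀ s ∈ V, ‖F k s‖ ≤ u' k := by
    intro k s hs
    by_cases hk : k ∈ E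
    · simp only [hu', if_pos hk]
      exact ((hV s hs).1 k hk).2
    · simp only [hu', if_neg hk]
      rw [hE, Set.mem_ofPred_eq, not_not] at hk
      exact hk.2 s (hV s hs).2
  refine ⟨?_, Complex.hasSum_deriv_of_summable_norm hsum hd hVo hb hs₀, ?_⟩
  · exact (Complex.differentiableOn_tsum_of_summable_norm hsum hd hVo hb).analyticAt
      (hVo.mem_nhds hs₀)
  · filter_upwards [hVo.mem_nhds hs₀] with s hs
    exact Summable.of_norm_bounded hsum fun k => hb k s hs

theorem exp_bound_of_mem_ball {s₀ s : ℂ} {r : ℝ} (hs : s ∈ Metric.ball s₀ r) :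
    s₀.re - r < s.re ∧ |s.im| ≤ ‖s₀‖ + r ∧ ‖s‖ ≤ ‖s₀‖ + r := by
  rw [mem_ball_iff_norm] at hs
  have h1 : |(s - s₀).re| ≤ ‖s - s₀‖ := Complex.abs_re_le_norm _
  rw [Complex.sub_re] at h1
  have h2 := abs_le.1 h1
  have h3 : ‖s‖ ≤ ‖s - s₀‖ + ‖s₀‖ := by simpa using norm_add_le (s - s₀) s₀
  refine ⟨by linarith, (Complex.abs_im_le_norm s).trans (by linarith), by linarith⟩

theorem norm_cpow_neg_le_of_mem_ball {s₀ s z : ℂ} {r : ℝ} (hs : s ∈ Metric.ball s₀ r)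
    (hz : 1 ≤ ‖z‖) :
    ‖z ^ (-s)‖ ≤ ‖z‖ ^ (-(s₀.re - r)) * Real.exp (Real.pi * (‖s₀‖ + r)) := by
  obtain ⟨h1, h2, -⟩ := exp_bound_of_mem_ball hs
  have hz0 : z ≠ 0 := norm_pos_iff.1 (by linarith)
  refine (norm_cpow_neg_le hz0 s).trans ?_
  have h3 : ‖z‖ ^ (-s.re) ≤ ‖z‖ ^ (-(s₀.re - r)) :=
    Real.rpow_le_rpow_of_exponent_le hz (by linarith)
  have := Real.pi_pos
  gcongr

theorem ConvergesBeyond.analyticAt_tsum_cpow {ι : Type*} {m : ι → ℕ} {w : ι → ℂ} {a : ℝ}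
    (h : ConvergesBeyond m w a) {s₀ : ℂ} (hs : a < s₀.re) :
    AnalyticAt ℂ (fun s : ℂ => ∑' k, (m k : ℂ) * w k ^ (-s)) s₀ := by
  set r := (s₀.re - a) / 2 with hr
  have hr0 : 0 < r := by linarith
  have hd : ∀ k, Differentiable ℂ fun s : ℂ => (m k : ℂ) * w k ^ (-s) := by
    intro k s
    exact ((differentiableAt_id.neg).const_cpow (Or.inl (h.ne_zero k))).const_mul _
  refine (analyticAt_tsum_of_eventually (Metric.ball_mem_nhds s₀ hr0)
    ((h.summable (s₀.re - r) (by linarith)).mul_right (Real.exp (Real.pi * (‖s₀‖ + r)))) ?_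
    fun k => (hd k).analyticAt _).1
  filter_upwards [h.eventually_le_norm 1] with k hk
  refine ⟨(hd k).differentiableOn, fun s hs => ?_⟩
  rw [norm_mul, Complex.norm_natCast, mul_assoc]
  gcongr
  exact norm_cpow_neg_le_of_mem_ball hs hk

/-! ### Gluing meromorphic continuations -/

theorem MeromorphicOn.eventuallyEq_of_isPreconnected {F G : ℂ → ℂ} {U : Set ℂ}
    (hF : MeromorphicOn F U) (hG : MeromorphicOn G U) (hU : IsPreconnected U) {x : ℂ} (hx : x ∈ U)
    (h : F =ᶠ[𝓝[≠] x] G) {y : ℂ} (hy : y ∈ U) : F =ᶠ[𝓝[≠] y] G := by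
  have htop : meromorphicOrderAt (F - G) x = ⊤ := by
    rw [meromorphicOrderAt_eq_top_iff]
    filter_upwards [h] with s hs
    simp [hs]
  have h0 : meromorphicOrderAt (F - G) y = ⊤ := by
    by_contra hne
    exact (hF.sub hG).meromorphicOrderAt_ne_top_of_isPreconnected hU hy hx hne htop
  rw [meromorphicOrderAt_eq_top_iff] at h0
  filter_upwards [h0] with s hs
  simpa [sub_eq_zero] using hs

/-- The vertical strip `α < re s < β`. -/
def verticalStrip (α β : ℝ) : Set ℂ := {s | α < s.re ∧ s.re < β}

theorem isOpen_verticalStrip (α β : ℝ) : IsOpen (verticalStrip α β) :=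
  (isOpen_lt continuous_const Complex.continuous_re).inter
    (isOpen_lt Complex.continuous_re continuous_const)

theorem isPreconnected_verticalStrip (α β : ℝ) : IsPreconnected (verticalStrip α β) := by
  refine Convex.isPreconnected ?_
  exact (convex_halfSpace_re_gt α).inter (convex_halfSpace_re_lt β)

/-- `F` continues `∑ m k * w k ^ (-s)` meromorphically to the strip `α < re s < β`. -/
structure IsStripContinuation {ι : Type*} (m : ι → ℕ) (w : ι → ℂ) (a α β : ℝ)
    (F : ℂ → ℂ) : Prop where
  meromorphicOn : MeromorphicOn F (verticalStrip α β)
  eq_tsum : ∀ s : ℂ, a < s.re → s.re < β → F s = ∑' k, (m k : ℂ) * w k ^ (-s)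

section Glue

variable {ι : Type*} {m : ι → ℕ} {w : ι → ℂ} {a α α' β : ℝ} {F G A : ℂ → ℂ}

theorem IsStripContinuation.eventuallyEq (hF : IsStripContinuation m w a α β F)
    (hG : IsStripContinuation m w a α' β G) (hα : α < β) (hα' : α' < β) (hβ : a < β) {s : ℂ}
    (hs : s ∈ verticalStrip α β) (hs' : s ∈ verticalStrip α' β) : F =ᶠ[𝓝[≠] s] G := by
  set γ := max α α' with hγ
  have hsub : verticalStrip γ β ⊆ verticalStrip α β := fun z hz =>
    ⟨(le_max_left α α').trans_lt hz.1, hz.2⟩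
  have hsub' : verticalStrip γ β ⊆ verticalStrip α' β := fun z hz =>
    ⟨(le_max_right α α').trans_lt hz.1, hz.2⟩
  have hγβ : max γ a < β := max_lt (max_lt hα hα') hβ
  -- A point of both strips where both functions are given by the series; the identity theorem
  -- starts there.
  set x : ℂ := (((max γ a + β) / 2 : ℝ) : ℂ) with hx
  have hx1 : max γ a < x.re := by rw [hx, Complex.ofReal_re]; linarith
  have hx2 : x.re < β := by rw [hx, Complex.ofReal_re]; linarith
  refine MeromorphicOn.eventuallyEq_of_isPreconnected (fun z hz => hF.meromorphicOn z (hsub hz))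
    (fun z hz => hG.meromorphicOn z (hsub' hz)) (isPreconnected_verticalStrip γ β) (x := x)
    ⟨(le_max_left _ _).trans_lt hx1, hx2⟩ ?_ ⟨max_lt hs.1 hs'.1, hs.2⟩
  refine Filter.Eventually.filter_mono nhdsWithin_le_nhds ?_
  filter_upwards [(isOpen_verticalStrip a β).mem_nhds
    (show x ∈ verticalStrip a β from ⟨(le_max_right _ _).trans_lt hx1, hx2⟩)] with z hz
  rw [hF.eq_tsum z hz.1 hz.2, hG.eq_tsum z hz.1 hz.2]

theorem IsZetaContinuation.isStripContinuation (hF : IsZetaContinuation m w a F) :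
    IsStripContinuation m w a α β F :=
  ⟨fun z _ => hF.meromorphic z, fun s hs _ => (hF.hasSum s hs).tsum_eq.symm⟩

theorem IsZetaContinuation.eventuallyEq (hF : IsZetaContinuation m w a F)
    (hG : IsStripContinuation m w a α β G) (hβ : a < β) {s : ℂ}
    (hs : s ∈ verticalStrip α β) : F =ᶠ[𝓝[≠] s] G :=
  hF.isStripContinuation.eventuallyEq hG (hs.1.trans hs.2) (hs.1.trans hs.2) hβ hs hs

theorem IsZetaContinuation.eventuallyEq_nhds_zero (hF : IsZetaContinuation m w a F)
    (hG : IsStripContinuation m w a α β G) (hβ : a < β) (h0 : 0 ∈ verticalStrip α β)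
    (hGA : G =ᶠ[𝓝[≠] 0] A) (hA : AnalyticAt ℂ A 0) : F =ᶠ[𝓝 0] A :=
  (hF.analyticAt_zero.frequently_eq_iff_eventually_eq hA).1
    ((hF.eventuallyEq hG hβ h0).trans hGA).frequently

/-- Continuations to wider and wider strips, one of which is regular at `0`, can be glued. -/
theorem exists_isZetaContinuation (hw : ConvergesBeyond m w a) (ha : 0 ≤ a) (hβ : a < β)
    (h : ∀ N : ℕ, ∃ F, IsStripContinuation m w a (-(N : ℝ)) β F)
    (h0 : ∃ F A α, α < 0 ∧ IsStripContinuation m w a α β F ∧ F =ᶠ[𝓝[≠] 0] A ∧ AnalyticAt ℂ A 0) :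
    ∃ F, IsZetaContinuation m w a F := by
  classical
  choose Φ hΦ using h
  set S : ℂ → ℂ := fun s : ℂ => ∑' k, (m k : ℂ) * w k ^ (-s) with hS
  -- Chosen so that `s` lies to the right of the left edge of the strip of index `ν s`.
  set ν : ℂ → ℕ := fun s => ⌈|s.re|⌉₊ + 1 with hν
  have hνs : ∀ s, -(ν s : ℝ) < s.re := by
    intro s
    have h1 := Nat.le_ceil |s.re|
    have h2 := neg_abs_le s.re
    rw [hν]
    push_cast
    linarith
  have hneg : ∀ N : ℕ, -(N : ℝ) < β := fun N => by
    have : (0 : ℝ) ≤ N := Nat.cast_nonneg N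
    linarith
  -- Strip continuations agree only on punctured neighbourhoods. Taking the punctured limit as the
  -- value makes the glued function independent of the strip and gives it the analytic value at
  -- regular points, in particular at $0$.
  set F : ℂ → ℂ := fun s => if a < s.re then S s else limUnder (𝓝[≠] s) (Φ (ν s)) with hF
  have hFS : ∀ s, a < s.re → F s = S s := fun s hs => by simp only [hF, if_pos hs]
  have hlim : ∀ (s : ℂ) (G B : ℂ → ℂ) (α : ℝ), IsStripContinuation m w a α β G →
      s ∈ verticalStrip α β → ¬ a < s.re → G =ᶠ[𝓝[≠] s] B → ContinuousAt B s → F s = B s := by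
    intro s G B α hG hs hsa hGB hB
    simp only [hF, if_neg hsa]
    refine Tendsto.limUnder_eq ?_
    have h1 := (hΦ (ν s)).eventuallyEq hG (hneg _) (hs.1.trans hs.2) hβ
      ⟨hνs s, hs.2⟩ hs
    exact (hB.tendsto.mono_left nhdsWithin_le_nhds).congr' ((h1.trans hGB).symm)
  have hev : ∀ (α : ℝ) (G : ℂ → ℂ) (s : ℂ), IsStripContinuation m w a α β G →
      s ∈ verticalStrip α β → F =ᶠ[𝓝[≠] s] G := by
    intro α G s hG hs
    filter_upwards [(hG.meromorphicOn s hs).eventually_analyticAt,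
      mem_nhdsWithin_of_mem_nhds ((isOpen_verticalStrip α β).mem_nhds hs)] with z hz hzs
    by_cases hza : a < z.re
    · rw [hFS z hza, hG.eq_tsum z hza hzs.2]
    · exact hlim z G G α hG hzs hza EventuallyEq.rfl hz.continuousAt
  refine ⟨F, ⟨fun s hs => ?_, fun s => ?_, ?_⟩⟩
  · rw [hFS s hs]
    exact (hw.summable_cpow hs).hasSum
  · by_cases hs : a < s.re
    · refine ((hw.analyticAt_tsum_cpow hs).congr ?_).meromorphicAt
      filter_upwards [(isOpen_lt continuous_const Complex.continuous_re).mem_nhds hs] with z hz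
      exact (hFS z hz).symm
    · have hmem : s ∈ verticalStrip (-(ν s : ℝ)) β := ⟨hνs s, (not_lt.1 hs).trans_lt hβ⟩
      exact ((hΦ (ν s)).meromorphicOn s hmem).congr (hev _ _ s (hΦ (ν s)) hmem).symm
  · obtain ⟨G, A, α, hα, hG, hGA, hA⟩ := h0
    have hmem : (0 : ℂ) ∈ verticalStrip α β := ⟨by simpa using hα, by simpa using ha.trans_lt hβ⟩
    have h1 : F =ᶠ[𝓝[≠] 0] A := (hev _ _ 0 hG hmem).trans hGA
    have h2 : F 0 = A 0 := hlim 0 G A α hG hmem (by simpa using ha) hGA hA.continuousAt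
    refine hA.congr ?_
    rw [eventuallyEq_nhdsWithin_iff] at h1
    filter_upwards [h1] with z hz
    by_cases hz0 : z = 0
    · rw [hz0, h2]
    · exact (hz hz0).symm

end Glue

/-! ### Translating the points of a zeta function -/

/-- The binomial coefficient of `z ^ j` in `(1 + z) ^ (-s)`. -/
noncomputable def negBinom : ℕ → ℂ → ℂ
  | 0, _ => 1
  | j + 1, s => -s / (j + 1) * negBinom j (s + 1)

theorem differentiable_negBinom (j : ℕ) : Differentiable ℂ (negBinom j) := by
  induction j with
  | zero => exact differentiable_const 1
  | succ j ih =>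
    show Differentiable ℂ fun s => -s / (j + 1) * negBinom j (s + 1)
    fun_prop

/-- In the variable $z$, the remainder of order $N+1$ at $s$ vanishes at $0$ and has derivative $-s$
times the remainder of order $N$ at $s+1$. The mean value inequality then gains one power of $|z|$;
the shift of $s$ explains the bound `M + 1` in the induction. -/
theorem exists_negBinom_remainder (N : ℕ) (M : ℝ) :
    ∃ C : ℝ, 0 ≤ C ∧ ∀ s : ℂ, ‖s‖ ≤ M → ∀ z : ℂ, ‖z‖ ≤ 1 / 2 →
      ‖(1 + z) ^ (-s) - ∑ j ∈ Finset.range N, negBinom j s * z ^ j‖ ≤ C * ‖z‖ ^ N := by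
  induction N generalizing M with
  | zero =>
    refine ⟨Real.exp M, (Real.exp_pos _).le, fun s hs z hz => ?_⟩
    have h1z : 1 + z ≠ 0 := by
      intro h
      have : z = -1 := by linear_combination h
      rw [this] at hz
      norm_num at hz
    rw [Finset.range_zero, Finset.sum_empty, sub_zero, pow_zero, mul_one,
      Complex.cpow_def_of_ne_zero h1z]
    refine (Complex.norm_exp_le_exp_norm _).trans (Real.exp_le_exp.2 ?_)
    rw [norm_mul, norm_neg]
    have h2 := Complex.norm_log_one_add_half_le_self hz
    have h3 : ‖Complex.log (1 + z)‖ ≤ 1 := by linarith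
    calc ‖Complex.log (1 + z)‖ * ‖s‖ ≤ 1 * M := by gcongr
      _ = M := one_mul M
  | succ N ih =>
    obtain ⟨C, hC0, hC⟩ := ih (M + 1)
    refine ⟨|M| * C, by positivity, fun s hs z hz => ?_⟩
    have hder : ∀ y : ℂ, ‖y‖ ≤ 1 / 2 → HasDerivAt
        (fun y => (1 + y) ^ (-s) - ∑ j ∈ Finset.range (N + 1), negBinom j s * y ^ j)
        (-s * ((1 + y) ^ (-(s + 1)) - ∑ j ∈ Finset.range N, negBinom j (s + 1) * y ^ j)) y := by
      intro y hy
      have hslit : 1 + y ∈ Complex.slitPlane := by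
        refine Or.inl ?_
        have := (abs_le.1 ((Complex.abs_re_le_norm y).trans hy)).1
        simp only [Complex.add_re, Complex.one_re]
        linarith
      have h1 : HasDerivAt (fun y : ℂ => (1 + y) ^ (-s)) (-s * (1 + y) ^ (-s - 1) * 1) y :=
        ((hasDerivAt_id y).const_add 1).cpow_const hslit
      have h2 : HasDerivAt (fun y : ℂ => ∑ j ∈ Finset.range (N + 1), negBinom j s * y ^ j)
          (∑ j ∈ Finset.range (N + 1), negBinom j s * (j * y ^ (j - 1))) y :=
        HasDerivAt.fun_sum fun j _ => (hasDerivAt_pow j y).const_mul _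
      convert! h1.sub h2 using 1
      rw [Finset.sum_range_succ']
      simp only [Nat.cast_zero, zero_mul, mul_zero, add_zero, mul_one]
      rw [mul_sub, Finset.mul_sum, show -(s + 1) = -s - 1 by ring]
      congr 1
      refine Finset.sum_congr rfl fun j _ => ?_
      simp only [negBinom, Nat.cast_add, Nat.cast_one, Nat.add_sub_cancel]
      have : (j : ℂ) + 1 ≠ 0 := Nat.cast_add_one_ne_zero j
      field_simp
    have hsub : ∀ y ∈ Metric.closedBall (0 : ℂ) ‖z‖, ‖y‖ ≤ ‖z‖ := by
      intro y hy
      simpa using hy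
    have hmv := (convex_closedBall (0 : ℂ) ‖z‖).norm_image_sub_le_of_norm_deriv_le
      (f := fun y => (1 + y) ^ (-s) - ∑ j ∈ Finset.range (N + 1), negBinom j s * y ^ j)
      (C := |M| * (C * ‖z‖ ^ N)) (x := 0) (y := z)
      (fun y hy => (hder y ((hsub y hy).trans hz)).differentiableAt) (fun y hy => ?_)
      (Metric.mem_closedBall_self (norm_nonneg _)) (by simp)
    · have h0 : (1 + (0 : ℂ)) ^ (-s) -
          ∑ j ∈ Finset.range (N + 1), negBinom j s * (0 : ℂ) ^ j = 0 := by
        rw [Finset.sum_range_succ']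
        simp [negBinom]
      simp only [h0, sub_zero] at hmv
      rw [pow_succ]
      linarith
    · have hy' := hsub y hy
      rw [(hder y (hy'.trans hz)).deriv, norm_mul, norm_neg]
      have hM : ‖s + 1‖ ≤ M + 1 := (norm_add_le _ _).trans (by simpa using hs)
      have h3 := hC (s + 1) hM y (hy'.trans hz)
      have hs' : ‖s‖ ≤ |M| := hs.trans (le_abs_self M)
      calc _ ≤ |M| * (C * ‖y‖ ^ N) := by gcongr
        _ ≤ _ := by gcongr

/-- The remainder of order `N` in the expansion of `(w + b) ^ (-s)` in powers of `b`. -/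
noncomputable def shiftRemainder (N : ℕ) (w b s : ℂ) : ℂ :=
  (w + b) ^ (-s) - ∑ j ∈ Finset.range N, negBinom j s * b ^ j * w ^ (-(s + j))

theorem differentiable_shiftRemainder (N : ℕ) {w b : ℂ} (hw : w ≠ 0) (hwb : w + b ≠ 0) :
    Differentiable ℂ (shiftRemainder N w b) := by
  intro s
  refine DifferentiableAt.sub ((differentiableAt_id.neg).const_cpow (Or.inl hwb))
    (DifferentiableAt.fun_sum fun j _ => ?_)
  refine ((differentiable_negBinom j s).mul_const _).mul ?_
  exact (by fun_prop : DifferentiableAt ℂ (fun s : ℂ => -(s + j)) s).const_cpow (Or.inl hw)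

/-- Both $w$ and $1+b/w$ have arguments in $(-\pi/2,\pi/2)$, so the principal logarithms add without
a jump. -/
theorem add_cpow_eq_mul {w b s : ℂ} (hw : 0 < w.re) (hb : ‖b / w‖ ≤ 1 / 2) :
    (w + b) ^ s = w ^ s * (1 + b / w) ^ s := by
  have hw0 : w ≠ 0 := by
    rintro rfl
    simp at hw
  have hre : 0 < (1 + b / w).re := by
    have := (abs_le.1 ((Complex.abs_re_le_norm (b / w)).trans hb)).1
    simp only [Complex.add_re, Complex.one_re]
    linarith
  have h10 : 1 + b / w ≠ 0 := by
    intro h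
    rw [h] at hre
    simp at hre
  have hprod : w + b = w * (1 + b / w) := by field_simp
  have h1 := abs_lt.1 (Complex.abs_arg_lt_pi_div_two_iff.2 (Or.inl hw))
  have h2 := abs_lt.1 (Complex.abs_arg_lt_pi_div_two_iff.2 (Or.inl hre))
  rw [hprod, Complex.cpow_def_of_ne_zero (mul_ne_zero hw0 h10), Complex.cpow_def_of_ne_zero hw0,
    Complex.cpow_def_of_ne_zero h10, Complex.log_mul hw0 h10 ⟨by linarith, by linarith⟩,
    add_mul, Complex.exp_add]

theorem shiftRemainder_eq {N : ℕ} {w b s : ℂ} (hw : 0 < w.re) (hb : ‖b / w‖ ≤ 1 / 2) :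
    shiftRemainder N w b s =
      w ^ (-s) * ((1 + b / w) ^ (-s) - ∑ j ∈ Finset.range N, negBinom j s * (b / w) ^ j) := by
  have hw0 : w ≠ 0 := by
    rintro rfl
    simp at hw
  rw [shiftRemainder, add_cpow_eq_mul hw hb, mul_sub, Finset.mul_sum]
  congr 1
  refine Finset.sum_congr rfl fun j _ => ?_
  rw [show -(s + j) = -s - j by ring, Complex.cpow_sub _ _ hw0, Complex.cpow_natCast, div_pow]
  ring

section Shift

variable {ι : Type*} {m : ι → ℕ} {w : ι → ℂ} {a : ℝ}

/-- For all but finitely many $k$ the remainder is $O(|w_k|^{-\operatorname{Re}s-N})$ locally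
uniformly in $s$, so the series converges $N$ units further to the left. -/
theorem ConvergesBeyond.shiftRemainder_tsum (h : ConvergesBeyond m w a)
    (hre : ∀ᶠ k in cofinite, 0 < (w k).re) {b : ℂ} (hb : ∀ k, w k + b ≠ 0) (N : ℕ) {s₀ : ℂ}
    (hs : a - N < s₀.re) :
    AnalyticAt ℂ (fun s => ∑' k, (m k : ℂ) * shiftRemainder N (w k) b s) s₀ ∧
      HasSum (fun k => deriv (fun s => (m k : ℂ) * shiftRemainder N (w k) b s) s₀)
        (deriv (fun s => ∑' k, (m k : ℂ) * shiftRemainder N (w k) b s) s₀) ∧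
      ∀ᶠ s in 𝓝 s₀, Summable fun k => (m k : ℂ) * shiftRemainder N (w k) b s := by
  set r := (s₀.re - (a - N)) / 2 with hr
  have hr0 : 0 < r := by linarith
  have hd : ∀ k, Differentiable ℂ fun s => (m k : ℂ) * shiftRemainder N (w k) b s := fun k =>
    (differentiable_shiftRemainder N (h.ne_zero k) (hb k)).const_mul _
  obtain ⟨C, hC0, hC⟩ := exists_negBinom_remainder N (‖s₀‖ + r)
  refine analyticAt_tsum_of_eventually (Metric.ball_mem_nhds s₀ hr0)
    ((h.summable (s₀.re - r + N) (by linarith)).mul_right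
      (Real.exp (Real.pi * (‖s₀‖ + r)) * C * ‖b‖ ^ N)) ?_ fun k => (hd k).analyticAt _
  filter_upwards [h.eventually_le_norm 1, h.eventually_le_norm (2 * ‖b‖), hre] with k hk hkb hkre
  refine ⟨(hd k).differentiableOn, fun s hs => ?_⟩
  have hpos : 0 < ‖w k‖ := by linarith
  have hbw : ‖b / w k‖ ≤ 1 / 2 := by
    rw [norm_div, div_le_iff₀ hpos]
    linarith
  rw [norm_mul, Complex.norm_natCast, mul_assoc, shiftRemainder_eq hkre hbw, norm_mul]
  gcongr (m k : ℝ) * ?_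
  have h1 := norm_cpow_neg_le_of_mem_ball hs hk
  have h2 := hC s (exp_bound_of_mem_ball hs).2.2 _ hbw
  have h3 : ‖w k‖ ^ (-(s₀.re - r + N)) = ‖w k‖ ^ (-(s₀.re - r)) / ‖w k‖ ^ N := by
    rw [neg_add, Real.rpow_add hpos, Real.rpow_neg hpos.le N, Real.rpow_natCast]
    rfl
  calc _ ≤ (‖w k‖ ^ (-(s₀.re - r)) * Real.exp (Real.pi * (‖s₀‖ + r))) * (C * ‖b / w k‖ ^ N) := by
        gcongr
    _ = _ := by
        rw [h3, norm_div, div_pow]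
        ring

/-- The continuation of the translated zeta function to `re s > a - N`. -/
noncomputable def shiftContinuation (m : ι → ℕ) (w : ι → ℂ) (F : ℂ → ℂ) (b : ℂ) (N : ℕ)
    (s : ℂ) : ℂ :=
  ∑ j ∈ Finset.range N, negBinom j s * b ^ j * F (s + j) +
    ∑' k, (m k : ℂ) * shiftRemainder N (w k) b s

theorem IsZetaContinuation.shift_isStripContinuation {F : ℂ → ℂ} (hF : IsZetaContinuation m w a F)
    (h : ConvergesBeyond m w a) (hre : ∀ᶠ k in cofinite, 0 < (w k).re) {b : ℂ}
    (hb : ∀ k, w k + b ≠ 0) (N : ℕ) {α : ℝ} (hα : a - N ≤ α) (β : ℝ) :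
    IsStripContinuation m (fun k => w k + b) a α β (shiftContinuation m w F b N) := by
  refine ⟨fun s hs => ?_, fun s hs _ => ?_⟩
  · refine MeromorphicAt.add ?_ (h.shiftRemainder_tsum hre hb N (hα.trans_lt hs.1)).1.meromorphicAt
    refine MeromorphicAt.fun_sum fun j _ => ?_
    refine MeromorphicAt.mul ?_ ?_
    · exact (((differentiable_negBinom j).analyticAt s).mul analyticAt_const).meromorphicAt
    · have hsh : AnalyticAt ℂ (fun z : ℂ => z + j) s := analyticAt_id.add analyticAt_const
      exact MeromorphicAt.comp_analyticAt (f := F) (g := fun z : ℂ => z + j)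
        (hF.meromorphic (s + j)) hsh
  · have hsum := (h.shiftRemainder_tsum hre hb N (s₀ := s) (by
      have : (0 : ℝ) ≤ N := Nat.cast_nonneg N
      linarith)).2.2.self_of_nhds
    have hj : ∀ j ∈ Finset.range N, HasSum (fun k => negBinom j s * b ^ j *
        ((m k : ℂ) * w k ^ (-(s + j)))) (negBinom j s * b ^ j * F (s + j)) := by
      intro j _
      refine (hF.hasSum (s + j) ?_).mul_left _
      have : (0 : ℝ) ≤ j := Nat.cast_nonneg j
      simp only [Complex.add_re, Complex.natCast_re]
      linarith
    have htot := (hasSum_sum hj).add hsum.hasSum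
    rw [shiftContinuation, ← htot.tsum_eq]
    refine tsum_congr fun k => ?_
    rw [shiftRemainder, mul_sub, Finset.mul_sum]
    have : ∑ j ∈ Finset.range N, negBinom j s * b ^ j * ((m k : ℂ) * w k ^ (-(s + j))) =
        ∑ j ∈ Finset.range N, (m k : ℂ) * (negBinom j s * b ^ j * w k ^ (-(s + j))) :=
      Finset.sum_congr rfl fun j _ => by ring
    rw [this]
    ring

/-- The function `A` is a regular form of the translated sum near $0$; it is needed when a pole of
`F` at some $j\ge1$ meets a zero of `negBinom j`. -/
theorem IsZetaContinuation.exists_shift {F A : ℂ → ℂ} (hF : IsZetaContinuation m w a F)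
    (h : ConvergesBeyond m w a) (ha : 0 ≤ a) (hre : ∀ᶠ k in cofinite, 0 < (w k).re) {b : ℂ}
    (hb : ∀ k, w k + b ≠ 0) {N : ℕ} (hN : a < N)
    (hA : AnalyticAt ℂ A 0) (hFA : shiftContinuation m w F b N =ᶠ[𝓝[≠] 0] A) :
    ∃ F', IsZetaContinuation m (fun k => w k + b) a F' ∧ deriv F' 0 = deriv A 0 := by
  have hw' := h.add_const ha hb
  have hstrip : IsStripContinuation m (fun k => w k + b) a (a - N) (a + 1)
      (shiftContinuation m w F b N) :=
    hF.shift_isStripContinuation h hre hb N le_rfl _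
  obtain ⟨F', hF'⟩ := exists_isZetaContinuation hw' ha (β := a + 1) (by linarith) (fun n => by
    obtain ⟨K, hK⟩ := exists_nat_ge (a + n)
    exact ⟨_, hF.shift_isStripContinuation h hre hb K (by linarith) _⟩)
    ⟨_, A, a - N, by linarith, hstrip, hFA, hA⟩
  refine ⟨F', hF', ?_⟩
  exact (hF'.eventuallyEq_nhds_zero hstrip (by linarith)
    ⟨by simpa using hN, by simp; linarith⟩ hFA hA).deriv_eq

theorem hasDerivAt_cpow_neg_zero {z : ℂ} (hz : z ≠ 0) :
    HasDerivAt (fun s : ℂ => z ^ (-s)) (-Complex.log z) 0 := by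
  have h := ((hasDerivAt_id (0 : ℂ)).neg).const_cpow (c := z) (Or.inl hz)
  simpa using h

/-- Translation for exponents of convergence below one. -/
theorem IsZetaContinuation.exists_shift_of_lt_one {F : ℂ → ℂ} (hF : IsZetaContinuation m w a F)
    (h : ConvergesBeyond m w a) (ha : 0 ≤ a) (ha1 : a < 1) (hre : ∀ᶠ k in cofinite, 0 < (w k).re)
    {b : ℂ} (hb : ∀ k, w k + b ≠ 0) :
    ∃ F', IsZetaContinuation m (fun k => w k + b) a F' ∧
      HasSum (fun k => (m k : ℂ) * (Complex.log (w k) - Complex.log (w k + b)))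
        (deriv F' 0 - deriv F 0) := by
  obtain ⟨hT1, hT2, -⟩ := h.shiftRemainder_tsum hre hb 1 (s₀ := 0) (by simpa using ha1)
  set T := fun s => ∑' k, (m k : ℂ) * shiftRemainder 1 (w k) b s with hT
  have hFA : shiftContinuation m w F b 1 = fun s => F s + T s := by
    funext s
    simp [shiftContinuation, negBinom, hT]
  obtain ⟨F', hF', hd⟩ := hF.exists_shift (A := fun s => F s + T s) h ha hre hb (N := 1)
    (by simpa using ha1) (hF.analyticAt_zero.add hT1) (by rw [hFA])
  refine ⟨F', hF', ?_⟩
  rw [hd, deriv_fun_add hF.analyticAt_zero.differentiableAt hT1.differentiableAt,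
    add_sub_cancel_left]
  refine hT2.congr_fun fun k => ?_
  have h1 := ((hasDerivAt_cpow_neg_zero (hb k)).sub
    (hasDerivAt_cpow_neg_zero (h.ne_zero k))).const_mul (m k : ℂ)
  have h2 : (fun s => (m k : ℂ) * shiftRemainder 1 (w k) b s) =
      fun s => (m k : ℂ) * ((w k + b) ^ (-s) - w k ^ (-s)) := by
    funext s
    simp [shiftRemainder, negBinom]
  rw [h2]
  refine Eq.symm (h1.deriv.trans ?_)
  ring

/-- Translation for the exponent of convergence one, with a simple pole at `1`. -/
theorem IsZetaContinuation.exists_shift_of_one {F Q : ℂ → ℂ} {κ : ℂ}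
    (hF : IsZetaContinuation m w 1 F) (h : ConvergesBeyond m w 1)
    (hre : ∀ᶠ k in cofinite, 0 < (w k).re) {b : ℂ} (hb : ∀ k, w k + b ≠ 0)
    (hQ : AnalyticAt ℂ Q 1) (hFQ : F =ᶠ[𝓝[≠] 1] fun s => κ / (s - 1) + Q s) :
    ∃ F', IsZetaContinuation m (fun k => w k + b) 1 F' ∧
      HasSum (fun k => (m k : ℂ) * (Complex.log (w k) - Complex.log (w k + b) + b / w k))
        (deriv F' 0 - deriv F 0 + b * Q 1) := by
  obtain ⟨hT1, hT2, -⟩ := h.shiftRemainder_tsum hre hb 2 (s₀ := 0) (by norm_num)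
  set T := fun s => ∑' k, (m k : ℂ) * shiftRemainder 2 (w k) b s with hT
  -- The term $-sb\,F(s+1)$ is $-b\kappa-sb\,Q(s+1)$ near $0$: the zero of $s$ cancels the pole of
  -- $F$ at $1$. Its derivative at $0$ is $-b\,Q(1)$, hence the correction in the conclusion.
  set A : ℂ → ℂ := fun s => F s + (-(b * κ) - s * b * Q (s + 1)) + T s with hA
  have hsh : AnalyticAt ℂ (fun s : ℂ => s + 1) 0 := analyticAt_id.add analyticAt_const
  have hQ' : AnalyticAt ℂ (fun s : ℂ => Q (s + 1)) 0 :=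
    AnalyticAt.fun_comp (f := fun s : ℂ => s + 1) (by simpa using hQ) hsh
  have hmid : AnalyticAt ℂ (fun s : ℂ => -(b * κ) - s * b * Q (s + 1)) 0 :=
    analyticAt_const.sub ((analyticAt_id.mul analyticAt_const).mul hQ')
  have hAan : AnalyticAt ℂ A 0 := (hF.analyticAt_zero.add hmid).add hT1
  have hFA : shiftContinuation m w F b 2 =ᶠ[𝓝[≠] 0] A := by
    have htend : Tendsto (fun s : ℂ => s + 1) (𝓝[≠] 0) (𝓝[≠] 1) := by
      refine tendsto_nhdsWithin_of_tendsto_nhds_of_eventually_within _ ?_ ?_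
      · have : Tendsto (fun s : ℂ => s + 1) (𝓝 0) (𝓝 (0 + 1)) := hsh.continuousAt.tendsto
        rw [zero_add] at this
        exact this.mono_left nhdsWithin_le_nhds
      · filter_upwards [self_mem_nhdsWithin] with s hs
        simpa using hs
    filter_upwards [htend.eventually hFQ, self_mem_nhdsWithin] with s hs hs0
    have hs0' : s ≠ 0 := hs0
    simp only [shiftContinuation, Finset.sum_range_succ, Finset.sum_range_zero, negBinom,
      Nat.cast_zero, Nat.cast_one, pow_zero, pow_one, add_zero, zero_add, mul_one, one_mul,
      hs, add_sub_cancel_right, div_one, hA, hT]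
    field_simp
    ring
  obtain ⟨F', hF', hd⟩ := hF.exists_shift h zero_le_one hre hb (N := 2) (by norm_num) hAan hFA
  refine ⟨F', hF', ?_⟩
  have hmidd : HasDerivAt (fun s : ℂ => -(b * κ) - s * b * Q (s + 1)) (-(b * Q 1)) 0 := by
    have h1 := (((hasDerivAt_id (0 : ℂ)).mul_const b).mul
      hQ'.differentiableAt.hasDerivAt).const_sub (-(b * κ))
    simpa using h1
  have hAd := (hF.analyticAt_zero.differentiableAt.hasDerivAt.add hmidd).add
    hT1.differentiableAt.hasDerivAt
  have hAd' : deriv A 0 = _ := hAd.deriv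
  rw [hd, hAd']
  have heq : deriv F 0 + -(b * Q 1) + deriv T 0 - deriv F 0 + b * Q 1 = deriv T 0 := by ring
  rw [heq]
  refine hT2.congr_fun fun k => ?_
  have hw1 : HasDerivAt (fun s : ℂ => s * b * w k ^ (-(s + 1))) (b * (w k)⁻¹) 0 := by
    have h1 : DifferentiableAt ℂ (fun s : ℂ => w k ^ (-(s + 1))) 0 :=
      (by fun_prop : DifferentiableAt ℂ (fun s : ℂ => -(s + 1)) 0).const_cpow
        (Or.inl (h.ne_zero k))
    have h2 := ((hasDerivAt_id (0 : ℂ)).mul_const b).mul h1.hasDerivAt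
    convert! h2 using 1
    simp [Complex.cpow_neg_one]
  have h1 := (((hasDerivAt_cpow_neg_zero (hb k)).sub
    (hasDerivAt_cpow_neg_zero (h.ne_zero k))).add hw1).const_mul (m k : ℂ)
  have h2 : (fun s => (m k : ℂ) * shiftRemainder 2 (w k) b s) =
      fun s => (m k : ℂ) * ((w k + b) ^ (-s) - w k ^ (-s) + s * b * w k ^ (-(s + 1))) := by
    funext s
    simp only [shiftRemainder, Finset.sum_range_succ, Finset.sum_range_zero, negBinom,
      Nat.cast_zero, Nat.cast_one, pow_zero, pow_one, add_zero, zero_add, mul_one, one_mul,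
      div_one]
    ring
  rw [h2]
  refine Eq.symm (h1.deriv.trans ?_)
  ring

end Shift

/-! ### The Laplace and Stieltjes transforms of powers -/

open MeasureTheory Set in
theorem integrableOn_cpow_mul_exp_neg {a w : ℂ} (ha : 0 < a.re) (hw : 0 < w.re) :
    IntegrableOn (fun t : ℝ => (t : ℂ) ^ (a - 1) * Complex.exp (-(w * t))) (Ioi 0) := by
  have h := integrableOn_rpow_mul_exp_neg_mul_rpow (p := 1) (s := a.re - 1) (b := w.re)
    (by linarith) one_pos hw
  refine Integrable.mono' h (Measurable.aestronglyMeasurable (by fun_prop)) ?_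
  filter_upwards [ae_restrict_mem measurableSet_Ioi] with t ht
  have ht0 : 0 < t := ht
  rw [norm_mul, Complex.norm_cpow_eq_rpow_re_of_pos ht0, Complex.norm_exp]
  simp

open MeasureTheory Set in
theorem differentiableOn_laplace_cpow {a : ℂ} (ha : 0 < a.re) :
    DifferentiableOn ℂ (fun w : ℂ => ∫ t in Ioi (0 : ℝ),
      (t : ℂ) ^ (a - 1) * Complex.exp (-(w * t))) {w | 0 < w.re} := by
  intro w₀ hw₀
  have hw₀' : 0 < w₀.re := hw₀
  have hmeas : ∀ w : ℂ, AEStronglyMeasurable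
      (fun t : ℝ => (t : ℂ) ^ (a - 1) * Complex.exp (-(w * t))) (volume.restrict (Ioi 0)) :=
    fun w => Measurable.aestronglyMeasurable (by fun_prop)
  have hball : Metric.ball w₀ (w₀.re / 2) ∈ 𝓝 w₀ := Metric.ball_mem_nhds _ (by linarith)
  refine (hasDerivAt_integral_of_dominated_loc_of_deriv_le
    (F' := fun w t => (t : ℂ) ^ (a - 1) * (Complex.exp (-(w * t)) * -(t : ℂ)))
    (bound := fun t => t ^ a.re * Real.exp (-(w₀.re / 2) * t ^ (1 : ℝ)))
    hball (Eventually.of_forall hmeas) (integrableOn_cpow_mul_exp_neg ha hw₀')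
    (Measurable.aestronglyMeasurable (by fun_prop)) ?_
    (integrableOn_rpow_mul_exp_neg_mul_rpow (by linarith) one_pos (by linarith))
    ?_).2.differentiableAt.differentiableWithinAt
  · filter_upwards [ae_restrict_mem measurableSet_Ioi] with t ht w hw
    have ht0 : 0 < t := ht
    have h1 := (exp_bound_of_mem_ball hw).1
    rw [norm_mul, norm_mul, Complex.norm_cpow_eq_rpow_re_of_pos ht0, Complex.norm_exp, norm_neg,
      Complex.norm_real, Real.norm_of_nonneg ht0.le, Complex.sub_re, Complex.one_re,
      Real.rpow_sub_one ht0.ne', Real.rpow_one]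
    have h2 : (-(w * (t : ℂ))).re ≤ -(w₀.re / 2) * t := by
      simp only [Complex.neg_re, Complex.mul_re, Complex.ofReal_re, Complex.ofReal_im]
      nlinarith
    calc t ^ a.re / t * (Real.exp (-(w * (t : ℂ))).re * t) = t ^ a.re *
          Real.exp (-(w * (t : ℂ))).re := by field_simp
      _ ≤ _ := by gcongr
  · refine Eventually.of_forall fun t w _ => ?_
    refine HasDerivAt.const_mul _ ?_
    have h1 : HasDerivAt (fun w : ℂ => -(w * (t : ℂ))) (-(1 * (t : ℂ))) w :=
      ((hasDerivAt_id w).mul_const _).neg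
    simpa using h1.cexp

open MeasureTheory Set in
/-- The Laplace transform of a power, on the right half-plane. -/
theorem integral_cpow_mul_exp_neg {a w : ℂ} (ha : 0 < a.re) (hw : 0 < w.re) :
    ∫ t in Ioi (0 : ℝ), (t : ℂ) ^ (a - 1) * Complex.exp (-(w * t)) =
      w ^ (-a) * Complex.Gamma a := by
  have hopen : IsOpen {w : ℂ | 0 < w.re} := isOpen_lt continuous_const Complex.continuous_re
  have hg : DifferentiableOn ℂ (fun w : ℂ => w ^ (-a) * Complex.Gamma a) {w | 0 < w.re} := by
    intro z hz
    exact ((differentiableAt_id.cpow_const (Or.inl hz)).mul_const _).differentiableWithinAt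
  -- Both sides are holomorphic in $w$ on the half-plane, and the formula is known for positive real
  -- $w$; the real points $1+1/(n+1)$ accumulate at $1$.
  refine AnalyticOnNhd.eqOn_of_preconnected_of_frequently_eq
    ((differentiableOn_laplace_cpow ha).analyticOnNhd hopen) (hg.analyticOnNhd hopen)
    (convex_halfSpace_re_gt 0).isPreconnected (z₀ := 1) (by simp) ?_ hw
  have hlim : Tendsto (fun n : ℕ => ((1 + 1 / ((n : ℝ) + 1) : ℝ) : ℂ)) atTop (𝓝[≠] 1) := by
    refine tendsto_nhdsWithin_of_tendsto_nhds_of_eventually_within _ ?_ ?_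
    · have h1 := (tendsto_one_div_add_atTop_nhds_zero_nat (𝕜 := ℝ)).const_add 1
      rw [add_zero] at h1
      have h2 := (Complex.continuous_ofReal.tendsto 1).comp h1
      rw [Complex.ofReal_one] at h2
      exact h2
    · refine Eventually.of_forall fun n => ?_
      have : (0 : ℝ) < 1 / ((n : ℝ) + 1) := by positivity
      simp only [mem_compl_iff, mem_singleton_iff, Complex.ofReal_eq_one]
      linarith
  refine hlim.frequently (Eventually.of_forall fun n => ?_).frequently
  have hr : (0 : ℝ) < 1 + 1 / ((n : ℝ) + 1) := by positivity
  rw [Complex.integral_cpow_mul_exp_neg_mul_Ioi ha hr, one_div, Complex.cpow_neg,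
    Complex.inv_cpow]
  rw [Complex.arg_ofReal_of_nonneg hr.le]
  exact Real.pi_pos.ne

open MeasureTheory Set in
/-- The Mellin transform of `y ↦ (w + y) ^ (-v)`. -/
theorem mellin_add_cpow_neg {u v w : ℂ} (hu : 0 < u.re) (huv : u.re < v.re) (hw : 0 < w.re) :
    mellin (fun y : ℝ => (w + y) ^ (-v)) u * Complex.Gamma v =
      w ^ (u - v) * Complex.Gamma u * Complex.Gamma (v - u) := by
  have hv : 0 < v.re := by linarith
  -- Fubini for this kernel: the $y$-integral produces $\Gamma(u)t^{-u}$, the $t$-integral produces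
  -- $\Gamma(v)(w+y)^{-v}$.
  set f : ℝ → ℝ → ℂ := fun t y => (t : ℂ) ^ (v - 1) * (y : ℂ) ^ (u - 1) *
    Complex.exp (-((w + y) * t)) with hf
  have hwy : ∀ y ∈ Ioi (0 : ℝ), 0 < (w + (y : ℂ)).re := by
    intro y hy
    have : 0 < y := hy
    simp only [Complex.add_re, Complex.ofReal_re]
    linarith
  have hfac : ∀ t y : ℝ, f t y = (t : ℂ) ^ (v - 1) * Complex.exp (-(w * t)) *
      ((y : ℂ) ^ (u - 1) * Complex.exp (-((t : ℂ) * y))) := by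
    intro t y
    simp only [hf]
    rw [show -((w + (y : ℂ)) * t) = -(w * t) + -((t : ℂ) * y) by ring, Complex.exp_add]
    ring
  have hmeas : AEStronglyMeasurable (Function.uncurry f)
      ((volume.restrict (Ioi (0 : ℝ))).prod (volume.restrict (Ioi (0 : ℝ)))) := by
    refine Measurable.aestronglyMeasurable ?_
    simp only [hf, Function.uncurry_def]
    fun_prop
  have hint : Integrable (Function.uncurry f)
      ((volume.restrict (Ioi (0 : ℝ))).prod (volume.restrict (Ioi (0 : ℝ)))) := by
    rw [integrable_prod_iff hmeas]
    constructor
    · filter_upwards [ae_restrict_mem measurableSet_Ioi] with t ht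
      have ht0 : 0 < t := ht
      simp only [Function.uncurry_apply_pair, hfac]
      exact (integrableOn_cpow_mul_exp_neg hu (by simpa using ht0)).const_mul _
    · have hb := ((integrableOn_cpow_mul_exp_neg (a := (v - u).re) (w := w.re)
        (by simpa using huv) (by simpa using hw)).norm).const_mul (Real.Gamma u.re)
      refine hb.congr ?_
      filter_upwards [ae_restrict_mem measurableSet_Ioi] with t ht
      have ht0 : 0 < t := ht
      have h1 : ∀ y ∈ Ioi (0 : ℝ), ‖Function.uncurry f (t, y)‖ =
          (t ^ (v.re - 1) * Real.exp (-(w.re * t))) * (y ^ (u.re - 1) * Real.exp (-(t * y))) := by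
        intro y hy
        have hy0 : 0 < y := hy
        rw [Function.uncurry_apply_pair, hfac, norm_mul, norm_mul, norm_mul,
          Complex.norm_cpow_eq_rpow_re_of_pos ht0, Complex.norm_cpow_eq_rpow_re_of_pos hy0,
          Complex.norm_exp, Complex.norm_exp]
        simp
      rw [setIntegral_congr_fun measurableSet_Ioi h1, integral_const_mul,
        Real.integral_rpow_mul_exp_neg_mul_Ioi hu ht0, norm_mul,
        Complex.norm_cpow_eq_rpow_re_of_pos ht0, Complex.norm_exp]
      have h2 : t ^ ((v - u).re - 1) = t ^ (v.re - 1) * (1 / t) ^ u.re := by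
        rw [one_div, Real.inv_rpow ht0.le, ← Real.rpow_neg ht0.le, ← Real.rpow_add ht0,
          Complex.sub_re]
        ring_nf
      simp only [Complex.sub_re, Complex.ofReal_re, Complex.one_re, Complex.neg_re,
        Complex.mul_re, Complex.ofReal_im, mul_zero, sub_zero] at h2 ⊢
      rw [h2]
      ring
  have hswap := integral_integral_swap hint
  have hL : ∫ t in Ioi (0 : ℝ), ∫ y in Ioi (0 : ℝ), f t y =
      w ^ (u - v) * Complex.Gamma u * Complex.Gamma (v - u) := by
    have h1 : ∀ t ∈ Ioi (0 : ℝ), ∫ y in Ioi (0 : ℝ), f t y =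
        Complex.Gamma u * ((t : ℂ) ^ ((v - u) - 1) * Complex.exp (-(w * t))) := by
      intro t ht
      have ht0 : 0 < t := ht
      have htc : (t : ℂ) ≠ 0 := by exact_mod_cast ht0.ne'
      simp only [hfac]
      rw [integral_const_mul, integral_cpow_mul_exp_neg hu (by simpa using ht0),
        show v - u - 1 = v - 1 + -u by ring, Complex.cpow_add _ _ htc]
      ring
    rw [setIntegral_congr_fun measurableSet_Ioi h1, integral_const_mul,
      integral_cpow_mul_exp_neg (by simpa using huv) hw, neg_sub]
    ring
  have hR : ∫ y in Ioi (0 : ℝ), ∫ t in Ioi (0 : ℝ), f t y =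
      mellin (fun y : ℝ => (w + y) ^ (-v)) u * Complex.Gamma v := by
    have h1 : ∀ y ∈ Ioi (0 : ℝ), ∫ t in Ioi (0 : ℝ), f t y =
        ((y : ℂ) ^ (u - 1) • (w + y) ^ (-v)) * Complex.Gamma v := by
      intro y hy
      have h2 : ∀ t : ℝ, f t y = (y : ℂ) ^ (u - 1) *
          ((t : ℂ) ^ (v - 1) * Complex.exp (-((w + y) * t))) := by
        intro t
        simp only [hf]
        ring
      simp only [h2]
      rw [integral_const_mul, integral_cpow_mul_exp_neg hv (hwy y hy), smul_eq_mul]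
      ring
    rw [setIntegral_congr_fun measurableSet_Ioi h1, integral_mul_const]
    rfl
  rw [← hR, ← hswap, hL]

theorem mellin_add_pow_inv {k : ℕ} {u w : ℂ} (hu : 0 < u.re) (huk : u.re < k)
    (hw : 0 < w.re) :
    mellin (fun y : ℝ => ((w + y) ^ k)⁻¹) u * Complex.Gamma k =
      w ^ (u - k) * Complex.Gamma u * Complex.Gamma (k - u) := by
  rw [← mellin_add_cpow_neg (v := k) hu (by simpa using huk) hw]
  congr 2
  funext y
  rw [Complex.cpow_neg, Complex.cpow_natCast]

/-! ### Continuation of a zeta function by a Mellin transform -/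

theorem mellin_of_continuousOn {f : ℝ → ℂ} (hf : ContinuousOn f (Set.Ici 0)) {a : ℝ}
    (hO : f =O[atTop] fun y => y ^ (-a)) {u : ℂ} (hu : 0 < u.re) (hua : u.re < a) :
    MellinConvergent f u ∧ DifferentiableAt ℂ (mellin f) u := by
  have hloc : MeasureTheory.LocallyIntegrableOn f (Set.Ioi 0) :=
    (hf.mono Set.Ioi_subset_Ici_self).locallyIntegrableOn measurableSet_Ioi
  have h0 : f =O[𝓝[>] 0] fun y : ℝ => y ^ (-(0 : ℝ)) := by
    simp only [neg_zero, Real.rpow_zero]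
    have h1 : Tendsto f (𝓝[>] 0) (𝓝 (f 0)) :=
      (hf 0 Set.self_mem_Ici).mono_left (nhdsWithin_mono _ Set.Ioi_subset_Ici_self)
    exact h1.isBigO_one ℝ
  exact ⟨mellinConvergent_of_isBigO_rpow hloc hO hua h0 hu,
    mellin_differentiableAt_of_isBigO_rpow hloc hO hua h0 hu⟩

theorem add_ofReal_ne_zero {w : ℂ} (hw : 0 < w.re) {y : ℝ} (hy : 0 ≤ y) : w + (y : ℂ) ≠ 0 := by
  intro h
  have := congrArg Complex.re h
  simp only [Complex.add_re, Complex.ofReal_re, Complex.zero_re] at this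
  linarith

theorem continuousOn_add_pow_inv {w : ℂ} (hw : 0 < w.re) (k : ℕ) :
    ContinuousOn (fun y : ℝ => ((w + y) ^ k)⁻¹) (Set.Ici 0) := by
  refine ContinuousOn.inv₀ (by fun_prop) fun y hy => pow_ne_zero _ ?_
  exact add_ofReal_ne_zero hw hy

theorem isBigO_add_pow_inv {w : ℂ} (hw : 0 < w.re) (k : ℕ) :
    (fun y : ℝ => ((w + y) ^ k)⁻¹) =O[atTop] fun y : ℝ => y ^ (-(k : ℝ)) := by
  refine IsBigO.of_bound 1 ?_
  filter_upwards [eventually_gt_atTop 0] with y hy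
  rw [one_mul, norm_inv, norm_pow, Real.norm_of_nonneg (by positivity), Real.rpow_neg hy.le,
    Real.rpow_natCast]
  gcongr
  have h1 := Complex.re_le_norm (w + (y : ℂ))
  simp only [Complex.add_re, Complex.ofReal_re] at h1
  linarith

theorem mellinConvergent_add_pow_inv {w : ℂ} (hw : 0 < w.re) {k : ℕ} {u : ℂ} (hu : 0 < u.re)
    (huk : u.re < k) : MellinConvergent (fun y : ℝ => ((w + y) ^ k)⁻¹) u :=
  (mellin_of_continuousOn (continuousOn_add_pow_inv hw k) (isBigO_add_pow_inv hw k) hu huk).1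

/-- In the right half-plane $|w+y|^2\ge|w|^2+y^2\ge\tfrac12(|w|+y)^2$. This replaces $w$ by $|w|$ in
the estimate of the Mellin integrals, with a constant independent of $w$. -/
theorem norm_add_sq_inv_le {w : ℂ} (hw : 0 < w.re) {y : ℝ} (hy : 0 ≤ y) :
    ‖((w + y) ^ 2)⁻¹‖ ≤ 2 * ((‖w‖ + y) ^ 2)⁻¹ := by
  have h1 : ‖w + (y : ℂ)‖ ^ 2 = ‖w‖ ^ 2 + 2 * y * w.re + y ^ 2 := by
    rw [Complex.sq_norm, Complex.sq_norm, Complex.normSq_apply, Complex.normSq_apply]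
    simp
    ring
  have hw0 : 0 < ‖w‖ := norm_pos_iff.2 (by rintro rfl; simp at hw)
  rw [norm_inv, norm_pow, h1, ← div_eq_mul_inv, inv_le_comm₀ (by positivity) (by positivity),
    inv_div, div_le_iff₀ (by norm_num)]
  nlinarith [sq_nonneg (‖w‖ - y), mul_nonneg hy hw.le]

open MeasureTheory Set in
-- After comparison with $|w|$ the integral is itself a Mellin transform with a closed form. The
-- resulting factor $|w|^{-\operatorname{Re}s}$ is what the sum over the zeros can absorb.
theorem integral_norm_le {w : ℂ} (hw : 0 < w.re) {s : ℂ} (hs : 0 < s.re) (hs2 : s.re < 2) :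
    ∫ y in Ioi (0 : ℝ), ‖(y : ℂ) ^ (2 - s - 1) • ((w + y) ^ 2)⁻¹‖ ≤
      2 * ‖Complex.Gamma (2 - s.re) * Complex.Gamma s.re‖ * ‖w‖ ^ (-s.re) := by
  have hw0 : 0 < ‖w‖ := norm_pos_iff.2 (by rintro rfl; simp at hw)
  have hwre : 0 < ((‖w‖ : ℝ) : ℂ).re := by simpa using hw0
  have hc1 := mellinConvergent_add_pow_inv hw (k := 2) (u := 2 - s) (by simpa using hs2)
    (by simpa using hs)
  have hc2 := mellinConvergent_add_pow_inv hwre (k := 2) (u := 2 - s.re)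
    (by simpa using hs2) (by simpa using hs)
  have hpt : ∀ y ∈ Ioi (0 : ℝ), ‖(y : ℂ) ^ ((2 : ℂ) - s.re - 1) • (((‖w‖ : ℂ) + y) ^ 2)⁻¹‖ =
      y ^ (1 - s.re) * ((‖w‖ + y) ^ 2)⁻¹ := by
    intro y hy
    have hy0 : 0 < y := hy
    rw [norm_smul, Complex.norm_cpow_eq_rpow_re_of_pos hy0, norm_inv, norm_pow,
      ← Complex.ofReal_add, Complex.norm_real, Real.norm_of_nonneg (by positivity)]
    congr 2
    simp
    ring
  have hval : ∫ y in Ioi (0 : ℝ), y ^ (1 - s.re) * ((‖w‖ + y) ^ 2)⁻¹ =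
      ‖mellin (fun y : ℝ => (((‖w‖ : ℂ) + y) ^ 2)⁻¹) (2 - s.re)‖ := by
    have h1 : mellin (fun y : ℝ => (((‖w‖ : ℂ) + y) ^ 2)⁻¹) (2 - s.re) =
        ((∫ y in Ioi (0 : ℝ), y ^ (1 - s.re) * ((‖w‖ + y) ^ 2)⁻¹ : ℝ) : ℂ) := by
      rw [mellin, ← integral_complex_ofReal]
      refine setIntegral_congr_fun measurableSet_Ioi fun y hy => ?_
      have hy0 : 0 < y := hy
      simp only [smul_eq_mul]
      push_cast
      rw [Complex.ofReal_cpow hy0.le]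
      congr 2
      push_cast
      ring
    rw [h1, Complex.norm_real, Real.norm_of_nonneg]
    refine setIntegral_nonneg measurableSet_Ioi fun y hy => ?_
    have hy0 : 0 < y := hy
    positivity
  have hG := mellin_add_pow_inv (k := 2) (u := 2 - s.re) (w := ‖w‖) (by simpa using hs2)
    (by simpa using hs) hwre
  have hΓ2 : Complex.Gamma ((2 : ℕ) : ℂ) = 1 := by
    have := Complex.Gamma_nat_eq_factorial 1
    norm_num at this ⊢
  rw [hΓ2, mul_one] at hG
  calc _ ≤ ∫ y in Ioi (0 : ℝ), 2 * ‖(y : ℂ) ^ ((2 : ℂ) - s.re - 1) • (((‖w‖ : ℂ) + y) ^ 2)⁻¹‖ := by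
        refine setIntegral_mono_on hc1.norm (hc2.norm.const_mul 2) measurableSet_Ioi fun y hy => ?_
        have hy0 : 0 < y := hy
        rw [hpt y hy, norm_smul, Complex.norm_cpow_eq_rpow_re_of_pos hy0]
        have h3 := norm_add_sq_inv_le hw hy0.le
        have h4 : (2 - s - 1).re = 1 - s.re := by simp; ring
        rw [h4]
        calc _ ≤ y ^ (1 - s.re) * (2 * ((‖w‖ + y) ^ 2)⁻¹) := by gcongr
          _ = _ := by ring
    _ = 2 * ‖mellin (fun y : ℝ => (((‖w‖ : ℂ) + y) ^ 2)⁻¹) (2 - s.re)‖ := by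
        rw [integral_const_mul, setIntegral_congr_fun measurableSet_Ioi hpt, hval]
    _ = _ := by
        rw [hG]
        simp only [norm_mul]
        rw [← Complex.ofReal_ofNat 2, ← Complex.ofReal_sub, Complex.norm_cpow_eq_rpow_re_of_pos hw0]
        have h5 : ((((2 - s.re : ℝ) : ℂ)) - ((2 : ℕ) : ℂ)).re = -s.re := by simp
        have h6 : (((2 : ℕ) : ℂ) - ((2 - s.re : ℝ) : ℂ)) = s.re := by push_cast; ring
        rw [h5, h6]
        ring

section Base

variable {ι : Type*} {m : ι → ℕ} {w : ι → ℂ} {ψ : ℝ → ℂ}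

open MeasureTheory Set in
-- Termwise Mellin transformation, legitimate because the integrals of the norms are
-- $O(|w_k|^{-\operatorname{Re}s})$. The power two is used because $\sum m_k/|w_k|^2$ converges,
-- whereas exponent one is only the abscissa.
theorem ConvergesBeyond.mellin_eq (h : ConvergesBeyond m w 1) (hre : ∀ k, 0 < (w k).re)
    (hψ : ∀ y : ℝ, 0 < y → HasSum (fun k => (m k : ℂ) * ((w k + y) ^ 2)⁻¹) (ψ y)) {s : ℂ}
    (hs : 1 < s.re) (hs2 : s.re < 2) :
    mellin ψ (2 - s) = (∑' k, (m k : ℂ) * w k ^ (-s)) *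
      (Complex.Gamma (2 - s) * Complex.Gamma s) := by
  have hcount := h.countable
  have hu : 0 < (2 - s).re := by simpa using hs2
  have hu2 : (2 - s).re < (2 : ℕ) := by simp; linarith
  have hconv : ∀ k, Integrable (fun y : ℝ => (y : ℂ) ^ (2 - s - 1) • ((w k + y) ^ 2)⁻¹)
      (volume.restrict (Ioi 0)) := fun k => mellinConvergent_add_pow_inv (hre k) hu hu2
  have hsum := hasSum_integral_of_summable_integral_norm
    (F := fun k (y : ℝ) => (m k : ℂ) * ((y : ℂ) ^ (2 - s - 1) • ((w k + y) ^ 2)⁻¹))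
    (μ := volume.restrict (Ioi (0 : ℝ))) (fun k => (hconv k).const_mul _) (by
      refine Summable.of_nonneg_of_le (fun k => integral_nonneg fun y => norm_nonneg _)
        (fun k => ?_) ((h.summable s.re hs).mul_left
          (2 * ‖Complex.Gamma (2 - s.re) * Complex.Gamma s.re‖))
      simp only [norm_mul, Complex.norm_natCast]
      rw [integral_const_mul]
      calc _ ≤ (m k : ℝ) * (2 * ‖Complex.Gamma (2 - s.re) * Complex.Gamma s.re‖ *
            ‖w k‖ ^ (-s.re)) := by
            gcongr
            exact integral_norm_le (hre k) (by linarith) hs2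
        _ = _ := by rw [norm_mul]; ring)
  have hΓ2 : Complex.Gamma ((2 : ℕ) : ℂ) = 1 := by
    have := Complex.Gamma_nat_eq_factorial 1
    norm_num at this ⊢
  have hterm : ∀ k, ∫ y in Ioi (0 : ℝ), (m k : ℂ) * ((y : ℂ) ^ (2 - s - 1) • ((w k + y) ^ 2)⁻¹) =
      (m k : ℂ) * w k ^ (-s) * (Complex.Gamma (2 - s) * Complex.Gamma s) := by
    intro k
    have h1 := mellin_add_pow_inv (k := 2) hu hu2 (hre k)
    rw [hΓ2, mul_one, mellin] at h1
    rw [integral_const_mul, h1]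
    push_cast
    rw [show (2 : ℂ) - s - 2 = -s by ring, show (2 : ℂ) - (2 - s) = s by ring]
    ring
  simp only [hterm] at hsum
  rw [← tsum_mul_right, hsum.tsum_eq, mellin]
  refine setIntegral_congr_fun measurableSet_Ioi fun y hy => ?_
  have h2 := ((hψ y hy).mul_left ((y : ℂ) ^ (2 - s - 1))).tsum_eq
  simp only [smul_eq_mul]
  rw [← h2]
  exact tsum_congr fun k => by ring

open MeasureTheory Set in
-- Subtracting $K$ terms of the expansion in powers of $1/(x_0+y)$ leaves a function continuous at
-- $0$ and $O(y^{-K-1})$, whose Mellin transform at $2-s$ is holomorphic for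
-- $1-K<\operatorname{Re}s<2$; the subtracted terms have explicit transforms. The factor `g k`, a
-- form of $\Gamma(k-2+s)/(\Gamma(k)\Gamma(s))$, is left free so that it can be chosen without
-- spurious values at the poles of $\Gamma$.
theorem ConvergesBeyond.mellin_isStripContinuation (h : ConvergesBeyond m w 1)
    (hre : ∀ k, 0 < (w k).re)
    (hψ : ∀ y : ℝ, 0 < y → HasSum (fun k => (m k : ℂ) * ((w k + y) ^ 2)⁻¹) (ψ y))
    (hψc : ContinuousOn ψ (Ici 0)) {x₀ : ℝ} (hx₀ : 0 < x₀) {K : ℕ} {c : ℕ → ℂ}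
    (hO : (fun y : ℝ => ψ y - ∑ k ∈ Finset.Icc 1 K, c k * (((x₀ : ℂ) + y) ^ k)⁻¹) =O[atTop]
      fun y : ℝ => y ^ (-((K : ℝ) + 1)))
    {g : ℕ → ℂ → ℂ} (hgm : ∀ k s, MeromorphicAt (g k) s)
    (hg : ∀ k ∈ Finset.Icc 1 K, ∀ s : ℂ, 1 < s.re → s.re < 2 →
      g k s * Complex.Gamma k * Complex.Gamma s = Complex.Gamma (k - 2 + s)) :
    (∀ s ∈ verticalStrip (1 - K) 2, AnalyticAt ℂ (fun s => mellin (fun y : ℝ => ψ y -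
      ∑ k ∈ Finset.Icc 1 K, c k * (((x₀ : ℂ) + y) ^ k)⁻¹) (2 - s)) s) ∧
    IsStripContinuation m w 1 (1 - K) 2 fun s =>
      ∑ k ∈ Finset.Icc 1 K, c k * (x₀ : ℂ) ^ (2 - s - k) * g k s +
        mellin (fun y : ℝ => ψ y - ∑ k ∈ Finset.Icc 1 K, c k * (((x₀ : ℂ) + y) ^ k)⁻¹) (2 - s) *
          ((Complex.Gamma (2 - s))⁻¹ * (Complex.Gamma s)⁻¹) := by
  have hx₀' : 0 < (x₀ : ℂ).re := by simpa using hx₀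
  have hx₀c : (x₀ : ℂ) ≠ 0 := by exact_mod_cast hx₀.ne'
  set r : ℝ → ℂ := fun y : ℝ => ψ y - ∑ k ∈ Finset.Icc 1 K, c k * (((x₀ : ℂ) + y) ^ k)⁻¹ with hr
  have hrc : ContinuousOn r (Ici 0) :=
    hψc.sub (continuousOn_finsetSum _ fun k _ =>
      continuousOn_const.mul (continuousOn_add_pow_inv hx₀' k))
  have hmell : ∀ s ∈ verticalStrip (1 - K) 2, MellinConvergent r (2 - s) ∧
      DifferentiableAt ℂ (mellin r) (2 - s) := by
    intro s hs
    refine mellin_of_continuousOn hrc hO ?_ ?_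
    · simpa using hs.2
    · have := hs.1
      simp
      linarith
  have han : ∀ s ∈ verticalStrip (1 - K) 2, AnalyticAt ℂ (fun s => mellin r (2 - s)) s := by
    intro s hs
    have hd : DifferentiableOn ℂ (fun s => mellin r (2 - s)) (verticalStrip (1 - K) 2) := by
      intro z hz
      exact ((hmell z hz).2.comp (f := fun z : ℂ => 2 - z) z
        (by fun_prop)).differentiableWithinAt
    exact hd.analyticAt ((isOpen_verticalStrip _ _).mem_nhds hs)
  refine ⟨han, fun s hs => ?_, fun s hs hs2 => ?_⟩
  · refine MeromorphicAt.add (MeromorphicAt.fun_sum fun k _ => ?_) ?_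
    · refine MeromorphicAt.mul (AnalyticAt.meromorphicAt ?_) (hgm k s)
      refine Differentiable.analyticAt (fun z => ?_) s
      refine DifferentiableAt.const_mul ?_ _
      exact (by fun_prop : DifferentiableAt ℂ (fun s : ℂ => 2 - s - k) z).const_cpow (Or.inl hx₀c)
    · refine (AnalyticAt.mul (han s hs) (AnalyticAt.mul ?_ ?_)).meromorphicAt
      · exact Differentiable.analyticAt (Complex.differentiable_one_div_Gamma.comp
          (f := fun z : ℂ => 2 - z) (by fun_prop)) s
      · exact Complex.differentiable_one_div_Gamma.analyticAt s
  · have hK : (0 : ℝ) ≤ K := Nat.cast_nonneg K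
    have hΓ1 : Complex.Gamma (2 - s) ≠ 0 := Complex.Gamma_ne_zero_of_re_pos (by simpa using hs2)
    have hΓ2 : Complex.Gamma s ≠ 0 := Complex.Gamma_ne_zero_of_re_pos (by linarith)
    have hmain := h.mellin_eq hre hψ hs hs2
    have hck : ∀ k ∈ Finset.Icc 1 K,
        MellinConvergent (fun y : ℝ => (((x₀ : ℂ) + y) ^ k)⁻¹) (2 - s) := by
      intro k hk
      have hk1 : (1 : ℝ) ≤ k := by exact_mod_cast (Finset.mem_Icc.1 hk).1
      refine mellinConvergent_add_pow_inv hx₀' (by simpa using hs2) ?_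
      simp
      linarith
    have hsplit : mellin ψ (2 - s) = mellin r (2 - s) + ∑ k ∈ Finset.Icc 1 K,
        c k * mellin (fun y : ℝ => (((x₀ : ℂ) + y) ^ k)⁻¹) (2 - s) := by
      have hint : ∀ k ∈ Finset.Icc 1 K, Integrable (fun y : ℝ => c k *
          ((y : ℂ) ^ (2 - s - 1) • (((x₀ : ℂ) + y) ^ k)⁻¹)) (volume.restrict (Ioi 0)) :=
        fun k hk => Integrable.const_mul (hck k hk) _
      have hrint : Integrable (fun y : ℝ => (y : ℂ) ^ (2 - s - 1) • r y)
          (volume.restrict (Ioi 0)) := (hmell s ⟨by linarith, hs2⟩).1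
      simp only [mellin]
      simp only [← integral_const_mul]
      rw [← integral_finsetSum _ hint, ← integral_add hrint (integrable_finsetSum _ hint)]
      refine integral_congr_ae (Eventually.of_forall fun y => ?_)
      simp only [hr, smul_eq_mul, mul_sub, Finset.mul_sum]
      have : ∑ k ∈ Finset.Icc 1 K, (y : ℂ) ^ (2 - s - 1) * (c k * (((x₀ : ℂ) + y) ^ k)⁻¹) =
          ∑ k ∈ Finset.Icc 1 K, c k * ((y : ℂ) ^ (2 - s - 1) * (((x₀ : ℂ) + y) ^ k)⁻¹) :=
        Finset.sum_congr rfl fun k _ => by ring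
      rw [this]
      ring
    have hgk : ∀ k ∈ Finset.Icc 1 K, c k * mellin (fun y : ℝ => (((x₀ : ℂ) + y) ^ k)⁻¹) (2 - s) =
        c k * (x₀ : ℂ) ^ (2 - s - k) * g k s * (Complex.Gamma (2 - s) * Complex.Gamma s) := by
      intro k hk
      have hk1 : (1 : ℝ) ≤ k := by exact_mod_cast (Finset.mem_Icc.1 hk).1
      have hΓk : Complex.Gamma k ≠ 0 := Complex.Gamma_ne_zero_of_re_pos
        (by rw [Complex.natCast_re]; linarith)
      have h1 := mellin_add_pow_inv (k := k) (u := 2 - s) (w := x₀) (by simpa using hs2)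
        (by simp; linarith) hx₀'
      rw [show (k : ℂ) - (2 - s) = k - 2 + s by ring, ← hg k hk s hs hs2] at h1
      have h2 : mellin (fun y : ℝ => (((x₀ : ℂ) + y) ^ k)⁻¹) (2 - s) =
          (x₀ : ℂ) ^ (2 - s - k) * g k s * (Complex.Gamma (2 - s) * Complex.Gamma s) := by
        apply mul_right_cancel₀ hΓk
        rw [h1]
        ring
      rw [h2]
      ring
    rw [hsplit, Finset.sum_congr rfl hgk, ← Finset.sum_mul] at hmain
    apply mul_right_cancel₀ (mul_ne_zero hΓ1 hΓ2)
    rw [← hmain]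
    field_simp
    ring

end Base

section Base

variable {ι : Type*} {m : ι → ℕ} {w : ι → ℂ} {ψ : ℝ → ℂ}

/-- All orders $K$ together give the continuation to the whole plane, while $K=2$ already covers the
points $1$ and $0$, where it is explicit. At $0$ the factor $1/\Gamma(s)$ has a simple zero, so the
derivative reads off the Mellin transform at $2$. -/
theorem ConvergesBeyond.exists_base (h : ConvergesBeyond m w 1) (hre : ∀ k, 0 < (w k).re)
    (hψ : ∀ y : ℝ, 0 < y → HasSum (fun k => (m k : ℂ) * ((w k + y) ^ 2)⁻¹) (ψ y))
    (hψc : ContinuousOn ψ (Set.Ici 0)) {x₀ : ℝ} (hx₀ : 0 < x₀)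
    (hexp : ∀ K : ℕ, ∃ c : ℕ → ℂ,
      (fun y : ℝ => ψ y - ∑ k ∈ Finset.Icc 1 K, c k * (((x₀ : ℂ) + y) ^ k)⁻¹) =O[atTop]
        fun y : ℝ => y ^ (-((K : ℝ) + 1)))
    {c : ℕ → ℂ}
    (hO : (fun y : ℝ => ψ y - ∑ k ∈ Finset.Icc 1 2, c k * (((x₀ : ℂ) + y) ^ k)⁻¹) =O[atTop]
        fun y : ℝ => y ^ (-(((2 : ℕ) : ℝ) + 1))) :
    ∃ F Q : ℂ → ℂ, IsZetaContinuation m w 1 F ∧ AnalyticAt ℂ Q 1 ∧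
      (F =ᶠ[𝓝[≠] 1] fun s => c 1 / (s - 1) + Q s) ∧
      Q 1 = -c 1 * Complex.log x₀ + c 2 / x₀ + mellin (fun y : ℝ => ψ y -
        ∑ k ∈ Finset.Icc 1 2, c k * (((x₀ : ℂ) + y) ^ k)⁻¹) 1 ∧
      deriv F 0 = c 1 * (x₀ * Complex.log x₀ - x₀) - c 2 * Complex.log x₀ + mellin (fun y : ℝ =>
        ψ y - ∑ k ∈ Finset.Icc 1 2, c k * (((x₀ : ℂ) + y) ^ k)⁻¹) 2 := by
  have hx₀c : (x₀ : ℂ) ≠ 0 := by exact_mod_cast hx₀.ne'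
  have hstrip : ∀ N : ℕ, ∃ F, IsStripContinuation m w 1 (-(N : ℝ)) 2 F := by
    intro N
    obtain ⟨d, hd⟩ := hexp (N + 1)
    have hΓinv : Meromorphic fun s : ℂ => (Complex.Gamma s)⁻¹ := fun s =>
      (Complex.differentiable_one_div_Gamma.analyticAt s).meromorphicAt
    have := (h.mellin_isStripContinuation hre hψ hψc hx₀ hd
      (g := fun k s => Complex.Gamma (k - 2 + s) / Complex.Gamma k * (Complex.Gamma s)⁻¹)
      (fun k s => by
        refine MeromorphicAt.mul (MeromorphicAt.div ?_ (MeromorphicAt.const _ _)) (hΓinv s)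
        have h1 : MeromorphicAt (fun s : ℂ => ((Complex.Gamma (k - 2 + s))⁻¹)⁻¹) s :=
          (Differentiable.analyticAt (Complex.differentiable_one_div_Gamma.comp
            (f := fun z : ℂ => k - 2 + z) (by fun_prop)) s).meromorphicAt.inv
        simpa using h1)
      (fun k hk s hs hs2 => by
        have hΓ2 : Complex.Gamma s ≠ 0 := Complex.Gamma_ne_zero_of_re_pos (by linarith)
        have hk1 : (1 : ℝ) ≤ k := by exact_mod_cast (Finset.mem_Icc.1 hk).1
        have hΓk : Complex.Gamma k ≠ 0 := Complex.Gamma_ne_zero_of_re_pos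
          (by rw [Complex.natCast_re]; linarith)
        field_simp)).2
    rw [show (1 : ℝ) - ((N + 1 : ℕ) : ℝ) = -N by push_cast; ring] at this
    exact ⟨_, this⟩
  have hΓ2 : Complex.Gamma ((2 : ℕ) : ℂ) = 1 := by
    have := Complex.Gamma_nat_eq_factorial 1
    norm_num at this ⊢
  -- For $k=1$ the Gamma quotient is $1/(s-1)$ and for $k=2$ it is $1$; written in this way the
  -- continuation is visibly regular at $0$.
  obtain ⟨hMan, hF₂⟩ := h.mellin_isStripContinuation hre hψ hψc hx₀ hO
    (g := fun k s => if k = 1 then (s - 1)⁻¹ else 1)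
    (fun k s => by
      by_cases hk : k = 1
      · simp only [hk, if_true]
        exact ((MeromorphicAt.id s).sub (MeromorphicAt.const 1 s)).inv
      · simp only [hk, if_false]
        exact MeromorphicAt.const 1 s)
    (fun k hk s hs hs2 => by
      rw [Finset.mem_Icc] at hk
      have hs1 : s - 1 ≠ 0 := by
        intro h0
        rw [sub_eq_zero] at h0
        rw [h0] at hs
        simp at hs
      obtain rfl | rfl : k = 1 ∨ k = 2 := by omega
      · have h1 := Complex.Gamma_add_one (s - 1) hs1
        rw [sub_add_cancel] at h1
        rw [if_pos rfl, h1, Nat.cast_one, Complex.Gamma_one, mul_one, inv_mul_cancel_left₀ hs1]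
        congr 1
        ring
      · rw [hΓ2]
        simp)
  set M : ℂ → ℂ := mellin (fun y : ℝ => ψ y -
        ∑ k ∈ Finset.Icc 1 2, c k * (((x₀ : ℂ) + y) ^ k)⁻¹) with hM
  have hIcc : Finset.Icc 1 2 = ({1, 2} : Finset ℕ) := rfl
  set J : ℂ → ℂ := fun s => M (2 - s) * ((Complex.Gamma (2 - s))⁻¹ * (Complex.Gamma s)⁻¹) with hJ
  set R : ℂ → ℂ := fun s => c 2 * (x₀ : ℂ) ^ (-s) + J s with hR
  set F₂ : ℂ → ℂ := fun s => c 1 * (x₀ : ℂ) ^ (1 - s) * (s - 1)⁻¹ + R s with hF₂def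
  have hF₂' : IsStripContinuation m w 1 (-1) 2 F₂ := by
    convert hF₂ using 1
    · norm_num
    · funext s
      rw [hIcc, Finset.sum_insert (by simp), Finset.sum_singleton, hF₂def, hR, hJ]
      simp only [if_true, Nat.cast_one, Nat.cast_ofNat, if_neg (show ¬ (2 : ℕ) = 1 by omega)]
      rw [show (2 : ℂ) - s - 1 = 1 - s by ring, show (2 : ℂ) - s - 2 = -s by ring]
      ring
  have hz1 : verticalStrip (1 - ((2 : ℕ) : ℝ)) 2 = verticalStrip (-1) 2 := by norm_num
  rw [hz1] at hMan
  have hpow : ∀ a : ℂ, Differentiable ℂ fun s : ℂ => (x₀ : ℂ) ^ (a - s) := fun a z =>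
    (by fun_prop : DifferentiableAt ℂ (fun s : ℂ => a - s) z).const_cpow (Or.inl hx₀c)
  have hpow' : Differentiable ℂ fun s : ℂ => (x₀ : ℂ) ^ (-s) := by
    simpa using hpow 0
  have hΓa : Differentiable ℂ fun s : ℂ => (Complex.Gamma (2 - s))⁻¹ :=
    Complex.differentiable_one_div_Gamma.comp (f := fun z : ℂ => 2 - z) (by fun_prop)
  have hΓb : Differentiable ℂ fun s : ℂ => (Complex.Gamma s)⁻¹ :=
    Complex.differentiable_one_div_Gamma
  have hJan : ∀ s ∈ verticalStrip (-1) 2, AnalyticAt ℂ J s := fun s hs =>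
    (hMan s hs).mul ((hΓa.analyticAt s).mul (hΓb.analyticAt s))
  have hRan : ∀ s ∈ verticalStrip (-1) 2, AnalyticAt ℂ R s := fun s hs =>
    ((hpow'.const_mul _).analyticAt s).add (hJan s hs)
  have h0mem : (0 : ℂ) ∈ verticalStrip (-1) 2 := by constructor <;> norm_num
  have h1mem : (1 : ℂ) ∈ verticalStrip (-1) 2 := by constructor <;> norm_num
  have hF₂an : AnalyticAt ℂ F₂ 0 :=
    ((((hpow 1).const_mul _).analyticAt 0).mul
      (AnalyticAt.inv (by fun_prop) (by norm_num))).add (hRan 0 h0mem)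
  obtain ⟨F, hF⟩ := exists_isZetaContinuation h zero_le_one one_lt_two hstrip
    ⟨F₂, F₂, -1, by norm_num, hF₂', EventuallyEq.rfl, hF₂an⟩
  have hF0 : F =ᶠ[𝓝 0] F₂ :=
    hF.eventuallyEq_nhds_zero hF₂' one_lt_two h0mem EventuallyEq.rfl hF₂an
  have hF1 : F =ᶠ[𝓝[≠] 1] F₂ := hF.eventuallyEq hF₂' one_lt_two h1mem
  set p : ℂ → ℂ := fun s => (x₀ : ℂ) ^ (1 - s) with hp
  have hpd : ∀ s, HasDerivAt p ((x₀ : ℂ) ^ (1 - s) * Complex.log x₀ * -1) s := by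
    intro s
    exact HasDerivAt.const_cpow ((hasDerivAt_id s).const_sub 1) (Or.inl hx₀c)
  -- Since $p(1)=1$, the quotient $p(s)/(s-1)$ is $1/(s-1)$ plus the divided difference of $p$,
  -- which is its regular part at $1$.
  refine ⟨F, fun s => c 1 * dslope p 1 s + R s, hF, ?_, ?_, ?_, ?_⟩
  · have h1 : AnalyticAt ℂ (dslope p 1) 1 := by
      have h2 : DifferentiableOn ℂ (dslope p 1) Set.univ :=
        (Complex.differentiableOn_dslope univ_mem).2 (hpow 1).differentiableOn
      exact h2.analyticAt univ_mem
    exact (analyticAt_const.mul h1).add (hRan 1 h1mem)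
  · filter_upwards [hF1, self_mem_nhdsWithin] with s hs hs1
    have hs1' : s ≠ 1 := hs1
    rw [hs, dslope_of_ne _ hs1', slope_def_field, hF₂def]
    have hs1'' : s - 1 ≠ 0 := sub_ne_zero.2 hs1'
    simp only [hp, sub_self, Complex.cpow_zero]
    field_simp
    ring
  · simp only [dslope_same, (hpd 1).deriv, hR, hJ, sub_self, Complex.cpow_zero, Complex.cpow_neg_one]
    rw [show (2 : ℂ) - 1 = 1 by norm_num, Complex.Gamma_one]
    ring
  · have hJd : HasDerivAt J (M 2) 0 := by
      set H : ℂ → ℂ := fun s => M (2 - s) * (Complex.Gamma (2 - s))⁻¹ * (Complex.Gamma (s + 1))⁻¹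
        with hH
      -- The relation $1/\Gamma(s)=s/\Gamma(s+1)$ displays the zero at $0$, and the derivative there
      -- is the cofactor.
      have hJH : J = fun s => s * H s := by
        funext s
        rw [hJ, hH]
        simp only [Complex.one_div_Gamma_eq_self_mul_one_div_Gamma_add_one s]
        ring
      have hHd : DifferentiableAt ℂ H 0 := by
        refine (((hMan 0 h0mem).differentiableAt).mul (hΓa 0)).mul ?_
        exact (Complex.differentiable_one_div_Gamma.comp (f := fun z : ℂ => z + 1)
          (by fun_prop)) 0
      have hH0 : H 0 = M 2 := by simp [hH]
      rw [hJH]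
      refine HasDerivAt.congr_deriv (HasDerivAt.fun_mul (hasDerivAt_id (0 : ℂ)) hHd.hasDerivAt) ?_
      simp [hH0]
    have hAd : HasDerivAt (fun s : ℂ => c 1 * p s * (s - 1)⁻¹)
        (c 1 * (x₀ * Complex.log x₀ - x₀)) 0 := by
      refine HasDerivAt.congr_deriv (HasDerivAt.fun_mul ((hpd 0).const_mul (c 1))
        (((hasDerivAt_id (0 : ℂ)).sub_const 1).fun_inv (by norm_num))) ?_
      simp [hp]
      ring
    have hBd : HasDerivAt (fun s : ℂ => c 2 * (x₀ : ℂ) ^ (-s)) (c 2 * -Complex.log x₀) 0 := by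
      refine HasDerivAt.congr_deriv
        ((HasDerivAt.const_cpow (hasDerivAt_neg (0 : ℂ)) (Or.inl hx₀c)).const_mul (c 2)) ?_
      simp
    rw [hF0.deriv_eq]
    have := (hAd.add (hBd.add hJd)).deriv
    have h4 : F₂ = (fun s : ℂ => c 1 * p s * (s - 1)⁻¹) +
      ((fun s : ℂ => c 2 * (x₀ : ℂ) ^ (-s)) + J) := rfl
    rw [h4, this]
    ring

end Base

/-- Along the positive reals `φ t = C₁ t (log t - 1) + b t + C₂ log t + c + o(1)`, where the
first two derivatives of `φ` have the corresponding expansions, and `φ''` has an expansion in powers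
of `1 / t` to all orders. -/
structure HasStirlingExpansion (φ : ℂ → ℂ) (C₁ b C₂ c : ℂ) : Prop where
  zeroth : Tendsto (fun t : ℝ => φ t - (C₁ * (t * (Complex.log t - 1)) + b * t +
    C₂ * Complex.log t + c)) atTop (𝓝 0)
  first : Tendsto (fun t : ℝ => (t : ℂ) * (deriv φ t - (C₁ * Complex.log t + b + C₂ / t)))
    atTop (𝓝 0)
  second : (fun t : ℝ => deriv (deriv φ) t - (C₁ * ((t : ℂ) ^ 1)⁻¹ - C₂ * ((t : ℂ) ^ 2)⁻¹)) =O[atTop]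
    fun t : ℝ => t ^ (-(((2 : ℕ) : ℝ) + 1))
  all : ∀ K : ℕ, ∃ d : ℕ → ℂ,
    (fun t : ℝ => deriv (deriv φ) t - ∑ k ∈ Finset.Icc 1 K, d k * ((t : ℂ) ^ k)⁻¹) =O[atTop]
      fun t : ℝ => t ^ (-((K : ℝ) + 1))

/-! ### Regularized products from the Stirling expansion -/

section Base

theorem isBigO_comp_const_add {f : ℝ → ℂ} {a : ℝ} (ha : 0 ≤ a)
    (h : f =O[atTop] fun t : ℝ => t ^ (-a)) :
    (fun y : ℝ => f (2 + y)) =O[atTop] fun y : ℝ => y ^ (-a) := by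
  refine (h.comp_tendsto (tendsto_atTop_add_const_left atTop 2 tendsto_id)).trans ?_
  refine IsBigO.of_bound 1 ?_
  filter_upwards [eventually_gt_atTop 0] with y hy
  simp only [Function.comp_def, id, one_mul]
  rw [Real.norm_of_nonneg (by positivity), Real.norm_of_nonneg (by positivity),
    Real.rpow_neg (by positivity), Real.rpow_neg hy.le]
  gcongr
  linarith

theorem isOpen_one_lt_re : IsOpen {x : ℂ | 1 < x.re} :=
  isOpen_lt continuous_const Complex.continuous_re

theorem deriv_eq_logDeriv_of_exp {f φ : ℂ → ℂ} {U : Set ℂ} (hU : IsOpen U)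
    (hφ : DifferentiableOn ℂ φ U) (hexp : ∀ x ∈ U, Complex.exp (φ x) = f x) {x : ℂ}
    (hx : x ∈ U) : logDeriv f x = deriv φ x := by
  have h1 : f =ᶠ[𝓝 x] fun z => Complex.exp (φ z) := by
    filter_upwards [hU.mem_nhds hx] with z hz
    exact (hexp z hz).symm
  have hd := (hφ.differentiableAt (hU.mem_nhds hx)).hasDerivAt
  rw [logDeriv_apply, h1.deriv_eq, h1.eq_of_nhds, hd.cexp.deriv]
  field_simp

open MeasureTheory Set in
-- The Mellin transforms at $1$ and $2$ of the corrected $-\varphi''(2+y)$ are $\int r$ and $\int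
-- y\,r$. Antiderivatives of $r$ are known in terms of $\varphi'$ and $\varphi$, and their behaviour
-- at infinity is the Stirling expansion; that is how $b$ and $c$ arise, while the terms with $C_1$
-- and $C_2$ cancel.
theorem GrowthAtMostOne.exists_base_continuation {f φ : ℂ → ℂ} {C₁ b C₂ c : ℂ}
    (hgr : GrowthAtMostOne f) (hf : Differentiable ℂ f) (hz : ∀ z, f z = 0 → z.re < 2)
    (hφ : DifferentiableOn ℂ φ {x : ℂ | 1 < x.re})
    (hexp : ∀ x : ℂ, 1 < x.re → Complex.exp (φ x) = f x)
    (hS : HasStirlingExpansion φ C₁ b C₂ c) :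
    ∃ (F Q : ℂ → ℂ) (κ : ℂ),
      IsZetaContinuation (fun ρ : {z // f z = 0} => analyticOrderNatAt f ρ) (fun ρ => 2 - ρ) 1 F ∧
      AnalyticAt ℂ Q 1 ∧ (F =ᶠ[𝓝[≠] 1] fun s => κ / (s - 1) + Q s) ∧
      Q 1 = deriv φ 2 - b ∧ deriv F 0 = -φ 2 + c + 2 * b := by
  have hU := isOpen_one_lt_re
  have hmemU : ∀ y : ℝ, 0 ≤ y → (2 : ℂ) + y ∈ {x : ℂ | 1 < x.re} := by
    intro y hy
    simp
    linarith
  have hne : ∀ x : ℂ, 1 < x.re → f x ≠ 0 := fun x hx => by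
    rw [← hexp x hx]
    exact Complex.exp_ne_zero _
  have hφ1 : DifferentiableOn ℂ (deriv φ) {x : ℂ | 1 < x.re} := hφ.deriv hU
  have hφ2 : DifferentiableOn ℂ (deriv (deriv φ)) {x : ℂ | 1 < x.re} := hφ1.deriv hU
  have hlog : ∀ x ∈ {x : ℂ | 1 < x.re}, logDeriv f x = deriv φ x := fun x hx =>
    deriv_eq_logDeriv_of_exp hU hφ hexp hx
  have hlog' : ∀ x ∈ {x : ℂ | 1 < x.re}, iteratedDeriv 1 (logDeriv f) x = deriv (deriv φ) x := by
    intro x hx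
    rw [iteratedDeriv_one]
    refine EventuallyEq.deriv_eq ?_
    filter_upwards [hU.mem_nhds hx] with z hz
    exact hlog z hz
  have hcb : ConvergesBeyond (fun ρ : {z // f z = 0} => analyticOrderNatAt f ρ)
      (fun ρ => (2 : ℂ) - ρ) 1 := hgr.convergesBeyond hf (hne 2 (by norm_num))
  have hcont : ContinuousOn (fun y : ℝ => -deriv (deriv φ) (2 + y)) (Ici 0) := by
    refine ContinuousOn.neg (hφ2.continuousOn.comp (by fun_prop) fun y hy => hmemU y hy)
  -- The leading terms of $-\varphi''$ are $-C_1/t+C_2/t^2$. With the shift $x_0=2$ equal to the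
  -- base point, $t=2+y$ is exactly the Stirling variable.
  set d : ℕ → ℂ := fun k => if k = 1 then -C₁ else C₂ with hd
  have hIcc : Finset.Icc 1 2 = ({1, 2} : Finset ℕ) := rfl
  have hcast : ∀ y : ℝ, (((2 : ℝ) : ℂ) + y) = ((2 + y : ℝ) : ℂ) := fun y => by push_cast; ring
  have hcast2 : ∀ y : ℝ, ((2 : ℂ) + y) = ((2 + y : ℝ) : ℂ) := fun y => by push_cast; ring
  have hO2 : (fun y : ℝ => -deriv (deriv φ) (2 + y) -
      ∑ k ∈ Finset.Icc 1 2, d k * ((((2 : ℝ) : ℂ) + y) ^ k)⁻¹) =O[atTop]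
        fun y : ℝ => y ^ (-(((2 : ℕ) : ℝ) + 1)) := by
    refine (isBigO_comp_const_add (by positivity) hS.second).neg_left.congr_left fun y => ?_
    rw [hIcc, Finset.sum_insert (by simp), Finset.sum_singleton, hcast, hcast2]
    simp only [hd, if_true, if_neg (show ¬ (2 : ℕ) = 1 by omega)]
    ring
  obtain ⟨F, Q, hF, hQ, hFQ, hQ1, hF0⟩ := hcb.exists_base (ψ := fun y : ℝ =>
      -deriv (deriv φ) (2 + y)) (fun ρ => by have := hz ρ ρ.2; simpa using this)
    (fun y hy => by
      have h1 := hgr.hasSum_pow hf (hne (2 + y) (hmemU y hy.le)) 0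
      rw [zero_add, hlog' _ (hmemU y hy.le)] at h1
      convert h1 using 1
      · funext ρ
        rw [sub_add_eq_add_sub]
      · simp)
    hcont (x₀ := 2) two_pos
    (fun K => by
      obtain ⟨e, he⟩ := hS.all K
      refine ⟨fun k => -e k, ?_⟩
      refine (isBigO_comp_const_add (by positivity) he).neg_left.congr_left fun y => ?_
      simp only [hcast, hcast2, neg_mul, Finset.sum_neg_distrib]
      ring) hO2
  refine ⟨F, Q, d 1, hF, hQ, hFQ, ?_, ?_⟩
  all_goals
    set r : ℝ → ℂ := fun y : ℝ => -deriv (deriv φ) (2 + y) -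
      ∑ k ∈ Finset.Icc 1 2, d k * ((((2 : ℝ) : ℂ) + y) ^ k)⁻¹ with hr
    have hrc : ContinuousOn r (Ici 0) :=
      hcont.sub (continuousOn_finsetSum _ fun k _ =>
        continuousOn_const.mul (continuousOn_add_pow_inv (by simp) k))
    have hr' : ∀ y : ℝ, r y = -deriv (deriv φ) (2 + y) + C₁ / (2 + y) - C₂ / (2 + y) ^ 2 := by
      intro y
      rw [hr]
      simp only
      rw [hIcc, Finset.sum_insert (by simp), Finset.sum_singleton]
      simp only [hd, if_true, if_neg (show ¬ (2 : ℕ) = 1 by omega)]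
      push_cast
      ring
    have hslit : ∀ y : ℝ, 0 ≤ y → (2 : ℂ) + y ∈ Complex.slitPlane := by
      intro y hy
      rw [Complex.mem_slitPlane_iff]
      left
      simp
      linarith
    have hlogd : ∀ y : ℝ, 0 ≤ y → HasDerivAt (fun z : ℂ => Complex.log (2 + z)) (2 + (y : ℂ))⁻¹ y :=
      fun y hy => HasDerivAt.comp_const_add (2 : ℂ) (y : ℂ) (Complex.hasDerivAt_log (hslit y hy))
    have hne0 : ∀ y : ℝ, 0 ≤ y → (2 : ℂ) + y ≠ 0 := fun y hy =>
      Complex.slitPlane_ne_zero (hslit y hy)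
    -- An antiderivative of `r`; its limit at infinity is $-b$.
    set h₁ : ℂ → ℂ := fun z => -deriv φ (2 + z) + C₁ * Complex.log (2 + z) + C₂ / (2 + z) with hh₁
    have hh₁d : ∀ y : ℝ, 0 ≤ y → HasDerivAt (fun y : ℝ => h₁ y) (r y) y := by
      intro y hy
      have e1 : HasDerivAt (fun z : ℂ => deriv φ (2 + z)) (deriv (deriv φ) (2 + y)) y :=
        HasDerivAt.comp_const_add (2 : ℂ) (y : ℂ)
          ((hφ1.differentiableAt (hU.mem_nhds (hmemU y hy))).hasDerivAt)
      have e2 : HasDerivAt (fun z : ℂ => C₂ / (2 + z)) (-C₂ / (2 + (y : ℂ)) ^ 2) y := by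
        have := ((hasDerivAt_id (y : ℂ)).const_add 2).fun_inv (hne0 y hy)
        refine HasDerivAt.congr_deriv (this.const_mul C₂) ?_
        simp only [id]
        ring
      have e3 : HasDerivAt h₁ (r y) y := by
        refine HasDerivAt.congr_deriv ((e1.neg.add ((hlogd y hy).const_mul C₁)).add e2) ?_
        rw [hr']
        ring
      exact e3.comp_ofReal
    -- The weight $t$ is needed below, where the product $y\,h_1$ occurs as a boundary term.
    have hh₁lim : Tendsto (fun y : ℝ => (((2 + y : ℝ)) : ℂ) * (h₁ y + b)) atTop (𝓝 0) := by
      have := (hS.first.comp (tendsto_atTop_add_const_left atTop 2 tendsto_id)).neg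
      rw [neg_zero] at this
      refine this.congr fun y => ?_
      simp only [Function.comp_def, id, hh₁, hcast2]
      ring
    have hinv : Tendsto (fun y : ℝ => (((2 + y : ℝ)) : ℂ)⁻¹) atTop (𝓝 0) := by
      have h1 : Tendsto (fun y : ℝ => ((2 + y)⁻¹ : ℝ)) atTop (𝓝 0) :=
        tendsto_inv_atTop_zero.comp (tendsto_atTop_add_const_left atTop 2 tendsto_id)
      have h2 := (Complex.continuous_ofReal.tendsto (0 : ℝ)).comp h1
      simpa [Function.comp_def] using h2
    have hh₁lim' : Tendsto (fun y : ℝ => h₁ y + b) atTop (𝓝 0) := by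
      have h1 := hinv.mul hh₁lim
      rw [mul_zero] at h1
      refine h1.congr' ?_
      filter_upwards [eventually_ge_atTop 0] with y hy
      rw [inv_mul_cancel_left₀]
      exact_mod_cast (by linarith : (2 + y : ℝ) ≠ 0)
  · have hconv := (mellin_of_continuousOn hrc hO2 (u := 1) (by simp) (by norm_num)).1
    have hint : IntegrableOn r (Ioi 0) := by
      simpa [MellinConvergent] using hconv
    have hval := integral_Ioi_of_hasDerivAt_of_tendsto
      (hh₁d 0 le_rfl).continuousAt.continuousWithinAt (fun y hy => hh₁d y (le_of_lt hy)) hint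
      (m := -b) (by simpa using hh₁lim'.sub_const b)
    have hm : mellin r 1 = ∫ y in Ioi (0 : ℝ), r y := by simp [mellin]
    rw [hQ1, hm, hval]
    simp only [hh₁, hd, if_true, if_neg (show ¬ (2 : ℕ) = 1 by omega)]
    push_cast
    simp only [add_zero]
    ring
  · have hconv := (mellin_of_continuousOn hrc hO2 (u := 2) (by simp) (by norm_num)).1
    have h21 : (2 : ℂ) - 1 = 1 := by norm_num
    have hint : IntegrableOn (fun y : ℝ => (y : ℂ) * r y) (Ioi 0) := by
      simpa [MellinConvergent, h21] using hconv
    -- An antiderivative of `h₁`, so that $y\,h_1-h_0$ is one of $y\,r$. As $h_1=-b+o(1/y)$ and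
    -- $h_0=-b(2+y)-c+o(1)$, the boundary term at infinity is $2b+c$.
    set h₀ : ℂ → ℂ := fun z => -φ (2 + z) + C₁ * ((2 + z) * Complex.log (2 + z) - (2 + z)) +
      C₂ * Complex.log (2 + z) with hh₀
    have hh₀d : ∀ y : ℝ, 0 ≤ y → HasDerivAt (fun y : ℝ => h₀ y) (h₁ y) y := by
      intro y hy
      have e1 : HasDerivAt (fun z : ℂ => φ (2 + z)) (deriv φ (2 + y)) y :=
        HasDerivAt.comp_const_add (2 : ℂ) (y : ℂ)
          ((hφ.differentiableAt (hU.mem_nhds (hmemU y hy))).hasDerivAt)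
      have e2 := (hasDerivAt_id (y : ℂ)).const_add 2
      have e3 : HasDerivAt h₀ (h₁ y) y := by
        refine HasDerivAt.congr_deriv ((e1.neg.add (((e2.mul (hlogd y hy)).sub e2).const_mul C₁)).add
          ((hlogd y hy).const_mul C₂)) ?_
        have := hne0 y hy
        simp only [hh₁, id]
        field_simp
        ring
      exact e3.comp_ofReal
    have hh₀lim : Tendsto (fun y : ℝ => h₀ y + b * (2 + y) + c) atTop (𝓝 0) := by
      have := (hS.zeroth.comp (tendsto_atTop_add_const_left atTop 2 tendsto_id)).neg
      rw [neg_zero] at this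
      refine this.congr fun y => ?_
      simp only [Function.comp_def, id, hh₀, hcast2]
      ring
    have hder : ∀ y : ℝ, 0 ≤ y →
        HasDerivAt (fun y : ℝ => (y : ℂ) * h₁ y - h₀ y) ((y : ℂ) * r y) y := by
      intro y hy
      refine HasDerivAt.congr_deriv (((hasDerivAt_id (y : ℂ)).comp_ofReal.mul (hh₁d y hy)).sub
        (hh₀d y hy)) ?_
      simp
    have hval := integral_Ioi_of_hasDerivAt_of_tendsto
      (hder 0 le_rfl).continuousAt.continuousWithinAt (fun y hy => hder y (le_of_lt hy)) hint
      (m := 2 * b + c) (by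
        have h1 := ((hh₁lim.sub (hh₁lim'.const_mul 2)).sub hh₀lim).add_const (2 * b + c)
        simp only [mul_zero, sub_zero, zero_add] at h1
        refine h1.congr fun y => ?_
        push_cast
        ring)
    have hm : mellin r 2 = ∫ y in Ioi (0 : ℝ), (y : ℂ) * r y := by simp [mellin, h21]
    rw [hF0, hm, hval]
    simp only [hh₀, hd, if_true, if_neg (show ¬ (2 : ℕ) = 1 by omega)]
    push_cast
    simp only [add_zero]
    ring

theorem GrowthAtMostOne.exists_continuation {f φ : ℂ → ℂ} {C₁ b C₂ c : ℂ}
    (hgr : GrowthAtMostOne f) (hf : Differentiable ℂ f) (hz : ∀ z, f z = 0 → z.re < 2)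
    (hφ : DifferentiableOn ℂ φ {x : ℂ | 1 < x.re})
    (hexp : ∀ x : ℂ, 1 < x.re → Complex.exp (φ x) = f x)
    (hS : HasStirlingExpansion φ C₁ b C₂ c) {x : ℂ} (hx : f x ≠ 0) :
    ∃ F : ℂ → ℂ,
      IsZetaContinuation (fun ρ : {z // f z = 0} => analyticOrderNatAt f ρ) (fun ρ => x - ρ) 1 F ∧
      HasSum (fun ρ : {z // f z = 0} => (analyticOrderNatAt f ρ : ℂ) *
        (Complex.log (2 - ρ) - Complex.log (x - ρ) + (x - 2) / (2 - ρ)))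
        (deriv F 0 + φ 2 - c - b * x + (x - 2) * deriv φ 2) := by
  obtain ⟨F, Q, κ, hF, hQ, hFQ, hQ1, hF0⟩ := hgr.exists_base_continuation hf hz hφ hexp hS
  have h2 : f 2 ≠ 0 := by
    rw [← hexp 2 (by norm_num)]
    exact Complex.exp_ne_zero _
  have hw : ∀ ρ : {z // f z = 0}, (2 : ℂ) - ρ + (x - 2) = x - ρ := fun ρ => by ring
  obtain ⟨F', hF', hsum⟩ := hF.exists_shift_of_one (b := x - 2) (hgr.convergesBeyond hf h2)
    (Eventually.of_forall fun ρ => by have := hz ρ ρ.2; simpa using this)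
    (fun ρ => by rw [hw]; exact sub_zero_ne_zero hx ρ) hQ hFQ
  simp only [hw] at hF' hsum
  refine ⟨F', hF', ?_⟩
  convert hsum using 1
  rw [hF0, hQ1]
  ring

/-- Exponentiating the logarithmic sum produced by the translation gives, term by term, the Hadamard
product centred at $2$. The quantities $\varphi(2)$ and $\varphi'(2)$ occur on both sides and
cancel, so only the Stirling constants remain. -/
theorem GrowthAtMostOne.exp_neg_deriv_zero {f φ : ℂ → ℂ} {C₁ b C₂ c : ℂ}
    (hgr : GrowthAtMostOne f) (hf : Differentiable ℂ f) (hz : ∀ z, f z = 0 → z.re < 2)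
    (hφ : DifferentiableOn ℂ φ {x : ℂ | 1 < x.re})
    (hexp : ∀ x : ℂ, 1 < x.re → Complex.exp (φ x) = f x)
    (hS : HasStirlingExpansion φ C₁ b C₂ c) {x : ℂ} (hx : f x ≠ 0) :
    Complex.exp (-zetaDerivZero (fun ρ : {z // f z = 0} => analyticOrderNatAt f ρ)
      (fun ρ => x - ρ) 1) = f x * Complex.exp (-c - b * x) := by
  obtain ⟨F, hF, hsum⟩ := hgr.exists_continuation hf hz hφ hexp hS hx
  have h2 : f 2 ≠ 0 := by
    rw [← hexp 2 (by norm_num)]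
    exact Complex.exp_ne_zero _
  have hld : logDeriv f 2 = deriv φ 2 :=
    deriv_eq_logDeriv_of_exp isOpen_one_lt_re hφ hexp (by simp)
  have hprod := hgr.hasProd hf h2 hx
  have hprod' := hsum.neg.cexp
  have heq : (Complex.exp ∘ fun ρ : {z // f z = 0} => -((analyticOrderNatAt f ρ : ℂ) *
        (Complex.log (2 - ρ) - Complex.log (x - ρ) + (x - 2) / (2 - ρ)))) = fun ρ : {z // f z = 0} =>
      ((x - ρ) / (2 - ρ) * Complex.exp (-((x - 2) / (2 - ρ)))) ^ analyticOrderNatAt f ρ := by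
    funext ρ
    have e1 := sub_zero_ne_zero hx ρ
    have e2 := sub_zero_ne_zero h2 ρ
    rw [Function.comp_apply, ← mul_neg, Complex.exp_nat_mul]
    congr 1
    rw [show -(Complex.log (2 - ρ) - Complex.log (x - ρ) + (x - 2) / (2 - ρ)) =
      Complex.log (x - ρ) - Complex.log (2 - ρ) + -((x - 2) / (2 - ρ)) by ring, Complex.exp_add,
      Complex.exp_sub, Complex.exp_log e1, Complex.exp_log e2]
  rw [heq] at hprod'
  have hu := hprod'.unique hprod
  rw [hF.zetaDerivZero_eq]
  rw [hld, ← hexp 2 (by norm_num), div_eq_mul_inv, ← Complex.exp_neg] at hu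
  have h3 : -deriv F 0 = -(deriv F 0 + φ 2 - c - b * x + (x - 2) * deriv φ 2) +
    (φ 2 + (x - 2) * deriv φ 2) + (-c - b * x) := by ring
  rw [h3, Complex.exp_add, Complex.exp_add, hu, Complex.exp_add]
  have h4 : Complex.exp (-φ 2) * Complex.exp (φ 2) = 1 := by
    rw [← Complex.exp_add, neg_add_cancel, Complex.exp_zero]
  have h5 : Complex.exp (-((x - 2) * deriv φ 2)) * Complex.exp ((x - 2) * deriv φ 2) = 1 := by
    rw [← Complex.exp_add, neg_add_cancel, Complex.exp_zero]
  linear_combination (f x * Complex.exp (-c - b * x)) * (h4 *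
    Complex.exp (-((x - 2) * deriv φ 2)) * Complex.exp ((x - 2) * deriv φ 2) + h5)

end Base

/-! ### Operations on Stirling expansions -/

section Stirling

variable {φ φ₁ φ₂ : ℂ → ℂ} {C₁ b C₂ c C₁' b' C₂' c' : ℂ}

theorem eventually_ofReal_mem {a : ℝ} :
    ∀ᶠ t : ℝ in atTop, ((t : ℂ) ∈ {x : ℂ | a < x.re}) := by
  filter_upwards [eventually_gt_atTop a] with t ht
  simpa using ht

theorem HasStirlingExpansion.add (h₁ : HasStirlingExpansion φ₁ C₁ b C₂ c)
    (h₂ : HasStirlingExpansion φ₂ C₁' b' C₂' c') (hd₁ : DifferentiableOn ℂ φ₁ {x : ℂ | 1 < x.re})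
    (hd₂ : DifferentiableOn ℂ φ₂ {x : ℂ | 1 < x.re}) :
    HasStirlingExpansion (fun x => φ₁ x + φ₂ x) (C₁ + C₁') (b + b') (C₂ + C₂') (c + c') := by
  have hU := isOpen_one_lt_re
  have e1 : ∀ x ∈ {x : ℂ | 1 < x.re}, deriv (fun x => φ₁ x + φ₂ x) x = deriv φ₁ x + deriv φ₂ x :=
    fun x hx => deriv_fun_add (hd₁.differentiableAt (hU.mem_nhds hx))
      (hd₂.differentiableAt (hU.mem_nhds hx))
  have e2 : ∀ x ∈ {x : ℂ | 1 < x.re}, deriv (deriv fun x => φ₁ x + φ₂ x) x =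
      deriv (deriv φ₁) x + deriv (deriv φ₂) x := by
    intro x hx
    rw [← deriv_fun_add ((hd₁.deriv hU).differentiableAt (hU.mem_nhds hx))
      ((hd₂.deriv hU).differentiableAt (hU.mem_nhds hx))]
    refine EventuallyEq.deriv_eq ?_
    filter_upwards [hU.mem_nhds hx] with z hz
    exact e1 z hz
  refine ⟨?_, ?_, ?_, fun K => ?_⟩
  · have := h₁.zeroth.add h₂.zeroth
    rw [add_zero] at this
    exact this.congr fun t => by ring
  · have := h₁.first.add h₂.first
    rw [add_zero] at this
    refine this.congr' ?_
    filter_upwards [eventually_ofReal_mem (a := 1)] with t ht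
    rw [e1 _ ht]
    ring
  · refine (h₁.second.add h₂.second).congr' ?_ EventuallyEq.rfl
    filter_upwards [eventually_ofReal_mem (a := 1)] with t ht
    rw [e2 _ ht]
    ring
  · obtain ⟨d₁, hd₁⟩ := h₁.all K
    obtain ⟨d₂, hd₂⟩ := h₂.all K
    refine ⟨fun k => d₁ k + d₂ k, (hd₁.add hd₂).congr' ?_ EventuallyEq.rfl⟩
    filter_upwards [eventually_ofReal_mem (a := 1)] with t ht
    rw [e2 _ ht]
    simp only [add_mul, Finset.sum_add_distrib]
    ring

theorem HasStirlingExpansion.const_mul (h : HasStirlingExpansion φ C₁ b C₂ c) (a : ℂ) :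
    HasStirlingExpansion (fun x => a * φ x) (a * C₁) (a * b) (a * C₂) (a * c) := by
  have e1 : (deriv fun x => a * φ x) = fun x => a * deriv φ x := by
    funext x
    rw [deriv_const_mul_field]
  have e2 : (deriv (deriv fun x => a * φ x)) = fun x => a * deriv (deriv φ) x := by
    rw [e1]
    funext x
    rw [deriv_const_mul_field]
  refine ⟨?_, ?_, ?_, fun K => ?_⟩
  · have := h.zeroth.const_mul a
    rw [mul_zero] at this
    exact this.congr fun t => by ring
  · have := h.first.const_mul a
    rw [mul_zero] at this
    exact this.congr fun t => by rw [e1]; ring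
  · exact (h.second.const_mul_left a).congr_left fun t => by rw [e2]; ring
  · obtain ⟨d, hd⟩ := h.all K
    refine ⟨fun k => a * d k, (hd.const_mul_left a).congr_left fun t => ?_⟩
    rw [e2]
    simp only [mul_sub, Finset.mul_sum, mul_assoc]

/-- Two differentiations of an expansion to order $N$ give one with $N+2$ terms; smaller numbers of
terms are reached by dropping the last one. -/
theorem exists_expansion_of_succ {g : ℝ → ℂ} {K : ℕ} {d : ℕ → ℂ}
    (h : (fun t : ℝ => g t - ∑ k ∈ Finset.Icc 1 (K + 1), d k * ((t : ℂ) ^ k)⁻¹) =O[atTop]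
      fun t : ℝ => t ^ (-(((K + 1 : ℕ) : ℝ) + 1))) :
    (fun t : ℝ => g t - ∑ k ∈ Finset.Icc 1 K, d k * ((t : ℂ) ^ k)⁻¹) =O[atTop]
      fun t : ℝ => t ^ (-((K : ℝ) + 1)) := by
  have h1 : (fun t : ℝ => d (K + 1) * ((t : ℂ) ^ (K + 1))⁻¹) =O[atTop]
      fun t : ℝ => t ^ (-((K : ℝ) + 1)) := by
    refine IsBigO.of_bound ‖d (K + 1)‖ ?_
    filter_upwards [eventually_gt_atTop 0] with t ht
    rw [norm_mul, norm_inv, norm_pow, Complex.norm_real, Real.norm_of_nonneg ht.le,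
      Real.norm_of_nonneg (by positivity), Real.rpow_neg ht.le]
    norm_cast
  have h2 : (fun t : ℝ => t ^ (-(((K + 1 : ℕ) : ℝ) + 1))) =O[atTop]
      fun t : ℝ => t ^ (-((K : ℝ) + 1)) := by
    refine IsBigO.of_bound 1 ?_
    filter_upwards [eventually_ge_atTop 1] with t ht
    have ht0 : 0 < t := by linarith
    rw [Real.norm_of_nonneg (by positivity), Real.norm_of_nonneg (by positivity), one_mul]
    refine Real.rpow_le_rpow_of_exponent_le ht ?_
    push_cast
    linarith
  refine ((h.trans h2).add h1).congr_left fun t => ?_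
  rw [Finset.sum_Icc_succ_top (by omega)]
  ring

theorem isBigO_zpow_iff_rpow {g : ℝ → ℂ} {k : ℤ} {a : ℝ} (ha : (k : ℝ) = a)
    (h : g =O[atTop] fun t : ℝ => t ^ k) : g =O[atTop] fun t : ℝ => t ^ a :=
  h.congr_right fun t => by rw [← ha, Real.rpow_intCast]

theorem tendsto_zero_of_isBigO_rpow {g : ℝ → ℂ} {a : ℝ} (ha : 0 < a)
    (h : g =O[atTop] fun t : ℝ => t ^ (-a)) : Tendsto g atTop (𝓝 0) :=
  h.trans_tendsto (tendsto_rpow_neg_atTop ha)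

theorem tendsto_mul_zero_of_isBigO_rpow {g : ℝ → ℂ}
    (h : g =O[atTop] fun t : ℝ => t ^ (-2 : ℝ)) :
    Tendsto (fun t : ℝ => (t : ℂ) * g t) atTop (𝓝 0) := by
  refine tendsto_zero_of_isBigO_rpow one_pos ?_
  have h1 : (fun t : ℝ => (t : ℂ)) =O[atTop] fun t : ℝ => t := by
    refine IsBigO.of_bound 1 (Eventually.of_forall fun t => ?_)
    simp
  refine (h1.mul h).congr' EventuallyEq.rfl ?_
  filter_upwards [eventually_gt_atTop 0] with t ht
  nth_rw 1 [← Real.rpow_one t]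
  rw [← Real.rpow_add ht]
  norm_num

theorem hasStirlingExpansion_of_decay
    (h : ∀ n N : ℕ, (fun t : ℝ => iteratedDeriv n φ (t : ℂ)) =O[atTop]
      fun t : ℝ => t ^ (-(N : ℤ))) : HasStirlingExpansion φ 0 0 0 0 := by
  have h2 : ∀ K : ℕ, (fun t : ℝ => deriv (deriv φ) (t : ℂ)) =O[atTop]
      fun t : ℝ => t ^ (-((K : ℝ) + 1)) := by
    intro K
    have := isBigO_zpow_iff_rpow (a := -((K : ℝ) + 1)) (by push_cast; ring) (h 2 (K + 1))
    simpa [iteratedDeriv_succ, iteratedDeriv_zero] using this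
  refine ⟨?_, ?_, ?_, fun K => ⟨0, ?_⟩⟩
  · have := tendsto_zero_of_isBigO_rpow one_pos (isBigO_zpow_iff_rpow (by simp) (h 0 1))
    simpa using this
  · have := tendsto_mul_zero_of_isBigO_rpow (isBigO_zpow_iff_rpow (by simp) (h 1 2))
    simpa using this
  · simpa using h2 2
  · simpa using h2 K

/-- The remainder of $-1/(t-1)^2=-\sum_k(k-1)t^{-k}$ has a closed form, from which its order is read
off directly. -/
theorem inv_sub_one_sq_eq {t : ℂ} (ht : t ≠ 0) (ht1 : t - 1 ≠ 0) (K : ℕ) :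
    -((t - 1) ^ 2)⁻¹ - ∑ k ∈ Finset.Icc 1 K, -((k : ℂ) - 1) * (t ^ k)⁻¹ =
      -((t ^ K)⁻¹ * (K * t - (K - 1)) * ((t - 1) ^ 2)⁻¹) := by
  induction K with
  | zero => simp
  | succ K ih =>
    rw [Finset.sum_Icc_succ_top (by omega), ← sub_sub, ih]
    push_cast
    field_simp
    ring

theorem hasStirlingExpansion_log_sub_one :
    HasStirlingExpansion (fun x => Complex.log (x - 1)) 0 0 1 0 := by
  have hd : ∀ x ∈ {x : ℂ | 1 < x.re}, HasDerivAt (fun x => Complex.log (x - 1)) (x - 1)⁻¹ x := by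
    intro x hx
    have hs : x - 1 ∈ Complex.slitPlane := by
      rw [Complex.mem_slitPlane_iff]
      left
      simpa using hx
    exact (Complex.hasDerivAt_log hs).comp_sub_const x 1
  have hd2 : ∀ x ∈ {x : ℂ | 1 < x.re},
      deriv (deriv (fun x => Complex.log (x - 1))) x = -((x - 1) ^ 2)⁻¹ := by
    intro x hx
    have h1 : deriv (fun x => Complex.log (x - 1)) =ᶠ[𝓝 x] fun x => (x - 1)⁻¹ := by
      filter_upwards [isOpen_one_lt_re.mem_nhds hx] with z hz
      exact (hd z hz).deriv
    rw [h1.deriv_eq]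
    have hx1 : x - 1 ≠ 0 := by
      intro h
      rw [sub_eq_zero] at h
      rw [h] at hx
      simp at hx
    have h2 : HasDerivAt (fun x : ℂ => (x - 1)⁻¹) (-1 / (x - 1) ^ 2) x :=
      ((hasDerivAt_id x).sub_const 1).fun_inv hx1
    rw [h2.deriv, neg_div, one_div]
  have hall : ∀ K : ℕ, (fun t : ℝ => deriv (deriv (fun x => Complex.log (x - 1))) (t : ℂ) -
      ∑ k ∈ Finset.Icc 1 K, -((k : ℂ) - 1) * ((t : ℂ) ^ k)⁻¹) =O[atTop]
      fun t : ℝ => t ^ (-((K : ℝ) + 1)) := by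
    intro K
    refine IsBigO.of_bound (4 * (2 * K + 1)) ?_
    filter_upwards [eventually_ge_atTop 2] with t ht
    have ht0 : 0 < t := by linarith
    have ht1 : (t : ℂ) - 1 ≠ 0 := by
      norm_cast
      linarith
    rw [hd2 t (by simp; linarith), inv_sub_one_sq_eq (by exact_mod_cast ht0.ne') ht1, norm_neg,
      norm_mul, norm_mul, norm_inv, norm_inv, norm_pow, norm_pow, Complex.norm_real,
      Real.norm_of_nonneg ht0.le, Real.norm_of_nonneg (by positivity), Real.rpow_neg ht0.le]
    have e1 : ‖(t : ℂ) - 1‖ = t - 1 := by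
      rw [← Complex.ofReal_one, ← Complex.ofReal_sub, Complex.norm_real,
        Real.norm_of_nonneg (by linarith)]
    have e2 : ‖(K : ℂ) * t - (K - 1)‖ ≤ (2 * K + 1) * t := by
      calc ‖(K : ℂ) * t - (K - 1)‖ ≤ ‖(K : ℂ) * t‖ + (‖(K : ℂ)‖ + ‖(1 : ℂ)‖) :=
            (norm_sub_le _ _).trans (add_le_add le_rfl (norm_sub_le _ _))
        _ = K * t + (K + 1) := by
            rw [norm_mul, Complex.norm_natCast, Complex.norm_real, Real.norm_of_nonneg ht0.le]
            simp
        _ ≤ _ := by nlinarith [Nat.cast_nonneg (α := ℝ) K]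
    have e3 : ((t - 1) ^ 2)⁻¹ ≤ 4 * (t ^ 2)⁻¹ := by
      rw [← div_eq_mul_inv, inv_le_comm₀ (by nlinarith) (by positivity), inv_div,
        div_le_iff₀ (by norm_num)]
      nlinarith
    have e4 : t ^ ((K : ℝ) + 1) = t ^ K * t := by norm_cast
    rw [e1, e4]
    calc (t ^ K)⁻¹ * ‖(K : ℂ) * t - (K - 1)‖ * ((t - 1) ^ 2)⁻¹
        ≤ (t ^ K)⁻¹ * ((2 * K + 1) * t) * (4 * (t ^ 2)⁻¹) := by gcongr
      _ = _ := by
        field_simp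
  refine ⟨?_, ?_, ?_, fun K => ⟨_, hall K⟩⟩
  · have h1 : Tendsto (fun t : ℝ => Real.log (1 - t⁻¹)) atTop (𝓝 0) := by
      have h2 : Tendsto (fun t : ℝ => 1 - t⁻¹) atTop (𝓝 1) := by
        simpa using tendsto_inv_atTop_zero.const_sub (1 : ℝ)
      simpa [Function.comp_def] using (Real.continuousAt_log one_ne_zero).tendsto.comp h2
    have h3 := (Complex.continuous_ofReal.tendsto (0 : ℝ)).comp h1
    rw [Complex.ofReal_zero] at h3
    refine h3.congr' ?_
    filter_upwards [eventually_gt_atTop 1] with t ht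
    have ht0 : 0 < t := by linarith
    rw [Function.comp_apply, show 1 - t⁻¹ = (t - 1) / t by field_simp,
      Real.log_div (by linarith) ht0.ne', ← Complex.ofReal_one, ← Complex.ofReal_sub,
      ← Complex.ofReal_log (by linarith), ← Complex.ofReal_log ht0.le]
    simp
  · refine tendsto_mul_zero_of_isBigO_rpow (IsBigO.of_bound 2 ?_)
    filter_upwards [eventually_ge_atTop 2] with t ht
    have ht0 : 0 < t := by linarith
    have ht1 : 0 < t - 1 := by linarith
    have e1 : (t : ℂ) - 1 = ((t - 1 : ℝ) : ℂ) := by push_cast; ring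
    rw [(hd t (by simp; linarith)).deriv, e1]
    have e2 : ((t - 1 : ℝ) : ℂ)⁻¹ - (0 * Complex.log t + 0 + 1 / t) = (((t - 1)⁻¹ - t⁻¹ : ℝ) : ℂ) := by
      push_cast
      ring
    have e3 : (t - 1)⁻¹ - t⁻¹ = ((t - 1) * t)⁻¹ := by
      field_simp
      ring
    rw [e2, e3, Complex.norm_real, Real.norm_of_nonneg (by positivity),
      Real.norm_of_nonneg (by positivity), Real.rpow_neg ht0.le, Real.rpow_two,
      ← div_eq_mul_inv, inv_le_comm₀ (by positivity) (by positivity), inv_div,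
      div_le_iff₀ (by norm_num)]
    nlinarith
  · refine (hall 2).congr_left fun t => ?_
    rw [show Finset.Icc 1 2 = ({1, 2} : Finset ℕ) from rfl, Finset.sum_insert (by simp),
      Finset.sum_singleton]
    push_cast
    ring

end Stirling

/-! ### The expansions of log G and log Ξ, and the products over ρ and over the trivial zeros -/

namespace PrimaryFunction

variable (P : PrimaryFunction)

theorem differentiableOn_logG' : DifferentiableOn ℂ P.logG {x : ℂ | 1 < x.re} :=
  P.differentiableOn_logG.mono fun x (hx : 1 < x.re) => (lt_trans one_pos hx : 0 < x.re)

theorem hasStirlingExpansion_logG :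
    HasStirlingExpansion P.logG (-P.ta₁) (-P.b₁) (-P.ta₀) (-P.b₀) := by
  set A : ℕ → ℂ → ℂ := fun N x => P.ta₁ * (x * (Complex.log x - 1)) + P.b₁ * x +
    P.ta₀ * Complex.log x + P.b₀ + ∑ j ∈ Finset.Icc 1 N, P.a j * x ^ (-(j : ℤ)) with hA
  set A₁ : ℕ → ℂ → ℂ := fun N x => P.ta₁ * Complex.log x + P.b₁ +
    P.ta₀ * x⁻¹ + ∑ j ∈ Finset.Icc 1 N, P.a j * (((-(j : ℤ) : ℤ) : ℂ) * x ^ (-(j : ℤ) - 1)) with hA₁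
  set A₂ : ℕ → ℂ → ℂ := fun N x => P.ta₁ * x⁻¹ - P.ta₀ * (x ^ 2)⁻¹ +
    ∑ j ∈ Finset.Icc 1 N, P.a j * (((-(j : ℤ) : ℤ) : ℂ) *
      (((-(j : ℤ) - 1 : ℤ) : ℂ) * x ^ (-(j : ℤ) - 1 - 1))) with hA₂
  have hU := isOpen_one_lt_re
  have hslit : ∀ x ∈ {x : ℂ | 1 < x.re}, x ∈ Complex.slitPlane := fun x hx => by
    rw [Complex.mem_slitPlane_iff]
    left
    exact lt_trans one_pos hx
  have hAd : ∀ N, ∀ x ∈ {x : ℂ | 1 < x.re}, HasDerivAt (A N) (A₁ N x) x := by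
    intro N x hx
    have hl := Complex.hasDerivAt_log (hslit x hx)
    have hx0 := Complex.slitPlane_ne_zero (hslit x hx)
    have hs : HasDerivAt (fun x : ℂ => ∑ j ∈ Finset.Icc 1 N, P.a j * x ^ (-(j : ℤ)))
        (∑ j ∈ Finset.Icc 1 N, P.a j * (((-(j : ℤ) : ℤ) : ℂ) * x ^ (-(j : ℤ) - 1))) x :=
      HasDerivAt.fun_sum fun j _ => (hasDerivAt_zpow _ x (Or.inl hx0)).const_mul _
    refine HasDerivAt.congr_deriv ((((((hasDerivAt_id x).mul (hl.sub_const 1)).const_mul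
      P.ta₁).add ((hasDerivAt_id x).const_mul P.b₁)).add (hl.const_mul P.ta₀)).add_const
        P.b₀ |>.add hs) ?_
    simp only [hA₁, id]
    field_simp
    ring
  have hA₁d : ∀ N, ∀ x ∈ {x : ℂ | 1 < x.re}, HasDerivAt (A₁ N) (A₂ N x) x := by
    intro N x hx
    have hl := Complex.hasDerivAt_log (hslit x hx)
    have hx0 := Complex.slitPlane_ne_zero (hslit x hx)
    have hs : HasDerivAt (fun x : ℂ => ∑ j ∈ Finset.Icc 1 N,
        P.a j * (((-(j : ℤ) : ℤ) : ℂ) * x ^ (-(j : ℤ) - 1)))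
        (∑ j ∈ Finset.Icc 1 N, P.a j * (((-(j : ℤ) : ℤ) : ℂ) *
          (((-(j : ℤ) - 1 : ℤ) : ℂ) * x ^ (-(j : ℤ) - 1 - 1)))) x :=
      HasDerivAt.fun_sum fun j _ => ((hasDerivAt_zpow _ x (Or.inl hx0)).const_mul _).const_mul _
    refine HasDerivAt.congr_deriv ((((hl.const_mul P.ta₁).add_const P.b₁).add
      ((hasDerivAt_inv hx0).const_mul P.ta₀)).add hs) ?_
    simp only [hA₂]
    ring
  have hGd := P.differentiableOn_logG'
  have hG1 : ∀ N, ∀ x ∈ {x : ℂ | 1 < x.re},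
      deriv (fun x => P.logG x + A N x) x = deriv P.logG x + A₁ N x := fun N x hx =>
    ((hGd.differentiableAt (hU.mem_nhds hx)).hasDerivAt.add (hAd N x hx)).deriv
  have hG2 : ∀ N, ∀ x ∈ {x : ℂ | 1 < x.re},
      deriv (deriv (fun x => P.logG x + A N x)) x = deriv (deriv P.logG) x + A₂ N x := by
    intro N x hx
    have h1 : deriv (fun x => P.logG x + A N x) =ᶠ[𝓝 x] fun x => deriv P.logG x + A₁ N x := by
      filter_upwards [hU.mem_nhds hx] with z hz
      exact hG1 N z hz
    rw [h1.deriv_eq]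
    exact (((hGd.deriv hU).differentiableAt (hU.mem_nhds hx)).hasDerivAt.add (hA₁d N x hx)).deriv
  have hst : ∀ n N : ℕ, (fun t : ℝ => iteratedDeriv n (fun x : ℂ => P.logG x + A N x) (t : ℂ))
      =O[atTop] fun t : ℝ => t ^ (-((N : ℝ) + 1 + n)) := fun n N =>
    isBigO_zpow_iff_rpow (by push_cast; ring) (P.stirling n N)
  -- Twice differentiated, $a_jx^{-j}$ becomes $j(j+1)a_jx^{-j-2}$, whence the shift by two; the
  -- sign is reversed because the expansion is that of $-\log\mathbf G$.
  set d : ℕ → ℂ := fun k => if k = 1 then -P.ta₁ else if k = 2 then P.ta₀ else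
    -(P.a (k - 2) * (((k - 2 : ℕ) : ℂ) * (((k - 2 : ℕ) : ℂ) + 1))) with hd
  have hall : ∀ N : ℕ, (fun t : ℝ => deriv (deriv P.logG) t -
      ∑ k ∈ Finset.Icc 1 (N + 2), d k * ((t : ℂ) ^ k)⁻¹) =O[atTop]
        fun t : ℝ => t ^ (-(((N + 2 : ℕ) : ℝ) + 1)) := by
    intro N
    have h1 := hst 2 N
    simp only [iteratedDeriv_succ, iteratedDeriv_zero] at h1
    refine (h1.congr_right fun t => by push_cast; ring_nf).congr' ?_ EventuallyEq.rfl
    filter_upwards [eventually_ofReal_mem (a := 1)] with t ht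
    have ht0 := Complex.slitPlane_ne_zero (hslit t ht)
    rw [hG2 N t ht, sub_eq_add_neg]
    congr 1
    clear h1
    induction N with
    | zero =>
      simp only [hA₂, hd]
      rw [show Finset.Icc 1 (0 + 2) = ({1, 2} : Finset ℕ) from rfl, Finset.sum_insert (by simp),
        Finset.sum_singleton]
      simp
      ring
    | succ N ih =>
      have e1 : A₂ (N + 1) t = A₂ N t + P.a (N + 1) * (((-((N + 1 : ℕ) : ℤ) : ℤ) : ℂ) *
          (((-((N + 1 : ℕ) : ℤ) - 1 : ℤ) : ℂ) * (t : ℂ) ^ (-((N + 1 : ℕ) : ℤ) - 1 - 1))) := by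
        simp only [hA₂]
        rw [Finset.sum_Icc_succ_top (by omega)]
        ring
      rw [e1, ih, show N + 1 + 2 = N + 2 + 1 by ring,
        Finset.sum_Icc_succ_top (a := 1) (b := N + 2) (by omega)]
      have e2 : -((N + 1 : ℕ) : ℤ) - 1 - 1 = -((N + 2 + 1 : ℕ) : ℤ) := by push_cast; ring
      have e3 : d (N + 2 + 1) = -(P.a (N + 1) * (((N + 1 : ℕ) : ℂ) * (((N + 1 : ℕ) : ℂ) + 1))) := by
        simp only [hd]
        rw [if_neg (by omega), if_neg (by omega), show N + 2 + 1 - 2 = N + 1 by omega]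
      rw [e2, e3, zpow_neg, zpow_natCast]
      push_cast
      ring
  refine ⟨?_, ?_, ?_, fun K => ⟨d, exists_expansion_of_succ (exists_expansion_of_succ (hall K))⟩⟩
  · have h1 := hst 0 0
    refine (tendsto_zero_of_isBigO_rpow (a := 1) one_pos
      (h1.congr_right fun t => by norm_num)).congr fun t => ?_
    simp [hA]
    ring
  · have h1 := hst 1 0
    refine (tendsto_mul_zero_of_isBigO_rpow (h1.congr_right fun t => by norm_num)).congr' ?_
    filter_upwards [eventually_ofReal_mem (a := 1)] with t ht
    rw [iteratedDeriv_one, hG1 0 t ht]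
    simp [hA₁]
    ring_nf
    simp
  · refine (hall 0).congr_left fun t => ?_
    rw [show Finset.Icc 1 (0 + 2) = ({1, 2} : Finset ℕ) from rfl, Finset.sum_insert (by simp),
        Finset.sum_singleton]
    simp [hd]

theorem differentiableOn_logXi : DifferentiableOn ℂ P.logXi {x : ℂ | 1 < x.re} := by
  intro x hx
  have hs : x - 1 ∈ Complex.slitPlane := by
    rw [Complex.mem_slitPlane_iff]
    left
    simpa using hx
  have h1 : DifferentiableAt ℂ (fun x => Complex.log (x - 1)) x :=
    ((Complex.hasDerivAt_log hs).comp_sub_const x 1).differentiableAt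
  exact (((h1.const_mul _).differentiableWithinAt).add (P.differentiableOn_logL x hx)).sub
    (P.differentiableOn_logG' x hx)

theorem exp_logXi (x : ℂ) (hx : 1 < x.re) : Complex.exp (P.logXi x) = P.Ξ x := by
  have hx1 : x ≠ 1 := by
    rintro rfl
    simp at hx
  have hG := P.exp_logG x (lt_trans one_pos hx)
  have hG0 : P.G x ≠ 0 := by
    rw [← hG]
    exact Complex.exp_ne_zero _
  rw [logXi, Complex.exp_sub, Complex.exp_add, Complex.exp_nat_mul,
    Complex.exp_log (sub_ne_zero.2 hx1), P.exp_logL x hx, hG, div_eq_iff hG0, mul_comm,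
    mul_comm (P.L x), ← P.G_mul_Ξ x hx1, mul_comm]

/-- The rapidly decreasing $\log L$ contributes nothing and $q\log(x-1)$ only changes the
coefficient of $\log x$, which does not enter the regularized product. Thus $\log\Xi$ and
$-\log\mathbf G$ have the same constants $b_1$ and $b_0$. -/
theorem hasStirlingExpansion_logXi :
    HasStirlingExpansion P.logXi P.ta₁ P.b₁ (P.ta₀ + P.q) P.b₀ := by
  have hd : DifferentiableOn ℂ (fun x => Complex.log (x - 1)) {x : ℂ | 1 < x.re} := by
    intro x hx
    have hs : x - 1 ∈ Complex.slitPlane := by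
      rw [Complex.mem_slitPlane_iff]
      left
      simpa using hx
    exact ((Complex.hasDerivAt_log hs).comp_sub_const x 1).differentiableAt.differentiableWithinAt
  have h1 := (hasStirlingExpansion_log_sub_one.const_mul P.q).add
    (hasStirlingExpansion_of_decay P.logL_decay) (hd.const_mul _) P.differentiableOn_logL
  have h2 := h1.add (P.hasStirlingExpansion_logG.const_mul (-1))
    ((hd.const_mul _).add P.differentiableOn_logL) (P.differentiableOn_logG'.const_mul _)
  convert h2 using 1
  · funext x
    rw [logXi]
    ring
  all_goals ring

theorem Ξ_ne_zero_of_one_lt_re {x : ℂ} (hx : 1 < x.re) : P.Ξ x ≠ 0 := by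
  rw [← P.exp_logXi x hx]
  exact Complex.exp_ne_zero _

theorem differentiable_Ξ : Differentiable ℂ P.Ξ := P.Ξ_order.1

theorem exists_firstContinuation {x : ℂ} (hx : P.Ξ x ≠ 0) :
    ∃ F : ℂ → ℂ, P.IsFirstContinuation x F ∧
      HasSum (fun ρ : P.Zeros => (P.mult ρ : ℂ) *
        (Complex.log (2 - ρ) - Complex.log (x - ρ) + (x - 2) / (2 - ρ)))
        (deriv F 0 + P.logXi 2 - P.b₀ - P.b₁ * x + (x - 2) * deriv P.logXi 2) :=
  P.Ξ_order.growthAtMostOne.exists_continuation P.differentiable_Ξ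
    (fun z hz => by have := P.nontrivial_zeros z hz; linarith [this.2.1])
    P.differentiableOn_logXi P.exp_logXi P.hasStirlingExpansion_logXi hx

theorem detFirst_eq {x : ℂ} (hx : P.Ξ x ≠ 0) :
    P.detFirst x = P.Ξ x * Complex.exp (-P.b₀ - P.b₁ * x) :=
  P.Ξ_order.growthAtMostOne.exp_neg_deriv_zero P.differentiable_Ξ
    (fun z hz => by have := P.nontrivial_zeros z hz; linarith [this.2.1])
    P.differentiableOn_logXi P.exp_logXi P.hasStirlingExpansion_logXi hx

theorem exists_trivialContinuation {x : ℂ} (hx : P.G x ≠ 0) :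
    ∃ F : ℂ → ℂ, P.IsTrivialContinuation x F := by
  obtain ⟨F, hF, -⟩ := P.G_order.growthAtMostOne.exists_continuation P.G_order.1
    (fun z hz => by linarith [P.trivial_zeros z hz])
    P.differentiableOn_logG' (fun x hx => P.exp_logG x (lt_trans one_pos hx))
    P.hasStirlingExpansion_logG hx
  exact ⟨F, hF⟩

theorem detTrivial_eq {x : ℂ} (hx : P.G x ≠ 0) :
    P.detTrivial x = P.G x * Complex.exp (P.b₀ + P.b₁ * x) := by
  have := P.G_order.growthAtMostOne.exp_neg_deriv_zero P.G_order.1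
    (fun z hz => by linarith [P.trivial_zeros z hz])
    P.differentiableOn_logG' (fun x hx => P.exp_logG x (lt_trans one_pos hx))
    P.hasStirlingExpansion_logG hx
  rw [neg_neg, neg_mul, sub_neg_eq_add] at this
  exact this

end PrimaryFunction

/-! ### Principal logarithms of products in the right half-plane -/

section HalfPlane

/-- If $ab$ were real and nonpositive, then $a|b|^2=(ab)\bar b$ would have nonpositive real part. -/
theorem mul_mem_slitPlane_of_re_pos {a b : ℂ} (ha : 0 < a.re) (hb : 0 < b.re) :
    a * b ∈ Complex.slitPlane := by
  rw [Complex.mem_slitPlane_iff]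
  by_contra! h
  obtain ⟨h1, h2⟩ := h
  rw [Complex.mul_re] at h1
  rw [Complex.mul_im] at h2
  have h3 : a.re * (b.re ^ 2 + b.im ^ 2) =
      (a.re * b.re - a.im * b.im) * b.re + (a.re * b.im + a.im * b.re) * b.im := by ring
  rw [h2, zero_mul, add_zero] at h3
  have h4 : 0 < a.re * (b.re ^ 2 + b.im ^ 2) := by positivity
  nlinarith

theorem log_mul_of_re_pos {a b : ℂ} (ha : 0 < a.re) (hb : 0 < b.re) :
    Complex.log (a * b) = Complex.log a + Complex.log b := by
  have ha0 : a ≠ 0 := by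
    rintro rfl
    simp at ha
  have hb0 : b ≠ 0 := by
    rintro rfl
    simp at hb
  rw [Complex.log_mul_eq_add_log_iff ha0 hb0]
  have h1 := abs_lt.1 (Complex.abs_arg_lt_pi_div_two_iff.2 (Or.inl ha))
  have h2 := abs_lt.1 (Complex.abs_arg_lt_pi_div_two_iff.2 (Or.inl hb))
  constructor <;> linarith

theorem log_I_mul {a : ℂ} (ha : 0 < a.re) :
    Complex.log (Complex.I * a) = Complex.log Complex.I + Complex.log a := by
  have ha0 : a ≠ 0 := by
    rintro rfl
    simp at ha
  rw [Complex.log_mul_eq_add_log_iff Complex.I_ne_zero ha0, Complex.arg_I]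
  have h1 := abs_lt.1 (Complex.abs_arg_lt_pi_div_two_iff.2 (Or.inl ha))
  constructor <;> linarith [Real.pi_pos]

theorem log_neg_I_mul {a : ℂ} (ha : 0 < a.re) :
    Complex.log (-Complex.I * a) = Complex.log (-Complex.I) + Complex.log a := by
  have ha0 : a ≠ 0 := by
    rintro rfl
    simp at ha
  rw [Complex.log_mul_eq_add_log_iff (neg_ne_zero.2 Complex.I_ne_zero) ha0, Complex.arg_neg_I]
  have h1 := abs_lt.1 (Complex.abs_arg_lt_pi_div_two_iff.2 (Or.inl ha))
  constructor <;> linarith [Real.pi_pos]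

end HalfPlane

/-! ### Pairs of zeros and the second family at v = 0 -/

namespace PrimaryFunction

variable (P : PrimaryFunction)

theorem Ξ_one_sub {x : ℂ} : P.Ξ (1 - x) = P.Ξ x := (P.Ξ_symm x).symm

theorem Ξ_half_ne_zero : P.Ξ (1 / 2) ≠ 0 := by
  intro h
  have := (P.nontrivial_zeros _ h).2.2
  norm_num at this

/-- The functional equation makes $\Xi$ even about $\tfrac12$. Hence the Hadamard product centred
there has no linear exponential factor. -/
theorem logDeriv_Ξ_half : logDeriv P.Ξ (1 / 2) = 0 := by
  have h1 : HasDerivAt (fun x => P.Ξ (1 - x)) (-deriv P.Ξ (1 / 2)) (1 / 2) := by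
    have h2 : HasDerivAt P.Ξ (deriv P.Ξ (1 / 2)) (1 - 1 / 2) := by
      have h3 := (P.differentiable_Ξ (1 / 2)).hasDerivAt
      rwa [show (1 : ℂ) - 1 / 2 = 1 / 2 by norm_num]
    simpa using h2.comp_const_sub 1 (1 / 2)
  have h4 : (fun x => P.Ξ (1 - x)) = P.Ξ := funext fun x => P.Ξ_one_sub
  rw [h4] at h1
  have h5 := h1.deriv
  have h6 : deriv P.Ξ (1 / 2) = 0 := by linear_combination h5 / 2
  rw [logDeriv_apply, h6, zero_div]

theorem mult_one_sub (x : ℂ) : P.mult (1 - x) = P.mult x := by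
  have h1 : AnalyticAt ℂ (fun z : ℂ => 1 - z) x := by fun_prop
  have h2 : deriv (fun z : ℂ => 1 - z) x ≠ 0 := by
    have h : HasDerivAt (fun z : ℂ => 1 - z) (-1) x := (hasDerivAt_id x).const_sub 1
    rw [h.deriv]
    norm_num
  have h3 := analyticOrderAt_comp_of_deriv_ne_zero (f := P.Ξ) h1 h2
  have h4 : P.Ξ ∘ (fun z : ℂ => 1 - z) = P.Ξ := funext fun x => P.Ξ_one_sub
  rw [h4] at h3
  rw [mult, mult, analyticOrderNatAt, analyticOrderNatAt, h3]

/-- The upper zeros, as zeros. -/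
def upper (ρ : P.UpperZeros) : P.Zeros := ⟨ρ, ρ.2.1⟩

/-- The mirror images of the upper zeros, as zeros. -/
def lower (ρ : P.UpperZeros) : P.Zeros := ⟨1 - ρ, by rw [P.Ξ_one_sub]; exact ρ.2.1⟩

open Classical in
/-- Every nontrivial zero is an upper zero or the mirror image of one. -/
noncomputable def zerosEquiv : P.UpperZeros × Bool ≃ P.Zeros where
  toFun p := if p.2 then P.lower p.1 else P.upper p.1
  invFun ρ := if h : 0 < (ρ : ℂ).im then (⟨ρ, ρ.2, h⟩, false) else
    (⟨1 - ρ, by rw [P.Ξ_one_sub]; exact ρ.2, by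
      have h1 := (P.nontrivial_zeros ρ ρ.2).2.2
      have h2 : (ρ : ℂ).im < 0 := lt_of_le_of_ne (not_lt.1 h) h1
      simpa using h2⟩, true)
  left_inv p := by
    obtain ⟨⟨ρ, h1, h2⟩, b⟩ := p
    cases b
    · simp [upper, h2]
    · simp [lower, not_lt.2 h2.le]
  right_inv ρ := by
    by_cases h : 0 < (ρ : ℂ).im
    · simp [h, upper]
    · simp [h, lower]

theorem hasSum_pairs {g : P.Zeros → ℂ} {a : ℂ} (h : HasSum g a) :
    HasSum (fun ρ : P.UpperZeros => g (P.upper ρ) + g (P.lower ρ)) a := by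
  refine HasSum.prod_fiberwise (P.zerosEquiv.hasSum_iff.2 h) fun ρ => ?_
  have := hasSum_fintype fun b : Bool => (g ∘ P.zerosEquiv) (ρ, b)
  convert this using 1
  simp [zerosEquiv, add_comm]

theorem hasProd_pairs {g : P.Zeros → ℂ} {a : ℂ} (h : HasProd g a) :
    HasProd (fun ρ : P.UpperZeros => g (P.upper ρ) * g (P.lower ρ)) a := by
  refine HasProd.prod_fiberwise (P.zerosEquiv.hasProd_iff.2 h) fun ρ => ?_
  have := hasProd_fintype fun b : Bool => (g ∘ P.zerosEquiv) (ρ, b)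
  convert this using 1
  simp [zerosEquiv, mul_comm]

theorem coe_upper (ρ : P.UpperZeros) : ((P.upper ρ : P.Zeros) : ℂ) = ρ := rfl

theorem coe_lower (ρ : P.UpperZeros) : ((P.lower ρ : P.Zeros) : ℂ) = 1 - ρ := rfl

/-- The bridge between the two families: the factors on the right belong to $\rho$ and $1-\rho$, and
their sum $2x-1$ does not depend on the pair. -/
theorem tau_sq_add (ρ x : ℂ) : tau ρ ^ 2 + (x - 1 / 2) ^ 2 = (x - ρ) * (x - 1 + ρ) := by
  rw [tau, mul_pow, neg_sq, Complex.I_sq]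
  ring

theorem tau_re (ρ : ℂ) : (tau ρ).re = ρ.im := by
  simp [tau]

theorem I_mul_tau (ρ : ℂ) : Complex.I * tau ρ = ρ - 1 / 2 := by
  rw [tau, ← mul_assoc, mul_neg, Complex.I_mul_I]
  ring

theorem neg_I_mul_tau (ρ : ℂ) : -Complex.I * tau ρ = 1 / 2 - ρ := by
  rw [neg_mul, I_mul_tau]
  ring

theorem tau_re_pos (ρ : P.UpperZeros) : 0 < (tau (ρ : ℂ)).re := by
  rw [tau_re]
  exact ρ.2.2

theorem tau_ne_zero (ρ : P.UpperZeros) : tau (ρ : ℂ) ≠ 0 := by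
  intro h
  have := P.tau_re_pos ρ
  rw [h] at this
  simp at this

theorem tau_sq_add_ne_zero_iff {x : ℂ} :
    (∀ ρ : P.UpperZeros, tau (ρ : ℂ) ^ 2 + (x - 1 / 2) ^ 2 ≠ 0) ↔ P.Ξ x ≠ 0 := by
  constructor
  · intro h h0
    obtain h1 | h1 := lt_or_gt_of_ne (P.nontrivial_zeros x h0).2.2
    · refine h ⟨1 - x, by rw [P.Ξ_one_sub]; exact h0, by simpa using h1⟩ ?_
      rw [tau_sq_add]
      ring
    · refine h ⟨x, h0, h1⟩ ?_
      rw [tau_sq_add]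
      ring
  · intro h ρ h0
    rw [tau_sq_add, mul_eq_zero] at h0
    obtain h0 | h0 := h0
    · apply h
      rw [sub_eq_zero] at h0
      rw [h0]
      exact ρ.2.1
    · apply h
      have h1 : x = 1 - ρ := by linear_combination h0
      rw [h1, P.Ξ_one_sub]
      exact ρ.2.1

theorem convergesBeyond_zeros {x : ℂ} (hx : P.Ξ x ≠ 0) :
    ConvergesBeyond (fun ρ : P.Zeros => P.mult ρ) (fun ρ => x - ρ) 1 :=
  P.Ξ_order.growthAtMostOne.convergesBeyond P.differentiable_Ξ hx

theorem upper_injective : Function.Injective P.upper := by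
  intro a b h
  have h1 := congrArg Subtype.val h
  exact Subtype.ext h1

/-- Since $|\tau|=|\tfrac12-\rho|$, squaring halves the exponent. Being below one, it allows
translation in $v$ with a single subtracted term. -/
theorem convergesBeyond_tau_sq :
    ConvergesBeyond (fun ρ : P.UpperZeros => P.mult ρ) (fun ρ => tau ρ ^ 2) (1 / 2) := by
  have h := P.convergesBeyond_zeros P.Ξ_half_ne_zero
  refine ⟨fun ρ => h.one_le (P.upper ρ), fun ρ => pow_ne_zero 2 (P.tau_ne_zero ρ), fun s hs => ?_⟩
  have h1 := (h.summable (2 * s) (by linarith)).comp_injective P.upper_injective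
  refine h1.congr fun ρ => ?_
  simp only [Function.comp_apply, coe_upper]
  congr 1
  rw [norm_pow, ← Real.rpow_natCast, ← Real.rpow_mul (norm_nonneg _), ← neg_I_mul_tau, norm_mul]
  simp

/-- In the critical strip $|\operatorname{Im}\tau|<\tfrac12$, so $|\tau|\ge1$ already forces
$|\operatorname{Re}\tau|>|\operatorname{Im}\tau|$. -/
theorem eventually_re_tau_sq_pos : ∀ᶠ ρ : P.UpperZeros in cofinite, 0 < (tau (ρ : ℂ) ^ 2).re := by
  filter_upwards [P.convergesBeyond_tau_sq.eventually_le_norm 1] with ρ hρ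
  have h1 := P.nontrivial_zeros ρ ρ.2.1
  have h2 : (tau (ρ : ℂ)).im = 1 / 2 - (ρ : ℂ).re := by
    simp [tau]
  rw [norm_pow, Complex.sq_norm, Complex.normSq_apply] at hρ
  rw [pow_two, Complex.mul_re]
  rw [h2] at hρ ⊢
  nlinarith [h1.1, h1.2.1]

theorem convergesBeyond_tau_sq_add {v : ℂ} (hv : ∀ ρ : P.UpperZeros, tau (ρ : ℂ) ^ 2 + v ≠ 0) :
    ConvergesBeyond (fun ρ : P.UpperZeros => P.mult ρ) (fun ρ => tau ρ ^ 2 + v) (1 / 2) :=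
  P.convergesBeyond_tau_sq.add_const (by norm_num) hv

/-- As $\operatorname{Re}\tau>0$, the arguments of $\pm i\tau$ are exactly $\arg\tau\pm\pi/2$, so
the two powers are $\tau^{-2s}$ with phases $e^{\mp i\pi s}$. -/
theorem tau_sq_cpow (ρ : P.UpperZeros) (s : ℂ) :
    (tau (ρ : ℂ) ^ 2) ^ (-s) * (2 * Complex.cos (Real.pi * s)) =
      (1 / 2 - (ρ : ℂ)) ^ (-(2 * s)) + ((ρ : ℂ) - 1 / 2) ^ (-(2 * s)) := by
  have hre := P.tau_re_pos ρ
  have h0 := P.tau_ne_zero ρ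
  have hI := Complex.I_ne_zero
  rw [← neg_I_mul_tau, ← I_mul_tau, Complex.cpow_def_of_ne_zero (pow_ne_zero 2 h0),
    Complex.cpow_def_of_ne_zero (mul_ne_zero (neg_ne_zero.2 hI) h0),
    Complex.cpow_def_of_ne_zero (mul_ne_zero hI h0), log_I_mul hre, log_neg_I_mul hre, pow_two,
    log_mul_of_re_pos hre hre, Complex.log_I, Complex.log_neg_I, Complex.two_cos, mul_add,
    ← Complex.exp_add, ← Complex.exp_add]
  congr 2 <;> ring

theorem isStripContinuation_second_zero {F : ℂ → ℂ} (hF : P.IsFirstContinuation (1 / 2) F) (α : ℝ) :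
    IsStripContinuation (fun ρ : P.UpperZeros => P.mult ρ) (fun ρ => tau ρ ^ 2) (1 / 2) α 1
      fun s => F (2 * s) / (2 * Complex.cos (Real.pi * s)) := by
  refine ⟨fun s _ => ?_, fun s hs hs1 => ?_⟩
  · refine MeromorphicAt.div ?_ (AnalyticAt.meromorphicAt ?_)
    · exact (hF.meromorphic (2 * s)).comp_analyticAt (by fun_prop)
    · refine Differentiable.analyticAt ?_ s
      exact (Complex.differentiable_cos.comp (by fun_prop)).const_mul 2
  · have h1 := P.hasSum_pairs (hF.hasSum (2 * s) (by simp; linarith))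
    -- The zeros of $\cos\pi s$ are the half-odd integers, and none has real part strictly between
    -- $\tfrac12$ and $1$, the right edge chosen for the strip.
    have hcos : 2 * Complex.cos (Real.pi * s) ≠ 0 := by
      refine mul_ne_zero two_ne_zero fun h0 => ?_
      rw [Complex.cos_eq_zero_iff] at h0
      obtain ⟨k, hk⟩ := h0
      have hpi : (Real.pi : ℂ) ≠ 0 := by exact_mod_cast Real.pi_ne_zero
      have hk' : s = (2 * k + 1) / 2 := by
        apply mul_left_cancel₀ hpi
        rw [hk]
        ring
      have hre : s.re = (2 * k + 1) / 2 := by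
        rw [hk']
        have : ((2 * (k : ℂ) + 1) / 2) = (((2 * k + 1) / 2 : ℝ) : ℂ) := by push_cast; ring
        rw [this, Complex.ofReal_re]
      rw [hre] at hs hs1
      have h2 : (0 : ℝ) < k := by linarith
      have h3 : (k : ℝ) < 1 := by linarith
      norm_cast at h2 h3
      omega
    rw [div_eq_iff hcos, ← h1.tsum_eq, ← tsum_mul_right]
    refine tsum_congr fun ρ => ?_
    rw [mul_assoc, P.tau_sq_cpow, coe_upper, coe_lower, P.mult_one_sub]
    rw [show (1 : ℂ) / 2 - (1 - ρ) = ρ - 1 / 2 by ring]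
    ring

/-- The derivative at $0$ is unchanged: the factor $2$ from doubling the argument cancels the $2$ of
$2\cos\pi s$, and the cosine is stationary at $0$. -/
theorem exists_secondContinuation_zero {F : ℂ → ℂ} (hF : P.IsFirstContinuation (1 / 2) F) :
    ∃ F₀, IsZetaContinuation (fun ρ : P.UpperZeros => P.mult ρ) (fun ρ => tau ρ ^ 2) (1 / 2) F₀ ∧
      deriv F₀ 0 = deriv F 0 := by
  have hstrip := P.isStripContinuation_second_zero hF
  set A : ℂ → ℂ := fun s => F (2 * s) / (2 * Complex.cos (Real.pi * s)) with hA
  have hF2 : AnalyticAt ℂ (fun s : ℂ => F (2 * s)) 0 :=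
    AnalyticAt.comp_of_eq hF.analyticAt_zero (by fun_prop) (by simp)
  have hcosd : Differentiable ℂ fun s : ℂ => 2 * Complex.cos (Real.pi * s) :=
    (Complex.differentiable_cos.comp (by fun_prop)).const_mul 2
  have hAan : AnalyticAt ℂ A 0 := hF2.div (hcosd.analyticAt 0) (by simp)
  obtain ⟨F₀, hF₀⟩ := exists_isZetaContinuation P.convergesBeyond_tau_sq (by norm_num)
    (β := 1) (by norm_num) (fun N => ⟨A, hstrip _⟩)
    ⟨A, A, -1, by norm_num, hstrip _, EventuallyEq.rfl, hAan⟩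
  refine ⟨F₀, hF₀, ?_⟩
  have h0 : F₀ =ᶠ[𝓝 0] A := hF₀.eventuallyEq_nhds_zero (hstrip (-1)) (by norm_num)
    (by constructor <;> norm_num) EventuallyEq.rfl hAan
  rw [h0.deriv_eq]
  have e1 : HasDerivAt (fun s : ℂ => F (2 * s)) (2 * deriv F 0) 0 := by
    have h1 : HasDerivAt F (deriv F 0) (2 * 0) := by
      rw [mul_zero]
      exact hF.analyticAt_zero.differentiableAt.hasDerivAt
    have h2 := h1.comp (0 : ℂ) ((hasDerivAt_id (0 : ℂ)).const_mul 2)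
    refine h2.congr_deriv ?_
    ring
  have e2 : HasDerivAt (fun s : ℂ => 2 * Complex.cos (Real.pi * s)) 0 0 := by
    have h1 := (((hasDerivAt_id (0 : ℂ)).const_mul (Real.pi : ℂ)).ccos).const_mul 2
    refine h1.congr_deriv ?_
    simp
  have e3 := e1.div e2 (by simp)
  rw [show deriv A 0 = _ from e3.deriv]
  simp
  ring

end PrimaryFunction

/-! ### The regularized product of the second family and its logarithm -/

theorem HasSum.of_eq {ι : Type*} {f g : ι → ℂ} {a b : ℂ} (h : HasSum f a)
    (hfg : ∀ k, g k = f k) (hab : b = a) : HasSum g b := by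
  rw [hab, funext hfg]
  exact h

namespace PrimaryFunction

variable (P : PrimaryFunction)

/-- In the Hadamard sum centred at $\tfrac12$ the constants $1/(\tfrac12-\rho)$ of $\rho$ and
$1-\rho$ are opposite, and $\Xi'/\Xi(\tfrac12)=0$. -/
theorem hasSum_pairs_logDeriv {x : ℂ} (hx : P.Ξ x ≠ 0) :
    HasSum (fun ρ : P.UpperZeros => (P.mult ρ : ℂ) * ((x - ρ)⁻¹ + (x - 1 + ρ)⁻¹))
      (logDeriv P.Ξ x) := by
  have h1 := P.hasSum_pairs (P.Ξ_order.growthAtMostOne.hasSum_sub P.differentiable_Ξ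
    P.Ξ_half_ne_zero hx)
  rw [P.logDeriv_Ξ_half, sub_zero] at h1
  refine h1.of_eq (fun ρ => ?_) rfl
  have h2 : analyticOrderNatAt P.Ξ (1 - (ρ : ℂ)) = P.mult ρ := P.mult_one_sub ρ
  have h3 : analyticOrderNatAt P.Ξ (ρ : ℂ) = P.mult ρ := rfl
  have h4 : ((1 : ℂ) / 2 - (1 - ρ))⁻¹ = -((1 : ℂ) / 2 - ρ)⁻¹ := by
    rw [← inv_neg]
    congr 1
    ring
  rw [coe_upper, coe_lower, h2, h3, h4, show x - (1 - (ρ : ℂ)) = x - 1 + ρ by ring]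
  ring

/-- The anchor for the branch of the logarithm, at $x=2$, that is $v=\tfrac94$. There all the
factors $2-\rho$ have positive real part, so the logarithms of a pair add exactly and not merely
modulo $2\pi i$. -/
theorem hasSum_log_tau_sq {F : ℂ → ℂ} (hF : P.IsFirstContinuation (1 / 2) F) :
    HasSum (fun ρ : P.UpperZeros => (P.mult ρ : ℂ) *
      (Complex.log (tau ρ ^ 2) - Complex.log (tau ρ ^ 2 + 9 / 4)))
      (-(deriv F 0 + P.logXi 2 - P.b₀ - P.b₁ / 2)) := by
  obtain ⟨F', hF', hsum⟩ := P.exists_firstContinuation P.Ξ_half_ne_zero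
  have h0 : deriv F' 0 = deriv F 0 := hF'.deriv_zero_unique hF
  have h1 := (P.hasSum_pairs hsum).neg
  have hld : logDeriv P.Ξ 2 = deriv P.logXi 2 :=
    deriv_eq_logDeriv_of_exp isOpen_one_lt_re P.differentiableOn_logXi P.exp_logXi (by simp)
  -- Summed over pairs, the linear terms of the logarithmic sum are a multiple of $\Xi'/\Xi(2)$;
  -- adding this multiple back removes them.
  have h2 := (P.hasSum_pairs_logDeriv (P.Ξ_ne_zero_of_one_lt_re (x := 2) (by simp))).mul_left
    ((1 : ℂ) / 2 - 2)
  have h3 := h1.add h2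
  rw [hld, h0] at h3
  refine h3.of_eq (fun ρ => ?_) ?_
  · have hz := P.nontrivial_zeros ρ ρ.2.1
    have hre := P.tau_re_pos ρ
    have e1 : Complex.log (tau (ρ : ℂ) ^ 2 + 9 / 4) =
        Complex.log (2 - ρ) + Complex.log (2 - (1 - (ρ : ℂ))) := by
      rw [← log_mul_of_re_pos]
      · congr 1
        have := tau_sq_add ρ 2
        linear_combination this
      · simp
        linarith [hz.2.1]
      · simp
        linarith [hz.1]
    have e2 : Complex.log (tau (ρ : ℂ) ^ 2) =
        Complex.log (1 / 2 - ρ) + Complex.log (1 / 2 - (1 - (ρ : ℂ))) := by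
      rw [show (1 : ℂ) / 2 - (1 - (ρ : ℂ)) = ρ - 1 / 2 by ring, ← neg_I_mul_tau, ← I_mul_tau,
        log_I_mul hre, log_neg_I_mul hre, pow_two, log_mul_of_re_pos hre hre, Complex.log_I,
        Complex.log_neg_I]
      ring
    rw [coe_upper, coe_lower, P.mult_one_sub, e1, e2,
      show (2 : ℂ) - (1 - (ρ : ℂ)) = 2 - 1 + ρ by ring]
    ring
  · ring

theorem exists_secondContinuation {F : ℂ → ℂ} (hF : P.IsFirstContinuation (1 / 2) F) {v : ℂ}
    (hv : ∀ ρ : P.UpperZeros, tau (ρ : ℂ) ^ 2 + v ≠ 0) :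
    ∃ F', P.IsSecondContinuation v F' ∧ HasSum (fun ρ : P.UpperZeros => (P.mult ρ : ℂ) *
      (Complex.log (tau ρ ^ 2) - Complex.log (tau ρ ^ 2 + v))) (deriv F' 0 - deriv F 0) := by
  obtain ⟨F₀, hF₀, hd⟩ := P.exists_secondContinuation_zero hF
  rw [← hd]
  exact hF₀.exists_shift_of_lt_one P.convergesBeyond_tau_sq (by norm_num) (by norm_num)
    P.eventually_re_tau_sq_pos hv

theorem ne_zero_of_secondAdmissible {v : ℂ} (hv : P.SecondAdmissible v) (ρ : P.UpperZeros) :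
    tau (ρ : ℂ) ^ 2 + v ≠ 0 :=
  Complex.slitPlane_ne_zero (hv ρ)

theorem zetaSecondDerivZero_sub {F : ℂ → ℂ} (hF : P.IsFirstContinuation (1 / 2) F) {v : ℂ}
    (hv : ∀ ρ : P.UpperZeros, tau (ρ : ℂ) ^ 2 + v ≠ 0) :
    HasSum (fun ρ : P.UpperZeros => (P.mult ρ : ℂ) *
      (Complex.log (tau ρ ^ 2) - Complex.log (tau ρ ^ 2 + v)))
      (P.zetaSecondDerivZero v - deriv F 0) := by
  obtain ⟨F', hF', h⟩ := P.exists_secondContinuation hF hv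
  rw [zetaSecondDerivZero, hF'.zetaDerivZero_eq]
  exact h

/-- The translation from $0$ to $v$ exponentiates to $\prod(\tau^2+v)/\tau^2$, the paired Hadamard
product of $\Xi(x)/\Xi(\tfrac12)$. The starting value is the first regularized product at
$\tfrac12$, whose derivative at exponent $0$ is that of the second family at $v=0$. -/
theorem detSecond_eq {x : ℂ} (hx : P.Ξ x ≠ 0) :
    P.detSecond ((x - 1 / 2) ^ 2) = Complex.exp (-(P.b₀ + P.b₁ / 2)) * P.Ξ x := by
  obtain ⟨F, hF, -⟩ := P.exists_firstContinuation P.Ξ_half_ne_zero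
  have h1 := P.detFirst_eq P.Ξ_half_ne_zero
  rw [detFirst, zetaFirstDerivZero, hF.zetaDerivZero_eq] at h1
  have hv := P.tau_sq_add_ne_zero_iff.2 hx
  have h2 := (P.zetaSecondDerivZero_sub hF hv).neg.cexp
  have h3 := P.hasProd_pairs (P.Ξ_order.growthAtMostOne.hasProd P.differentiable_Ξ
    P.Ξ_half_ne_zero hx)
  rw [P.logDeriv_Ξ_half, mul_zero, neg_zero, Complex.exp_zero, mul_one] at h3
  have h4 : (Complex.exp ∘ fun ρ : P.UpperZeros => -((P.mult ρ : ℂ) *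
      (Complex.log (tau ρ ^ 2) - Complex.log (tau ρ ^ 2 + (x - 1 / 2) ^ 2)))) =
      fun ρ : P.UpperZeros => ((x - P.upper ρ) / (1 / 2 - P.upper ρ) *
        Complex.exp (-((x - 1 / 2) / (1 / 2 - P.upper ρ)))) ^
          analyticOrderNatAt P.Ξ (P.upper ρ : ℂ) *
        ((x - P.lower ρ) / (1 / 2 - P.lower ρ) *
        Complex.exp (-((x - 1 / 2) / (1 / 2 - P.lower ρ)))) ^
          analyticOrderNatAt P.Ξ (P.lower ρ : ℂ) := by
    funext ρ
    have e1 : analyticOrderNatAt P.Ξ (1 - (ρ : ℂ)) = P.mult ρ := P.mult_one_sub ρ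
    have e2 : analyticOrderNatAt P.Ξ (ρ : ℂ) = P.mult ρ := rfl
    have e3 : (1 : ℂ) / 2 - ρ ≠ 0 := sub_zero_ne_zero P.Ξ_half_ne_zero (P.upper ρ)
    have e4 : (1 : ℂ) / 2 - (1 - ρ) = -(1 / 2 - ρ) := by ring
    have e5 : tau (ρ : ℂ) ^ 2 = (1 / 2 - ρ) * (1 / 2 - (1 - ρ)) := by
      have := tau_sq_add ρ (1 / 2)
      linear_combination this
    rw [coe_upper, coe_lower, e1, e2, ← mul_pow, Function.comp_apply, ← mul_neg,
      Complex.exp_nat_mul, neg_sub, Complex.exp_sub, Complex.exp_log (hv ρ),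
      Complex.exp_log (pow_ne_zero 2 (P.tau_ne_zero ρ))]
    congr 1
    -- The convergence factors of two zeros symmetric about $\tfrac12$ are inverse to each other.
    have e6 : -((x - 1 / 2) / (1 / 2 - (ρ : ℂ))) + -((x - 1 / 2) / -(1 / 2 - ρ)) = 0 := by
      rw [div_neg]
      ring
    rw [tau_sq_add, e5, mul_mul_mul_comm, ← Complex.exp_add, e4, e6, Complex.exp_zero, mul_one,
      div_mul_div_comm]
    congr 1
    ring
  rw [h4] at h2
  have h5 := h2.unique h3
  rw [detSecond, show -P.zetaSecondDerivZero ((x - 1 / 2) ^ 2) =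
    -(P.zetaSecondDerivZero ((x - 1 / 2) ^ 2) - deriv F 0) + -deriv F 0 by ring, Complex.exp_add,
    h5, h1, ← mul_assoc, div_mul_cancel₀ _ P.Ξ_half_ne_zero, mul_comm]
  congr 2
  ring

theorem zetaSecondDerivZero_nine_fourths :
    P.zetaSecondDerivZero (9 / 4) = P.b₁ / 2 + P.b₀ - P.logXi 2 := by
  obtain ⟨F, hF, -⟩ := P.exists_firstContinuation P.Ξ_half_ne_zero
  have hv := P.tau_sq_add_ne_zero_iff.2 (P.Ξ_ne_zero_of_one_lt_re (x := 2) (by simp))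
  rw [show ((2 : ℂ) - 1 / 2) ^ 2 = 9 / 4 by norm_num] at hv
  have := (P.zetaSecondDerivZero_sub hF hv).unique (P.hasSum_log_tau_sq hF)
  linear_combination this

theorem eventually_tau_sq_add_ne_zero {v : ℂ} (hv : ∀ ρ : P.UpperZeros, tau (ρ : ℂ) ^ 2 + v ≠ 0) :
    ∀ᶠ z in 𝓝 v, ∀ ρ : P.UpperZeros, tau (ρ : ℂ) ^ 2 + z ≠ 0 := by
  have hfin : {ρ : P.UpperZeros | ¬ ‖v‖ + 1 ≤ ‖tau (ρ : ℂ) ^ 2‖}.Finite :=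
    P.convergesBeyond_tau_sq.eventually_le_norm (‖v‖ + 1)
  have h1 : ∀ᶠ z in 𝓝 v, ∀ ρ ∈ {ρ : P.UpperZeros | ¬ ‖v‖ + 1 ≤ ‖tau (ρ : ℂ) ^ 2‖},
      tau (ρ : ℂ) ^ 2 + z ≠ 0 := by
    rw [Filter.eventually_all_finite hfin]
    intro ρ _
    exact (by fun_prop : ContinuousAt (fun z : ℂ => tau (ρ : ℂ) ^ 2 + z) v).eventually_ne (hv ρ)
  filter_upwards [h1, Metric.ball_mem_nhds v one_pos] with z hz hzb ρ
  by_cases hρ : ‖v‖ + 1 ≤ ‖tau (ρ : ℂ) ^ 2‖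
  · intro h0
    have h2 : tau (ρ : ℂ) ^ 2 = -z := by linear_combination h0
    rw [h2, norm_neg] at hρ
    rw [Metric.mem_ball, dist_eq_norm] at hzb
    have := norm_sub_norm_le z v
    linarith
  · exact hz ρ hρ

theorem norm_log_sub_log_add_le {w b : ℂ} (hw : 0 < w.re) (hb : 2 * ‖b‖ ≤ ‖w‖) :
    w + b ∈ Complex.slitPlane ∧
      ‖Complex.log w - Complex.log (w + b)‖ ≤ 3 / 2 * (‖b‖ * ‖w‖⁻¹) := by
  have hw0 : w ≠ 0 := by
    rintro rfl
    simp at hw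
  have hwn : 0 < ‖w‖ := norm_pos_iff.2 hw0
  have hb' : ‖b / w‖ ≤ 1 / 2 := by
    rw [norm_div, div_le_iff₀ hwn]
    linarith
  have hre : 0 < (1 + b / w).re := by
    have := (abs_le.1 ((Complex.abs_re_le_norm (b / w)).trans hb')).1
    simp only [Complex.add_re, Complex.one_re]
    linarith
  have h1 : w + b = w * (1 + b / w) := by field_simp
  constructor
  · rw [h1]
    exact mul_mem_slitPlane_of_re_pos hw hre
  · rw [h1, log_mul_of_re_pos hw hre, sub_add_cancel_left, norm_neg]
    refine (Complex.norm_log_one_add_half_le_self hb').trans_eq ?_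
    rw [norm_div, div_eq_mul_inv ‖b‖]

/-- Up to a constant it is a sum of differences of logarithms of size $O(|\tau|^{-2})$, locally
uniformly in $v$. Admissibility keeps the finitely many remaining logarithms off their cut. -/
theorem analyticOnNhd_zetaSecondDerivZero :
    AnalyticOnNhd ℂ P.zetaSecondDerivZero {v : ℂ | P.SecondAdmissible v} := by
  intro v hv
  obtain ⟨F, hF, -⟩ := P.exists_firstContinuation P.Ξ_half_ne_zero
  have hcb := P.convergesBeyond_tau_sq
  have han := (analyticAt_tsum_of_eventually (s₀ := v) (U := Metric.ball v 1)
    (F := fun (ρ : P.UpperZeros) (z : ℂ) => (P.mult ρ : ℂ) *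
      (Complex.log (tau ρ ^ 2) - Complex.log (tau ρ ^ 2 + z)))
    (Metric.ball_mem_nhds v one_pos)
    (u := fun ρ => 3 / 2 * (‖v‖ + 1) * ((P.mult ρ : ℝ) * ‖tau (ρ : ℂ) ^ 2‖ ^ (-(1 : ℝ))))
    ((hcb.summable 1 (by norm_num)).mul_left _) (by
      filter_upwards [hcb.eventually_le_norm (2 * (‖v‖ + 1)), P.eventually_re_tau_sq_pos]
        with ρ hρ hre
      have hball : ∀ z ∈ Metric.ball v 1, ‖z‖ ≤ ‖v‖ + 1 := by
        intro z hz
        rw [Metric.mem_ball, dist_eq_norm] at hz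
        have := norm_sub_norm_le z v
        linarith
      have hb : ∀ z ∈ Metric.ball v 1, _ := fun z hz =>
        norm_log_sub_log_add_le (b := z) hre (by linarith [hball z hz])
      refine ⟨fun z hz => ?_, fun z hz => ?_⟩
      · refine DifferentiableAt.differentiableWithinAt ?_
        refine DifferentiableAt.const_mul (DifferentiableAt.const_sub ?_ _) _
        exact DifferentiableAt.clog (by fun_prop) (hb z hz).1
      · rw [norm_mul, Complex.norm_natCast, Real.rpow_neg_one]
        calc _ ≤ (P.mult ρ : ℝ) * (3 / 2 * (‖z‖ * ‖tau (ρ : ℂ) ^ 2‖⁻¹)) := by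
              gcongr
              exact (hb z hz).2
          _ ≤ (P.mult ρ : ℝ) * (3 / 2 * ((‖v‖ + 1) * ‖tau (ρ : ℂ) ^ 2‖⁻¹)) := by
              gcongr
              exact hball z hz
          _ = _ := by ring)
    (fun ρ => by
      refine analyticAt_const.mul (analyticAt_const.sub ?_)
      exact AnalyticAt.clog (by fun_prop) (hv ρ))).1
  refine (han.add (analyticAt_const (v := deriv F 0))).congr ?_
  filter_upwards [P.eventually_tau_sq_add_ne_zero (P.ne_zero_of_secondAdmissible hv)] with z hz
  rw [Pi.add_apply, (P.zetaSecondDerivZero_sub hF hz).tsum_eq, sub_add_cancel]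

theorem secondAdmissible_of_one_lt_re {x : ℂ} (hx : 1 < x.re) :
    P.SecondAdmissible ((x - 1 / 2) ^ 2) := by
  intro ρ
  have hz := P.nontrivial_zeros ρ ρ.2.1
  rw [tau_sq_add]
  refine mul_mem_slitPlane_of_re_pos ?_ ?_
  · rw [Complex.sub_re]
    linarith [hz.2.1]
  · rw [Complex.add_re, Complex.sub_re, Complex.one_re]
    linarith [hz.1]

/-- By the formula for the regularized product, the exponentials of the two sides agree. Their
difference is therefore constant on the connected half-plane, and it vanishes at $x=2$. -/
theorem zetaSecondDerivZero_eq {x : ℂ} (hx : 1 < x.re) :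
    P.zetaSecondDerivZero ((x - 1 / 2) ^ 2) = P.b₁ / 2 + P.b₀ - P.logXi x := by
  set g : ℂ → ℂ := fun x => P.zetaSecondDerivZero ((x - 1 / 2) ^ 2) + P.logXi x with hg
  have hU := isOpen_one_lt_re
  have hgd : DifferentiableOn ℂ g {x : ℂ | 1 < x.re} := by
    intro z hz
    have h1 : AnalyticAt ℂ (fun x : ℂ => P.zetaSecondDerivZero ((x - 1 / 2) ^ 2)) z :=
      AnalyticAt.comp_of_eq (P.analyticOnNhd_zetaSecondDerivZero _
        (P.secondAdmissible_of_one_lt_re hz)) (by fun_prop) rfl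
    exact h1.differentiableAt.differentiableWithinAt.add (P.differentiableOn_logXi z hz)
  have hexp : ∀ z ∈ {x : ℂ | 1 < x.re}, Complex.exp (g z) = Complex.exp (P.b₀ + P.b₁ / 2) := by
    intro z hz
    have hΞ := P.Ξ_ne_zero_of_one_lt_re hz
    have h1 := P.detSecond_eq hΞ
    rw [detSecond, Complex.exp_neg, Complex.exp_neg, ← P.exp_logXi z hz] at h1
    have h2 := Complex.exp_ne_zero (P.zetaSecondDerivZero ((z - 1 / 2) ^ 2))
    have h3 := Complex.exp_ne_zero (P.b₀ + P.b₁ / 2)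
    rw [hg]
    simp only [Complex.exp_add] at h1 h3 ⊢
    generalize Complex.exp (P.zetaSecondDerivZero ((z - 1 / 2) ^ 2)) = A at *
    field_simp at h1
    linear_combination -h1
  have hderiv : Set.EqOn (deriv g) 0 {x : ℂ | 1 < x.re} := by
    intro z hz
    have h1 := (hgd.differentiableAt (hU.mem_nhds hz)).hasDerivAt.cexp
    have h2 : (fun z => Complex.exp (g z)) =ᶠ[𝓝 z] fun _ => Complex.exp (P.b₀ + P.b₁ / 2) := by
      filter_upwards [hU.mem_nhds hz] with y hy
      exact hexp y hy
    have h3 := h1.deriv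
    rw [h2.deriv_eq, deriv_const] at h3
    exact (mul_eq_zero.1 h3.symm).resolve_left (Complex.exp_ne_zero _)
  have hconv : IsPreconnected {x : ℂ | 1 < x.re} := (convex_halfSpace_re_gt 1).isPreconnected
  have h2 := hU.is_const_of_deriv_eq_zero hconv hgd hderiv hx
    (show (2 : ℂ) ∈ {x : ℂ | 1 < x.re} by simp)
  simp only [hg] at h2
  rw [show ((2 : ℂ) - 1 / 2) ^ 2 = 9 / 4 by norm_num, P.zetaSecondDerivZero_nine_fourths] at h2
  linear_combination h2

theorem G_mul_Ξ_tendsto (x : ℂ) :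
    Tendsto (fun z : ℂ => (z - 1) ^ P.q * P.L z) (𝓝[≠] x) (𝓝 (P.G x * P.Ξ x)) := by
  have h1 : Tendsto (fun z => P.G z * P.Ξ z) (𝓝[≠] x) (𝓝 (P.G x * P.Ξ x)) :=
    ((P.G_order.1.continuous.mul P.differentiable_Ξ.continuous).tendsto x).mono_left
      nhdsWithin_le_nhds
  refine h1.congr' ?_
  have h2 : ∀ᶠ z in 𝓝[≠] x, z ≠ 1 := by
    by_cases hx : x = 1
    · rw [hx]
      exact self_mem_nhdsWithin
    · exact nhdsWithin_le_nhds (isOpen_ne.mem_nhds hx)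
  filter_upwards [h2] with z hz
  exact P.G_mul_Ξ z hz

theorem G_mul_Ξ_eq {x : ℂ} (hx : x ≠ 1 ∨ P.q = 0) :
    (x - 1) ^ P.q * P.L x = P.G x * P.Ξ x := by
  by_cases h1 : x = 1
  · have hq := hx.resolve_left (not_not.2 h1)
    have h2 := P.G_mul_Ξ_tendsto x
    have h3 : Tendsto (fun z : ℂ => (z - 1) ^ P.q * P.L z) (𝓝[≠] x)
        (𝓝 ((x - 1) ^ P.q * P.L x)) := by
      simp only [hq, pow_zero, one_mul]
      rw [h1]
      exact (P.differentiableAt_L_one hq).continuousAt.tendsto.mono_left nhdsWithin_le_nhds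
    exact tendsto_nhds_unique h3 h2
  · exact (P.G_mul_Ξ x h1).symm

theorem detTrivial_mul_detSecond {x : ℂ} (hG : P.G x ≠ 0) (hΞ : P.Ξ x ≠ 0) :
    Complex.exp (-P.b₁ * (x - 1 / 2)) * P.detTrivial x * P.detSecond ((x - 1 / 2) ^ 2) =
      P.G x * P.Ξ x := by
  rw [P.detTrivial_eq hG, P.detSecond_eq hΞ]
  have h1 : Complex.exp (-P.b₁ * (x - 1 / 2)) * Complex.exp (P.b₀ + P.b₁ * x) *
      Complex.exp (-(P.b₀ + P.b₁ / 2)) = 1 := by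
    rw [← Complex.exp_add, ← Complex.exp_add, Complex.exp_eq_one_iff]
    exact ⟨0, by push_cast; ring⟩
  linear_combination P.G x * P.Ξ x * h1

theorem Ξ_ne_zero_of_firstAdmissible {x : ℂ} (hx : P.FirstAdmissible x) : P.Ξ x ≠ 0 := by
  intro h
  have := Complex.slitPlane_ne_zero (hx ⟨x, h⟩)
  simp at this

theorem G_ne_zero_of_trivialAdmissible {x : ℂ} (hx : P.TrivialAdmissible x) : P.G x ≠ 0 := by
  intro h
  have := Complex.slitPlane_ne_zero (hx ⟨x, h⟩)
  simp at this

end PrimaryFunction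

/-! ### Waring's formula and the partial fractions that invert it -/

section Waring

/-- The recursion of Waring's coefficients $\frac n{n-\ell}\binom{n-\ell}\ell$ that mirrors
$p_{n+2}=(a+b)p_{n+1}-ab\,p_n$ for the power sums. -/
theorem waring_coeff {n ℓ : ℕ} (hn : 1 ≤ n) (hℓ : 2 * ℓ ≤ n) :
    ((n + 2 : ℕ) : ℂ) * (((n + 1 - ℓ).choose (ℓ + 1) : ℂ) / ((n + 1 - ℓ : ℕ) : ℂ)) =
      ((n + 1 : ℕ) : ℂ) * (((n - ℓ).choose (ℓ + 1) : ℂ) / ((n - ℓ : ℕ) : ℂ)) +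
        (n : ℂ) * (((n - ℓ).choose ℓ : ℂ) / ((n - ℓ : ℕ) : ℂ)) := by
  obtain ⟨m, rfl⟩ : ∃ m, n = m + ℓ := ⟨n - ℓ, by omega⟩
  have hm : (m : ℂ) ≠ 0 := by
    norm_cast
    omega
  have hm1 : ((m + 1 : ℕ) : ℂ) ≠ 0 := by
    norm_cast
  have hl1 : ((ℓ + 1 : ℕ) : ℂ) ≠ 0 := by
    norm_cast
  rw [show m + ℓ + 1 - ℓ = m + 1 by omega, show m + ℓ - ℓ = m by omega]
  have h1 : ((m + 1 : ℕ) : ℂ) * (m.choose ℓ : ℂ) = ((m + 1).choose (ℓ + 1) : ℂ) * ((ℓ + 1 : ℕ) : ℂ) := by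
    exact_mod_cast Nat.add_one_mul_choose_eq m ℓ
  have h2 : (m.choose (ℓ + 1) : ℂ) * ((ℓ + 1 : ℕ) : ℂ) = (m.choose ℓ : ℂ) * ((m : ℂ) - ℓ) := by
    rw [← Nat.cast_sub (by omega)]
    exact_mod_cast Nat.choose_succ_right_eq m ℓ
  have e1 : ((m + 1).choose (ℓ + 1) : ℂ) / ((m + 1 : ℕ) : ℂ) = (m.choose ℓ : ℂ) / ((ℓ + 1 : ℕ) : ℂ) := by
    rw [div_eq_div_iff hm1 hl1, ← h1, mul_comm]
  have e2 : (m.choose (ℓ + 1) : ℂ) = (m.choose ℓ : ℂ) * ((m : ℂ) - ℓ) / ((ℓ + 1 : ℕ) : ℂ) := by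
    rw [eq_div_iff hl1, h2]
  rw [e1, e2]
  push_cast at hl1 ⊢
  field_simp
  ring

theorem waring_term {n : ℕ} (hn : 1 ≤ n) (ℓ : ℕ) (s : ℂ) :
    ((n + 2 : ℕ) : ℂ) * (((n + 2 - (ℓ + 1)).choose (ℓ + 1) : ℂ) / ((n + 2 - (ℓ + 1) : ℕ) : ℂ)) *
        s ^ (n + 2 - 2 * (ℓ + 1)) =
      s * (((n + 1 : ℕ) : ℂ) * (((n + 1 - (ℓ + 1)).choose (ℓ + 1) : ℂ) /
        ((n + 1 - (ℓ + 1) : ℕ) : ℂ)) * s ^ (n + 1 - 2 * (ℓ + 1))) +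
        (n : ℂ) * (((n - ℓ).choose ℓ : ℂ) / ((n - ℓ : ℕ) : ℂ)) * s ^ (n - 2 * ℓ) := by
  rw [show n + 2 - (ℓ + 1) = n + 1 - ℓ by omega, show n + 1 - (ℓ + 1) = n - ℓ by omega,
    show n + 2 - 2 * (ℓ + 1) = n - 2 * ℓ by omega]
  -- Where subtraction of exponents is truncated, the binomial coefficient in front vanishes.
  by_cases hℓ : 2 * ℓ ≤ n
  · rw [waring_coeff hn hℓ]
    by_cases hℓ2 : 2 * ℓ = n
    · rw [Nat.choose_eq_zero_of_lt (show n - ℓ < ℓ + 1 by omega)]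
      simp
    · rw [show n - 2 * ℓ = n + 1 - 2 * (ℓ + 1) + 1 by omega, pow_succ]
      ring
  · rw [Nat.choose_eq_zero_of_lt (show n + 1 - ℓ < ℓ + 1 by omega),
      Nat.choose_eq_zero_of_lt (show n - ℓ < ℓ + 1 by omega),
      Nat.choose_eq_zero_of_lt (show n - ℓ < ℓ by omega)]
    simp

/-- Waring's formula for the power sums of two variables. -/
theorem pow_add_pow_eq_sum (a b : ℂ) : ∀ n : ℕ, 1 ≤ n → ∀ N : ℕ, n / 2 < N →
    a ^ n + b ^ n = ∑ ℓ ∈ Finset.range N, (-1) ^ ℓ * ((n : ℂ) * (((n - ℓ).choose ℓ : ℂ) /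
      ((n - ℓ : ℕ) : ℂ)) * (a + b) ^ (n - 2 * ℓ)) * (a * b) ^ ℓ := by
  intro n
  induction n using Nat.strong_induction_on with
  | _ n ih =>
    intro hn N hN
    obtain ⟨N, rfl⟩ : ∃ M, N = M + 1 := ⟨N - 1, by omega⟩
    match n, hn with
    | 1, _ =>
      rw [Finset.sum_range_succ', Finset.sum_eq_zero]
      · simp
      · intro ℓ _
        rw [Nat.choose_eq_zero_of_lt (by omega)]
        simp
    | 2, _ =>
      obtain ⟨N, rfl⟩ : ∃ M, N = M + 1 := ⟨N - 1, by omega⟩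
      rw [Finset.sum_range_succ', Finset.sum_range_succ', Finset.sum_eq_zero]
      · simp
        ring
      · intro ℓ _
        rw [Nat.choose_eq_zero_of_lt (by omega)]
        simp
    | n + 3, _ =>
      -- Leaving the number of terms free lets the two sums be taken of lengths that match after the
      -- term $\ell=0$ is split off.
      have h1 := ih (n + 2) (by omega) (by omega) (N + 1) (by omega)
      have h2 := ih (n + 1) (by omega) (by omega) N (by omega)
      have h3 : a ^ (n + 3) + b ^ (n + 3) = (a + b) * (a ^ (n + 2) + b ^ (n + 2)) -
          a * b * (a ^ (n + 1) + b ^ (n + 1)) := by ring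
      have hterm := fun ℓ => waring_term (n := n + 1) (by omega) ℓ (a + b)
      have e1 : n + 1 + 2 = n + 3 := rfl
      have e2 : n + 1 + 1 = n + 2 := rfl
      simp only [e1, e2] at hterm
      rw [h3, h1, h2, Finset.sum_range_succ', Finset.sum_range_succ', mul_add, Finset.mul_sum,
        Finset.mul_sum]
      simp only [hterm]
      rw [add_sub_right_comm, ← Finset.sum_sub_distrib]
      congr 1
      · refine Finset.sum_congr rfl fun ℓ _ => ?_
        ring
      · have e3 : ((n + 2 : ℕ) : ℂ) ≠ 0 := by norm_cast
        have e4 : ((n + 3 : ℕ) : ℂ) ≠ 0 := by norm_cast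
        simp only [pow_zero, mul_zero, Nat.sub_zero, Nat.choose_zero_right, Nat.cast_one, one_div,
          mul_one, one_mul, mul_inv_cancel₀ e3, mul_inv_cancel₀ e4]
        ring

/-- A truncation of $(1-y)(1-y)^{-k-2}=(1-y)^{-k-1}$, by Pascal's rule. In the next identity the
boundary terms for $y$ and $z=1-y$ cancel, because $(1-2y)+(1-2z)=0$. -/
theorem mul_sum_choose_succ (k : ℕ) (y : ℂ) :
    (1 - y) * ∑ ℓ ∈ Finset.range (k + 2), ((k + 1 + ℓ).choose (k + 1) : ℂ) * y ^ ℓ =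
      ∑ ℓ ∈ Finset.range (k + 1), ((k + ℓ).choose k : ℂ) * y ^ ℓ +
        ((2 * k + 1).choose k : ℂ) * y ^ (k + 1) * (1 - 2 * y) := by
  have h1 : ∀ ℓ, ((k + 1 + (ℓ + 1)).choose (k + 1) : ℂ) =
      ((k + (ℓ + 1)).choose k : ℂ) + ((k + 1 + ℓ).choose (k + 1) : ℂ) := by
    intro ℓ
    rw [show k + 1 + (ℓ + 1) = k + (ℓ + 1) + 1 by ring, Nat.choose_succ_succ,
      show k + (ℓ + 1) = k + 1 + ℓ by ring]
    push_cast
    ring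
  set T := ∑ ℓ ∈ Finset.range (k + 1), ((k + 1 + ℓ).choose (k + 1) : ℂ) * y ^ ℓ with hT
  have h2 : ∑ ℓ ∈ Finset.range (k + 2), ((k + 1 + ℓ).choose (k + 1) : ℂ) * y ^ ℓ =
      T + ((k + 1 + (k + 1)).choose (k + 1) : ℂ) * y ^ (k + 1) := by
    rw [Finset.sum_range_succ]
  have h3 : ∑ ℓ ∈ Finset.range (k + 2), ((k + 1 + ℓ).choose (k + 1) : ℂ) * y ^ ℓ =
      ∑ ℓ ∈ Finset.range (k + 2), ((k + ℓ).choose k : ℂ) * y ^ ℓ + y * T := by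
    rw [Finset.sum_range_succ', Finset.sum_range_succ' (fun ℓ => ((k + ℓ).choose k : ℂ) * y ^ ℓ),
      hT, Finset.mul_sum]
    simp only [h1, add_mul, Finset.sum_add_distrib, add_zero, Nat.choose_self]
    have : ∑ ℓ ∈ Finset.range (k + 1), ((k + 1 + ℓ).choose (k + 1) : ℂ) * y ^ (ℓ + 1) =
        ∑ ℓ ∈ Finset.range (k + 1), y * (((k + 1 + ℓ).choose (k + 1) : ℂ) * y ^ ℓ) :=
      Finset.sum_congr rfl fun ℓ _ => by ring
    rw [this]
    ring
  have h4 : ∑ ℓ ∈ Finset.range (k + 2), ((k + ℓ).choose k : ℂ) * y ^ ℓ =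
      ∑ ℓ ∈ Finset.range (k + 1), ((k + ℓ).choose k : ℂ) * y ^ ℓ +
        ((2 * k + 1).choose k : ℂ) * y ^ (k + 1) := by
    rw [Finset.sum_range_succ, show k + (k + 1) = 2 * k + 1 by ring]
  have h5 : ((k + 1 + (k + 1)).choose (k + 1) : ℂ) = 2 * ((2 * k + 1).choose k : ℂ) := by
    rw [show k + 1 + (k + 1) = 2 * k + 1 + 1 by ring, Nat.choose_succ_succ]
    have : (2 * k + 1).choose (k + 1) = (2 * k + 1).choose k := by
      rw [← Nat.choose_symm (by omega : k + 1 ≤ 2 * k + 1)]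
      congr 1
      omega
    rw [this]
    push_cast
    ring
  rw [h5] at h2
  rw [h4] at h3
  linear_combination h3 - y * h2

/-- The partial fraction identity behind the inversion of Waring's formula. -/
theorem sum_choose_mul_eq_one {y z : ℂ} (hyz : y + z = 1) (k : ℕ) :
    z ^ (k + 1) * ∑ ℓ ∈ Finset.range (k + 1), ((k + ℓ).choose k : ℂ) * y ^ ℓ +
      y ^ (k + 1) * ∑ ℓ ∈ Finset.range (k + 1), ((k + ℓ).choose k : ℂ) * z ^ ℓ = 1 := by
  induction k with
  | zero => simp [add_comm z y, hyz]
  | succ k ih =>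
    have h1 := mul_sum_choose_succ k y
    have h2 := mul_sum_choose_succ k z
    rw [show 1 - y = z by linear_combination -hyz] at h1
    rw [show 1 - z = y by linear_combination -hyz] at h2
    have hz : z = 1 - y := by linear_combination hyz
    calc _ = z ^ (k + 1) * (z * ∑ ℓ ∈ Finset.range (k + 2),
          ((k + 1 + ℓ).choose (k + 1) : ℂ) * y ^ ℓ) + y ^ (k + 1) * (y *
          ∑ ℓ ∈ Finset.range (k + 2), ((k + 1 + ℓ).choose (k + 1) : ℂ) * z ^ ℓ) := by ring
      _ = 1 := by
        rw [h1, h2]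
        linear_combination ih - 2 * ((2 * k + 1).choose k : ℂ) * y ^ (k + 1) * z ^ (k + 1) * hyz

end Waring

/-! ### The two linear systems and their mutual inversion -/

section Systems

variable {V W : Type*} [AddCommGroup V] [Module ℂ V] [AddCommGroup W] [Module ℂ W]

/-- Power sums in terms of powers of the product, for two variables of sum `t`. -/
noncomputable def toFirst (t : ℂ) (B : ℕ → V) (n : ℕ) : V :=
  ∑ ℓ ∈ Finset.range (n / 2 + 1), ((n : ℂ) * ((-1) ^ ℓ * ((n - ℓ).choose ℓ : ℂ) *
    t ^ (n - 2 * ℓ) / ((n - ℓ : ℕ) : ℂ))) • B (n - ℓ)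

/-- Powers of the product in terms of power sums, for two variables of sum `t`. -/
noncomputable def toSecond (t : ℂ) (A : ℕ → V) (m : ℕ) : V :=
  ∑ ℓ ∈ Finset.range m, (((m + ℓ - 1).choose (m - 1) : ℂ) * t ^ (-((m : ℤ) + ℓ))) • A (m - ℓ)

theorem map_toFirst (φ : V →ₗ[ℂ] W) (t : ℂ) (B : ℕ → V) (n : ℕ) :
    φ (toFirst t B n) = toFirst t (fun k => φ (B k)) n := by
  simp [toFirst]

theorem map_toSecond (φ : V →ₗ[ℂ] W) (t : ℂ) (A : ℕ → V) (m : ℕ) :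
    φ (toSecond t A m) = toSecond t (fun k => φ (A k)) m := by
  simp [toSecond]

theorem toSecond_congr {t : ℂ} {A A' : ℕ → V} (h : ∀ m, 1 ≤ m → A m = A' m) (m : ℕ) :
    toSecond t A m = toSecond t A' m := by
  refine Finset.sum_congr rfl fun ℓ hℓ => ?_
  rw [Finset.mem_range] at hℓ
  rw [h _ (by omega)]

/-- Waring's formula for $a^{-1}$ and $b^{-1}$, whose sum is $(a+b)(ab)^{-1}$; each term collects
the power $n-\ell$ of $(ab)^{-1}$. -/
theorem toFirst_pow {a b : ℂ} (ha : a ≠ 0) (hb : b ≠ 0) {n : ℕ} (hn : 1 ≤ n) :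
    toFirst (a + b) (fun k => ((a * b)⁻¹) ^ k) n = (a⁻¹) ^ n + (b⁻¹) ^ n := by
  rw [pow_add_pow_eq_sum _ _ n hn (n / 2 + 1) (by omega), toFirst]
  refine Finset.sum_congr rfl fun ℓ hℓ => ?_
  rw [Finset.mem_range] at hℓ
  have h1 : a⁻¹ + b⁻¹ = (a + b) * (a * b)⁻¹ := by
    field_simp
    ring
  rw [h1, mul_pow, show n - ℓ = n - 2 * ℓ + ℓ by omega, pow_add, smul_eq_mul, mul_inv]
  ring

/-- The partial fraction identity with $y=a/(a+b)$ and $z=b/(a+b)$, multiplied by $(ab)^{-m}$. -/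
theorem toSecond_pow {a b : ℂ} (ha : a ≠ 0) (hb : b ≠ 0) (hab : a + b ≠ 0) {m : ℕ} (hm : 1 ≤ m) :
    toSecond (a + b) (fun k => (a⁻¹) ^ k + (b⁻¹) ^ k) m = ((a * b)⁻¹) ^ m := by
  obtain ⟨k, rfl⟩ : ∃ k, m = k + 1 := ⟨m - 1, by omega⟩
  have h1 := sum_choose_mul_eq_one (y := a / (a + b)) (z := b / (a + b)) (by field_simp) k
  rw [toSecond, ← mul_one (((a * b)⁻¹) ^ (k + 1)), ← h1, mul_add, Finset.mul_sum, Finset.mul_sum,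
    Finset.mul_sum, Finset.mul_sum, ← Finset.sum_add_distrib]
  refine Finset.sum_congr rfl fun ℓ hℓ => ?_
  rw [Finset.mem_range] at hℓ
  have h2 : a⁻¹ ^ (k + 1) = a⁻¹ ^ (k + 1 - ℓ) * a⁻¹ ^ ℓ := by
    rw [← pow_add]
    congr 1
    omega
  have h3 : b⁻¹ ^ (k + 1) = b⁻¹ ^ (k + 1 - ℓ) * b⁻¹ ^ ℓ := by
    rw [← pow_add]
    congr 1
    omega
  have h4 : (a + b) ^ (-(((k + 1 : ℕ) : ℤ) + ℓ)) = ((a + b)⁻¹) ^ (k + 1) * ((a + b)⁻¹) ^ ℓ := by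
    rw [← pow_add, zpow_neg, inv_pow]
    norm_cast
  have h5 : a⁻¹ ^ ℓ * a ^ ℓ = 1 := by
    rw [← mul_pow, inv_mul_cancel₀ ha, one_pow]
  have h6 : b⁻¹ ^ ℓ * b ^ ℓ = 1 := by
    rw [← mul_pow, inv_mul_cancel₀ hb, one_pow]
  have h7 : a⁻¹ ^ (k + 1) * a ^ (k + 1) = 1 := by
    rw [← mul_pow, inv_mul_cancel₀ ha, one_pow]
  have h8 : b⁻¹ ^ (k + 1) * b ^ (k + 1) = 1 := by
    rw [← mul_pow, inv_mul_cancel₀ hb, one_pow]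
  have h9 : ((a * b)⁻¹) ^ (k + 1) * ((b / (a + b)) ^ (k + 1) * (a / (a + b)) ^ ℓ) =
      a⁻¹ ^ (k + 1 - ℓ) * (((a + b)⁻¹) ^ (k + 1) * ((a + b)⁻¹) ^ ℓ) := by
    rw [mul_inv, mul_pow, div_eq_mul_inv, div_eq_mul_inv, mul_pow, mul_pow, h2]
    linear_combination (a⁻¹ ^ (k + 1 - ℓ) * (((a + b)⁻¹) ^ (k + 1) * ((a + b)⁻¹) ^ ℓ)) *
      (h5 * b⁻¹ ^ (k + 1) * b ^ (k + 1) + h8)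
  have h10 : ((a * b)⁻¹) ^ (k + 1) * ((a / (a + b)) ^ (k + 1) * (b / (a + b)) ^ ℓ) =
      b⁻¹ ^ (k + 1 - ℓ) * (((a + b)⁻¹) ^ (k + 1) * ((a + b)⁻¹) ^ ℓ) := by
    rw [mul_inv, mul_pow, div_eq_mul_inv, div_eq_mul_inv, mul_pow, mul_pow, h3]
    linear_combination (b⁻¹ ^ (k + 1 - ℓ) * (((a + b)⁻¹) ^ (k + 1) * ((a + b)⁻¹) ^ ℓ)) *
      (h6 * a⁻¹ ^ (k + 1) * a ^ (k + 1) + h7)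
  rw [smul_eq_mul, h4, show k + 1 + ℓ - 1 = k + ℓ by omega, show k + 1 - 1 = k by omega]
  linear_combination -((k + ℓ).choose k : ℂ) * (h9 + h10)

theorem exists_add_eq_mul_eq (t p : ℂ) : ∃ a b : ℂ, a + b = t ∧ a * b = p := by
  obtain ⟨s, hs⟩ := IsAlgClosed.exists_pow_nat_eq (t ^ 2 - 4 * p) two_pos
  refine ⟨(t + s) / 2, (t - s) / 2, by ring, ?_⟩
  linear_combination -hs / 4

open Polynomial in
-- Both transforms are linear, so the universal sequence $X^k$ of polynomials suffices. There the
-- identity holds at every $u\neq0$, because $u=(ab)^{-1}$ for some $a,b$ with sum $t$; the linear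
-- map $X^k\mapsto B_k$ carries it to an arbitrary sequence.
theorem toSecond_toFirst {t : ℂ} (ht : t ≠ 0) (B : ℕ → ℂ) {m : ℕ} (hm : 1 ≤ m) :
    toSecond t (toFirst t B) m = B m := by
  have hpoly : toSecond t (toFirst t fun k => (X : ℂ[X]) ^ k) m = X ^ m := by
    refine Polynomial.eq_of_infinite_eval_eq _ _ ?_
    refine Set.Infinite.mono (s := {u : ℂ | u ≠ 0}) (fun u hu => ?_) ?_
    · obtain ⟨a, b, hab, hp⟩ := exists_add_eq_mul_eq t u⁻¹
      have hp0 : a * b ≠ 0 := by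
        rw [hp]
        exact inv_ne_zero hu
      have ha := left_ne_zero_of_mul hp0
      have hb := right_ne_zero_of_mul hp0
      have hu' : u = (a * b)⁻¹ := by rw [hp, inv_inv]
      have h1 := map_toSecond (Polynomial.leval u) t (toFirst t fun k => (X : ℂ[X]) ^ k) m
      simp only [map_toFirst] at h1
      simp only [Polynomial.leval_apply, eval_pow, eval_X] at h1
      change eval u _ = eval u _
      rw [h1, eval_pow, eval_X, hu', ← hab, ← toSecond_pow ha hb (by rwa [hab]) hm]
      exact toSecond_congr (fun n hn => toFirst_pow ha hb hn) m
    · exact (Set.finite_singleton (0 : ℂ)).infinite_compl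
  have h1 := congrArg ((Polynomial.basisMonomials ℂ).constr ℂ B) hpoly
  have h2 : ∀ k, (Polynomial.basisMonomials ℂ).constr ℂ B (X ^ k) = B k := by
    intro k
    have := (Polynomial.basisMonomials ℂ).constr_basis ℂ B k
    simpa only [Polynomial.coe_basisMonomials, Polynomial.monomial_one_right_eq_X_pow] using this
  rw [map_toSecond] at h1
  simp only [map_toFirst, h2] at h1
  exact h1

/-- The system is triangular, with diagonal entries $t^{-n}\ne0$. -/
theorem toSecond_injective {t : ℂ} (ht : t ≠ 0) {A A' : ℕ → ℂ}
    (h : ∀ m, 1 ≤ m → toSecond t A m = toSecond t A' m) : ∀ n, 1 ≤ n → A n = A' n := by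
  intro n
  induction n using Nat.strong_induction_on with
  | _ n ih =>
    intro hn
    have h1 := h n hn
    obtain ⟨k, rfl⟩ : ∃ k, n = k + 1 := ⟨n - 1, by omega⟩
    rw [toSecond, toSecond, Finset.sum_range_succ', Finset.sum_range_succ'] at h1
    have h2 : ∀ ℓ ∈ Finset.range k, A (k + 1 - (ℓ + 1)) = A' (k + 1 - (ℓ + 1)) := by
      intro ℓ hℓ
      rw [Finset.mem_range] at hℓ
      exact ih _ (by omega) (by omega)
    rw [Finset.sum_congr rfl fun ℓ hℓ => by rw [h2 ℓ hℓ]] at h1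
    have h3 := add_left_cancel h1
    simp only [add_zero, Nat.sub_zero, Nat.choose_self, Nat.cast_one, one_mul, smul_eq_mul] at h3
    exact mul_left_cancel₀ (zpow_ne_zero _ ht) h3

theorem toFirst_iff_toSecond {t : ℂ} (ht : t ≠ 0) (A B : ℕ → ℂ) :
    (∀ n, 1 ≤ n → A n = toFirst t B n) ↔ ∀ m, 1 ≤ m → B m = toSecond t A m := by
  constructor
  · intro h m hm
    rw [toSecond_congr h, toSecond_toFirst ht B hm]
  · intro h
    refine toSecond_injective ht fun m hm => ?_
    rw [toSecond_toFirst ht B hm, h m hm]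

theorem eq_toFirst_iff (t : ℂ) (A B : ℕ → ℂ) {n : ℕ} (hn : 1 ≤ n) :
    A n = toFirst t B n ↔ A n / n = ∑ ℓ ∈ Finset.range (n / 2 + 1),
        (-1) ^ ℓ * ((n - ℓ).choose ℓ : ℂ) * t ^ (n - 2 * ℓ)
          * (B (n - ℓ) / ((n - ℓ : ℕ) : ℂ)) := by
  have hn0 : (n : ℂ) ≠ 0 := by
    norm_cast
    omega
  rw [div_eq_iff hn0, Finset.sum_mul, toFirst]
  have : ∀ ℓ, ((n : ℂ) * ((-1) ^ ℓ * ((n - ℓ).choose ℓ : ℂ) * t ^ (n - 2 * ℓ) /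
      ((n - ℓ : ℕ) : ℂ))) • B (n - ℓ) = (-1) ^ ℓ * ((n - ℓ).choose ℓ : ℂ) * t ^ (n - 2 * ℓ)
          * (B (n - ℓ) / ((n - ℓ : ℕ) : ℂ)) * n := fun ℓ => by
    rw [smul_eq_mul]
    ring
  simp only [this]

theorem hasSum_toFirst {ι : Type*} {g : ℕ → ι → ℂ} {B : ℕ → ℂ} (t : ℂ)
    (h : ∀ m, 1 ≤ m → HasSum (g m) (B m)) {n : ℕ} (hn : 1 ≤ n) :
    HasSum (fun k => toFirst t (fun m => g m k) n) (toFirst t B n) := by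
  refine hasSum_sum fun ℓ hℓ => ?_
  rw [Finset.mem_range] at hℓ
  exact (h _ (by omega)).mul_left _

end Systems

/-! ### Values at positive integers -/

namespace PrimaryFunction

variable (P : PrimaryFunction)

theorem cpow_neg_natCast (z : ℂ) (n : ℕ) : z ^ (-(n : ℂ)) = z⁻¹ ^ n := by
  rw [Complex.cpow_neg, Complex.cpow_natCast, inv_pow]

theorem hasSum_zetaFirst {x : ℂ} (hx : P.Ξ x ≠ 0) {n : ℕ} (hn : 2 ≤ n) :
    HasSum (fun ρ : P.Zeros => (P.mult ρ : ℂ) * (x - ρ) ^ (-(n : ℂ)))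
      ((-1) ^ (n - 1) / ((n - 1).factorial : ℂ) * P.logXiDeriv n x) := by
  obtain ⟨k, rfl⟩ : ∃ k, n = k + 2 := ⟨n - 2, by omega⟩
  refine (P.Ξ_order.growthAtMostOne.hasSum_pow P.differentiable_Ξ hx k).of_eq (fun ρ => ?_) ?_
  · rw [cpow_neg_natCast, inv_pow]
    rfl
  · rw [logXiDeriv]
    rfl

theorem zetaFirstInt_eq {x : ℂ} (hx : P.Ξ x ≠ 0) {n : ℕ} (hn : 1 ≤ n) :
    P.zetaFirstInt n x = (-1) ^ (n - 1) / ((n - 1).factorial : ℂ) * P.logXiDeriv n x := by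
  by_cases h1 : n = 1
  · subst h1
    rw [zetaFirstInt, if_pos rfl, (P.hasSum_pairs_logDeriv hx).tsum_eq]
    simp [logXiDeriv]
  · rw [zetaFirstInt, if_neg h1, zetaFirst]
    exact (P.hasSum_zetaFirst hx (by omega)).tsum_eq

theorem hasSum_zetaFirstInt {x : ℂ} (hx : P.Ξ x ≠ 0) {n : ℕ} (hn : 1 ≤ n) :
    HasSum (fun ρ : P.UpperZeros => (P.mult ρ : ℂ) * ((x - ρ)⁻¹ ^ n + (x - 1 + ρ)⁻¹ ^ n))
      (P.zetaFirstInt n x) := by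
  rw [P.zetaFirstInt_eq hx hn]
  by_cases h1 : n = 1
  · subst h1
    refine (P.hasSum_pairs_logDeriv hx).of_eq (fun ρ => ?_) ?_
    · simp
    · simp [logXiDeriv]
  · refine (P.hasSum_pairs (P.hasSum_zetaFirst hx (n := n) (by omega))).of_eq (fun ρ => ?_) rfl
    rw [coe_upper, coe_lower, P.mult_one_sub, cpow_neg_natCast, cpow_neg_natCast,
      show x - (1 - (ρ : ℂ)) = x - 1 + ρ by ring]
    ring

theorem hasSum_zetaSecond {x : ℂ} (hx : P.Ξ x ≠ 0) {m : ℕ} (hm : 1 ≤ m) :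
    HasSum (fun ρ : P.UpperZeros => (P.mult ρ : ℂ) * (tau ρ ^ 2 + (x - 1 / 2) ^ 2) ^ (-(m : ℂ)))
      (P.zetaSecond m ((x - 1 / 2) ^ 2)) := by
  refine Summable.hasSum ?_
  have hm' : (1 : ℝ) ≤ m := by exact_mod_cast hm
  refine (P.convergesBeyond_tau_sq_add (P.tau_sq_add_ne_zero_iff.2 hx)).summable_cpow ?_
  rw [Complex.natCast_re]
  linarith

theorem hasSum_zetaSecond_mul {x : ℂ} (hx : P.Ξ x ≠ 0) {m : ℕ} (hm : 1 ≤ m) :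
    HasSum (fun ρ : P.UpperZeros => (P.mult ρ : ℂ) * ((x - ρ) * (x - 1 + ρ))⁻¹ ^ m)
      (P.zetaSecond m ((x - 1 / 2) ^ 2)) :=
  (P.hasSum_zetaSecond hx hm).of_eq
    (fun ρ => by rw [cpow_neg_natCast, tau_sq_add]) rfl

/-- Waring's formula for each pair, with the common sum $2x-1$, summed over the pairs. -/
theorem zetaFirstInt_eq_toFirst {x : ℂ} (hx : P.Ξ x ≠ 0) {n : ℕ} (hn : 1 ≤ n) :
    P.zetaFirstInt n x = toFirst (2 * x - 1) (fun m => P.zetaSecond m ((x - 1 / 2) ^ 2)) n := by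
  refine (P.hasSum_zetaFirstInt hx hn).unique
    ((hasSum_toFirst (2 * x - 1) (fun m hm => P.hasSum_zetaSecond_mul hx hm) hn).of_eq
      (fun ρ => ?_) rfl)
  have h0 := P.tau_sq_add_ne_zero_iff.2 hx ρ
  rw [tau_sq_add] at h0
  have h1 := toFirst_pow (left_ne_zero_of_mul h0) (right_ne_zero_of_mul h0) hn
  rw [show x - ρ + (x - 1 + ρ) = 2 * x - 1 by ring] at h1
  rw [← h1]
  exact map_toFirst (LinearMap.mulLeft ℂ (P.mult ρ : ℂ)) _ _ _

/-- At $x=\tfrac12$ the sum of a pair is $0$ and the inversion breaks down, but the two factors are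
opposite, so their product is minus a square. -/
theorem zetaSecond_zero_eq {m : ℕ} (hm : 1 ≤ m) :
    P.zetaSecond m 0 = 1 / 2 * (-1) ^ m * P.zetaFirstInt (2 * m) (1 / 2) := by
  have h1 := P.hasSum_zetaSecond_mul P.Ξ_half_ne_zero hm
  rw [sub_self, zero_pow two_ne_zero] at h1
  refine h1.unique (((P.hasSum_zetaFirstInt P.Ξ_half_ne_zero (n := 2 * m) (by omega)).mul_left
    (1 / 2 * (-1) ^ m)).of_eq (fun ρ => ?_) rfl)
  rw [show (1 : ℂ) / 2 - 1 + ρ = -(1 / 2 - ρ) by ring, mul_neg, inv_neg, inv_neg,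
    Even.neg_pow (even_two_mul m), neg_pow, mul_inv, mul_pow, two_mul m, pow_add]
  ring

end PrimaryFunction

/-! ### The main theorem -/

theorem sq_half_add_sub (w : ℂ) : (1 / 2 + w - 1 / 2) ^ 2 = w ^ 2 := by
  ring

theorem cpow_half_sq (v : ℂ) : (v ^ (1 / 2 : ℂ)) ^ 2 = v := by
  rw [one_div, Complex.cpow_ofNat_inv_pow]

theorem mainTheorem7 (P : PrimaryFunction) :
    -- the meromorphic continuations exist and are regular at exponent `0`
    (∀ v : ℂ, P.SecondAdmissible v → ∃ F, P.IsSecondContinuation v F) ∧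
    (∀ x : ℂ, P.FirstAdmissible x → ∃ F, P.IsFirstContinuation x F) ∧
    (∀ x : ℂ, P.TrivialAdmissible x → ∃ F, P.IsTrivialContinuation x F) ∧
    -- the zeta-regularized product of the second family
    (∀ v : ℂ, P.SecondAdmissible v →
      P.detSecond v = Complex.exp (-(P.b₀ + P.b₁ / 2)) * P.Ξ (1 / 2 + v ^ (1 / 2 : ℂ)) ∧
      P.detSecond v = Complex.exp (-(P.b₀ + P.b₁ / 2)) * P.Ξ (1 / 2 - v ^ (1 / 2 : ℂ)) ∧
      (P.FirstAdmissible (1 / 2 + v ^ (1 / 2 : ℂ)) →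
        P.detSecond v =
          Complex.exp (P.b₁ * v ^ (1 / 2 : ℂ)) * P.detFirst (1 / 2 + v ^ (1 / 2 : ℂ)))) ∧
    -- the symmetric factorization of `(x - 1) ^ q * L x`
    (∀ x : ℂ, P.TrivialAdmissible x → P.SecondAdmissible ((x - 1 / 2) ^ 2) →
      (x ≠ 1 ∨ P.q = 0 → (x - 1) ^ P.q * P.L x =
        Complex.exp (-P.b₁ * (x - 1 / 2)) * P.detTrivial x * P.detSecond ((x - 1 / 2) ^ 2)) ∧
      Tendsto (fun z : ℂ => (z - 1) ^ P.q * P.L z) (𝓝[≠] x)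
        (𝓝 (Complex.exp (-P.b₁ * (x - 1 / 2)) * P.detTrivial x
          * P.detSecond ((x - 1 / 2) ^ 2)))) ∧
    -- the derivative at `0`: `b₁ / 2 + b₀ - log Ξ (1 / 2 ± v ^ (1 / 2))`, where the logarithm is the
    -- analytic determination in `v` that agrees with `logXi` for `re x > 1`
    AnalyticOnNhd ℂ P.zetaSecondDerivZero {v : ℂ | P.SecondAdmissible v} ∧
    (∀ x : ℂ, 1 < x.re → P.SecondAdmissible ((x - 1 / 2) ^ 2) ∧
      P.zetaSecondDerivZero ((x - 1 / 2) ^ 2) = P.b₁ / 2 + P.b₀ - P.logXi x) ∧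
    -- convergence of the series at positive integers
    (∀ x : ℂ, P.Ξ x ≠ 0 →
      (Summable fun ρ : P.UpperZeros => (P.mult ρ : ℂ) * ((x - ρ)⁻¹ + (x - 1 + ρ)⁻¹)) ∧
      (∀ n : ℕ, 2 ≤ n → Summable fun ρ : P.Zeros => (P.mult ρ : ℂ) * (x - ρ) ^ (-(n : ℂ))) ∧
      (∀ m : ℕ, 1 ≤ m → Summable fun ρ : P.UpperZeros =>
        (P.mult ρ : ℂ) * (PrimaryFunction.tau ρ ^ 2 + (x - 1 / 2) ^ 2) ^ (-(m : ℂ)))) ∧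
    -- the first family in terms of the second
    (∀ x : ℂ, P.Ξ x ≠ 0 → ∀ n : ℕ, 1 ≤ n →
      P.zetaFirstInt n x / n = ∑ ℓ ∈ Finset.range (n / 2 + 1),
        (-1) ^ ℓ * ((n - ℓ).choose ℓ : ℂ) * (2 * x - 1) ^ (n - 2 * ℓ)
          * (P.zetaSecond ((n - ℓ : ℕ) : ℂ) ((x - 1 / 2) ^ 2) / ((n - ℓ : ℕ) : ℂ))) ∧
    -- the second family in terms of the first
    (∀ x : ℂ, P.Ξ x ≠ 0 → x ≠ 1 / 2 → ∀ m : ℕ, 1 ≤ m →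
      P.zetaSecond m ((x - 1 / 2) ^ 2) = ∑ ℓ ∈ Finset.range m,
        ((m + ℓ - 1).choose (m - 1) : ℂ) * (2 * x - 1) ^ (-((m : ℤ) + ℓ))
          * P.zetaFirstInt (m - ℓ) x) ∧
    (∀ m : ℕ, 1 ≤ m →
      P.zetaSecond m 0 = 1 / 2 * (-1) ^ m * P.zetaFirstInt (2 * m) (1 / 2)) ∧
    -- the two systems of linear relations are mutually inverse
    (∀ x : ℂ, x ≠ 1 / 2 → ∀ A B : ℕ → ℂ,
      (∀ n : ℕ, 1 ≤ n → A n / n = ∑ ℓ ∈ Finset.range (n / 2 + 1),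
        (-1) ^ ℓ * ((n - ℓ).choose ℓ : ℂ) * (2 * x - 1) ^ (n - 2 * ℓ)
          * (B (n - ℓ) / ((n - ℓ : ℕ) : ℂ))) ↔
      (∀ m : ℕ, 1 ≤ m → B m = ∑ ℓ ∈ Finset.range m,
        ((m + ℓ - 1).choose (m - 1) : ℂ) * (2 * x - 1) ^ (-((m : ℤ) + ℓ)) * A (m - ℓ))) ∧
    -- the transcendental values in terms of the derivatives of `log Ξ`
    (∀ x : ℂ, P.Ξ x ≠ 0 → x ≠ 1 / 2 → ∀ m : ℕ, 1 ≤ m →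
      P.zetaSecond m ((x - 1 / 2) ^ 2) = -∑ ℓ ∈ Finset.range m,
        ((m + ℓ - 1).choose (m - 1) : ℂ)
          * ((1 - 2 * x) ^ (-((m : ℤ) + ℓ)) / ((m - ℓ - 1).factorial : ℂ))
          * P.logXiDeriv (m - ℓ) x) ∧
    (∀ m : ℕ, 1 ≤ m →
      P.zetaSecond m 0 =
        (-1) ^ (m + 1) / (2 * ((2 * m - 1).factorial : ℂ)) * P.logXiDeriv (2 * m) (1 / 2)) := by
  have htwo : ∀ x : ℂ, x ≠ 1 / 2 → 2 * x - 1 ≠ 0 := by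
    intro x hx h
    apply hx
    linear_combination h / 2
  have hsecond : ∀ x : ℂ, P.Ξ x ≠ 0 → x ≠ 1 / 2 → ∀ m : ℕ, 1 ≤ m →
      P.zetaSecond m ((x - 1 / 2) ^ 2) = ∑ ℓ ∈ Finset.range m,
        ((m + ℓ - 1).choose (m - 1) : ℂ) * (2 * x - 1) ^ (-((m : ℤ) + ℓ))
          * P.zetaFirstInt (m - ℓ) x := by
    intro x hx hx2 m hm
    exact (toFirst_iff_toSecond (htwo x hx2) (fun n => P.zetaFirstInt n x)
      (fun m => P.zetaSecond m ((x - 1 / 2) ^ 2))).1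
      (fun n hn => P.zetaFirstInt_eq_toFirst hx hn) m hm
  -- Here `w` is either square root of `v`, which yields both signs in the formula.
  have hsec : ∀ v w : ℂ, w ^ 2 = v → P.SecondAdmissible v → P.Ξ (1 / 2 + w) ≠ 0 ∧
      P.detSecond v = Complex.exp (-(P.b₀ + P.b₁ / 2)) * P.Ξ (1 / 2 + w) := by
    intro v w hw hv
    have h1 : P.Ξ (1 / 2 + w) ≠ 0 := by
      rw [← P.tau_sq_add_ne_zero_iff, sq_half_add_sub, hw]
      exact P.ne_zero_of_secondAdmissible hv
    refine ⟨h1, ?_⟩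
    rw [← P.detSecond_eq h1, sq_half_add_sub, hw]
  refine ⟨fun v hv => ?_, fun x hx => ?_, fun x hx => ?_, fun v hv => ⟨?_, ?_, fun hx => ?_⟩,
    fun x hx hv => ?_, P.analyticOnNhd_zetaSecondDerivZero,
    fun x hx => ⟨P.secondAdmissible_of_one_lt_re hx, P.zetaSecondDerivZero_eq hx⟩,
    fun x hx => ⟨(P.hasSum_pairs_logDeriv hx).summable,
      fun n hn => (P.hasSum_zetaFirst hx hn).summable,
      fun m hm => (P.hasSum_zetaSecond hx hm).summable⟩,
    fun x hx n hn => (eq_toFirst_iff _ (fun n => P.zetaFirstInt n x)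
      (fun m => P.zetaSecond m ((x - 1 / 2) ^ 2)) hn).1 (P.zetaFirstInt_eq_toFirst hx hn),
    hsecond, fun m hm => P.zetaSecond_zero_eq hm, fun x hx A B => ?_, fun x hx hx2 m hm => ?_,
    fun m hm => ?_⟩
  · obtain ⟨F, hF, -⟩ := P.exists_firstContinuation P.Ξ_half_ne_zero
    obtain ⟨F', hF', -⟩ := P.exists_secondContinuation hF (P.ne_zero_of_secondAdmissible hv)
    exact ⟨F', hF'⟩
  · obtain ⟨F, hF, -⟩ := P.exists_firstContinuation (P.Ξ_ne_zero_of_firstAdmissible hx)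
    exact ⟨F, hF⟩
  · exact P.exists_trivialContinuation (P.G_ne_zero_of_trivialAdmissible hx)
  · exact (hsec v _ (cpow_half_sq v) hv).2
  · have := (hsec v (-v ^ (1 / 2 : ℂ)) (by rw [neg_sq, cpow_half_sq]) hv).2
    rwa [← sub_eq_add_neg] at this
  · obtain ⟨h1, h2⟩ := hsec v _ (cpow_half_sq v) hv
    rw [h2, P.detFirst_eq h1, mul_left_comm, ← Complex.exp_add, mul_comm]
    congr 2
    ring
  · have hG := P.G_ne_zero_of_trivialAdmissible hx
    have hΞ := P.tau_sq_add_ne_zero_iff.1 (P.ne_zero_of_secondAdmissible hv)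
    rw [P.detTrivial_mul_detSecond hG hΞ]
    exact ⟨P.G_mul_Ξ_eq, P.G_mul_Ξ_tendsto x⟩
  · refine Iff.trans ?_ (toFirst_iff_toSecond (htwo x hx) A B)
    exact forall₂_congr fun n hn => (eq_toFirst_iff _ A B hn).symm
  · rw [hsecond x hx hx2 m hm, ← Finset.sum_neg_distrib]
    refine Finset.sum_congr rfl fun ℓ hℓ => ?_
    rw [Finset.mem_range] at hℓ
    obtain ⟨j, rfl⟩ : ∃ j, m = j + 1 + ℓ := ⟨m - ℓ - 1, by omega⟩
    rw [P.zetaFirstInt_eq hx (by omega), show (1 : ℂ) - 2 * x = (-1) * (2 * x - 1) by ring, mul_zpow,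
      show j + 1 + ℓ - ℓ = j + 1 by omega, show j + 1 - 1 = j by omega]
    -- The exponent $m+\ell=j+1+2\ell$ has the parity of $j+1$; this is the sign $(-1)^j$ of the
    -- logarithmic derivative together with the overall minus.
    have h1 : (-1 : ℂ) ^ (-(((j + 1 + ℓ : ℕ) : ℤ) + ℓ)) = -(-1) ^ j := by
      rw [zpow_neg, ← inv_zpow, inv_neg_one]
      norm_cast
      rw [show j + 1 + ℓ + ℓ = j + 1 + 2 * ℓ by ring, pow_add, pow_mul, pow_succ]
      simp
    rw [h1]
    ring
  · rw [P.zetaSecond_zero_eq hm, P.zetaFirstInt_eq P.Ξ_half_ne_zero (by omega)]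
    obtain ⟨j, rfl⟩ : ∃ j, m = j + 1 := ⟨m - 1, by omega⟩
    have h1 : (-1 : ℂ) ^ (2 * (j + 1) - 1) = -1 := by
      rw [show 2 * (j + 1) - 1 = 2 * j + 1 by omega, pow_succ, pow_mul]
      simp
    rw [h1]
    ring
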